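/- **Lemma A.6 (CLT for quadratic forms of panel data dependent over both dimensions).** *Kernel and bandwidth.* Let $K:\mathbb R\to\mathbb R$ be continuous and symmetric, with $K(u)=0$ for $|u|>1$ and $K(0)=1$. Let $(N,T)=(N_n,T_n)\to(\infty,\infty)$ along a sequence, and let $h=h_n$ satisfy $h\to0$, $Th\to\infty$, $hT^2/N^2\to0$ and $hN^2/T^2\to0$. *Errors.* For every $N$ let $(e_t)_{t\in\mathbb Z}$ be i.i.d. random elements of a measurable space (both may depend on $N$), let $g=(g_1,\dots,g_N)^\top$ be measurable, and let $\varepsilon_t=(\varepsilon_{1t},\dots,\varepsilon_{Nt})^\top=g(e_t,e_{t-1},\dots)$. Suppose that $\varepsilon_t$ is square integrable with $E\varepsilon_t=0$ and that the spectral norm of $E[\varepsilon_t\varepsilon_t^\top]$ is bounded by a constant that does not depend on $N$. With $e_0'$ an independent copy of $e_0$, independent of $(e_t)_{t\in\mathbb Z}$, and $\varepsilon_m^*=g(e_m,\dots,e_1,e_0',e_{-1},\dots)$, suppose that for some $\alpha>3$ and $C<\infty$ not depending on $N$, $$\sup_{v\in\mathbb R^N,\ \|v\|=1}\Big(E\big|v^\top\varepsilon_m-v^\top\varepsilon_m^*\big|^4\Big)^{1/4}\le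 C\,(m+1)^{-\alpha}\qquad\text{for all } m\ge0 \text{ and all } N .$$ *Weights.* Let $r$ be fixed and, for every $N$, let $\Lambda=(\lambda_1,\dots,\lambda_N)^\top$ be a nonrandom $N\times r$ matrix (which may depend on $N$), with $\Lambda^\top\Lambda$ nonsingular for all large $N$; put $a_i=\lambda_i^\top\big(\tfrac1N\Lambda^\top\Lambda\big)^{-1}\tfrac1N\sum_{j=1}^N\lambda_j$. Let $\bar\varepsilon_{t,a}=\frac1{\sqrt N}\sum_{i=1}^N(1-a_i)\varepsilon_{it}$ and suppose that the limit $$\sigma^2_{\varepsilon,a}=\lim\frac1T\sum_{t,s=1}^T E(\bar\varepsilon_{t,a}\bar\varepsilon_{s,a})\,K\Big(\frac{t-s}{Th}\Big)$$ exists in $\mathbb R$ along the given sequence. Then $$Q_T=\frac1{TN}\sum_{i,j=1}^N\sum_{t,s=1}^T(1-a_i)(1-a_j)\,\varepsilon_{it}\varepsilon_{js}\,K\Big(\frac{t-s}{Th}\Big)$$ satisfies $$h^{-1/2}\,[Q_T-E Q_T]\ \to_D\ N\big(0,\,2\nu_0\sigma^4_{\varepsilon,a}\big),\qquad \nu_0=\int_{-1}^1K^2(u)\,du,$$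 where $N(0,0)$ is the point mass at $0$. -/

import Mathlib

open MeasureTheory ProbabilityTheory Filter Topology

noncomputable section

namespace PanelCLT

/-- A kernel: continuous, symmetric, vanishing outside `[-1, 1]`, with `K 0 = 1`. -/
structure IsKernel (K : ℝ → ℝ) : Prop where
  continuous : Continuous K
  symm : ∀ u, K (-u) = K u
  support : ∀ u, 1 < |u| → K u = 0
  zero : K 0 = 1

/-- The joint limit `(N, T) → ∞`, taken along an arbitrary path `n ↦ (N n, T n)`, together with
the rates imposed on the bandwidth `h` along that path. Positivity of `h n` for large `n` follows
from `T h → ∞`. -/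
structure IsBandwidth (N T : ℕ → ℕ) (h : ℕ → ℝ) : Prop where
  tendsto_N : Tendsto N atTop atTop
  tendsto_T : Tendsto T atTop atTop
  tendsto_h : Tendsto h atTop (𝓝 0)
  tendsto_Th : Tendsto (fun n => (T n : ℝ) * h n) atTop atTop
  tendsto_hTN : Tendsto (fun n => h n * (T n : ℝ) ^ 2 / (N n : ℝ) ^ 2) atTop (𝓝 0)
  tendsto_hNT : Tendsto (fun n => h n * (N n : ℝ) ^ 2 / (T n : ℝ) ^ 2) atTop (𝓝 0)

section Errors

variable {Ω E : Type*} {N : ℕ}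

/-- The past `(e_t, e_{t-1}, e_{t-2}, …)` of the innovations. -/
def past (e : ℤ → Ω → E) (t : ℤ) (ω : Ω) : ℕ → E := fun k => e (t - k) ω

/-- The error vector `ε_t = g(e_t, e_{t-1}, …)` in `ℝ^N`. -/
def err (e : ℤ → Ω → E) (g : (ℕ → E) → EuclideanSpace ℝ (Fin N)) (t : ℤ) (ω : Ω) :
    EuclideanSpace ℝ (Fin N) :=
  g (past e t ω)

/-- The coupled error vector `ε_m^* = g(e_m, …, e_1, e_0', e_{-1}, …)`. It lives on `Ω × Ω`
(with the product measure): the innovations are read off the first coordinate, and `e_0'` is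
`e_0` evaluated at the second coordinate, hence an independent copy. -/
def errCoupled (e : ℤ → Ω → E) (g : (ℕ → E) → EuclideanSpace ℝ (Fin N)) (m : ℕ) (p : Ω × Ω) :
    EuclideanSpace ℝ (Fin N) :=
  g (Function.update (past e m p.1) m (e 0 p.2))

/-- The functional dependence measure
`sup_{‖v‖ = 1} | v^⊤ ε_m - v^⊤ ε_m^* |_4`, with `|·|_4` the `L^4` norm. -/
def dependence [MeasurableSpace Ω] (P : Measure Ω) (e : ℤ → Ω → E)
    (g : (ℕ → E) → EuclideanSpace ℝ (Fin N)) (m : ℕ) : ENNReal :=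
  ⨆ (v : EuclideanSpace ℝ (Fin N)) (_ : ‖v‖ = 1),
    eLpNorm (fun p : Ω × Ω => inner ℝ v (err e g m p.1) - inner ℝ v (errCoupled e g m p))
      4 (P.prod P)

/-- The second moment matrix `E[ε_t ε_t^⊤]`. -/
def secondMoment [MeasurableSpace Ω] (P : Measure Ω) (e : ℤ → Ω → E)
    (g : (ℕ → E) → EuclideanSpace ℝ (Fin N)) (t : ℤ) : Matrix (Fin N) (Fin N) ℝ :=
  Matrix.of fun i j => ∫ ω, err e g t ω i * err e g t ω j ∂P

end Errors

/-- The assumptions on the panel of errors. For every cross-section size `N` the errors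
`ε_t = g_N(e_t, e_{t-1}, …)` are a measurable function of the past of i.i.d. innovations
(and hence a stationary process), centred, square integrable, with `E[ε_t ε_t^⊤]` bounded in
spectral norm uniformly in `N`, and with functional dependence measure `O(m^{-α})`, `α > 3`,
uniformly in `N`. -/
structure IsErrorPanel {Ω : Type*} [MeasurableSpace Ω] (P : Measure Ω) {E : ℕ → Type*}
    [∀ N, MeasurableSpace (E N)] (e : ∀ N, ℤ → Ω → E N)
    (g : ∀ N, (ℕ → E N) → EuclideanSpace ℝ (Fin N)) : Prop where
  measurable_e : ∀ N t, Measurable (e N t)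
  indep : ∀ N, iIndepFun (e N) P
  identDistrib : ∀ N t, IdentDistrib (e N t) (e N 0) P P
  measurable_g : ∀ N, Measurable (g N)
  memLp_two : ∀ N t i, MemLp (fun ω => err (e N) (g N) t ω i) 2 P
  mean_zero : ∀ N t i, ∫ ω, err (e N) (g N) t ω i ∂P = 0
  spectral_bound : ∃ c : ℝ, 0 < c ∧
    ∀ N t, ‖Matrix.toEuclideanCLM (n := Fin N) (𝕜 := ℝ) (secondMoment P (e N) (g N) t)‖ ≤ c
  dependence_decay : ∃ α C : ℝ, 3 < α ∧
    ∀ N m : ℕ, dependence P (e N) (g N) m ≤ ENNReal.ofReal (C * ((m : ℝ) + 1) ^ (-α))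

section Loadings

variable {N r : ℕ}

/-- The normalized Gram matrix `N⁻¹ Λ^⊤ Λ` of the loadings; the rows of `Λ` are `λ_i`. -/
def loadingGram (Λ : Matrix (Fin N) (Fin r) ℝ) : Matrix (Fin r) (Fin r) ℝ :=
  (1 / (N : ℝ)) • (Λ.transpose * Λ)

/-- The average loading `N⁻¹ ∑_i λ_i`. -/
def meanLoading (Λ : Matrix (Fin N) (Fin r) ℝ) : Fin r → ℝ :=
  (1 / (N : ℝ)) • ∑ i, Λ i

/-- `a_i = λ_i^⊤ (N⁻¹ Λ^⊤ Λ)⁻¹ (N⁻¹ ∑_j λ_j)`. -/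
def aCoef (Λ : Matrix (Fin N) (Fin r) ℝ) (i : Fin N) : ℝ :=
  Λ i ⬝ᵥ ((loadingGram Λ)⁻¹.mulVec (meanLoading Λ))

end Loadings

section Statistic

variable {Ω E : Type*} {N r : ℕ}

/-- The quadratic form
`Q_T = (TN)⁻¹ ∑_{i,j ≤ N} ∑_{t,s = 1}^T (1 - a_i)(1 - a_j) ε_it ε_js K((t - s) / (T h))`. -/
def quadForm (e : ℤ → Ω → E) (g : (ℕ → E) → EuclideanSpace ℝ (Fin N))
    (Λ : Matrix (Fin N) (Fin r) ℝ) (K : ℝ → ℝ) (T : ℕ) (h : ℝ) (ω : Ω) : ℝ :=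
  1 / ((T : ℝ) * N) * ∑ i : Fin N, ∑ j : Fin N, ∑ t ∈ Finset.Icc 1 T, ∑ s ∈ Finset.Icc 1 T,
    (1 - aCoef Λ i) * (1 - aCoef Λ j) * err e g t ω i * err e g s ω j *
      K (((t : ℝ) - (s : ℝ)) / ((T : ℝ) * h))

/-- The weighted cross-sectional average `N^{-1/2} ∑_i (1 - a_i) ε_it`. -/
def errBar (e : ℤ → Ω → E) (g : (ℕ → E) → EuclideanSpace ℝ (Fin N))
    (Λ : Matrix (Fin N) (Fin r) ℝ) (t : ℤ) (ω : Ω) : ℝ :=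
  1 / √(N : ℝ) * ∑ i, (1 - aCoef Λ i) * err e g t ω i

/-- The kernel-weighted long-run variance before passing to the limit,
`T⁻¹ ∑_{t,s = 1}^T E(ε̄_{t,a} ε̄_{s,a}) K((t - s) / (T h))`. -/
def kernelVariance [MeasurableSpace Ω] (P : Measure Ω) (e : ℤ → Ω → E)
    (g : (ℕ → E) → EuclideanSpace ℝ (Fin N)) (Λ : Matrix (Fin N) (Fin r) ℝ) (K : ℝ → ℝ)
    (T : ℕ) (h : ℝ) : ℝ :=
  1 / (T : ℝ) * ∑ t ∈ Finset.Icc 1 T, ∑ s ∈ Finset.Icc 1 T,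
    (∫ ω, errBar e g Λ t ω * errBar e g Λ s ω ∂P) *
      K (((t : ℝ) - (s : ℝ)) / ((T : ℝ) * h))

end Statistic

end PanelCLT

end

noncomputable section

namespace PanelCLT

set_option linter.unusedSectionVars false

open scoped ENNReal

/-! The vector with entries `a_i` is the orthogonal projection of the vector of ones on the column
space of `Λ`, so the weights `N^{-1/2} (1 - a_i)` form a vector of norm at most one. The weighted
average is therefore a scalar causal process `X_t`, a function of i.i.d. innovations whose
influences decay cubically in `L⁴`, uniformly in `N`. With `B = T h`, the statistic is `(T
B)^{-1/2}` times a centred quadratic form in `X` with coefficients `K ((t - s) / B)`, and everything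
can be computed on the i.i.d. product space.

The basic tool is the Efron–Stein inequality (`efronStein`). Applied to a function and to its
square, it gives an `L⁴` bound by squared influences (`eLpNorm_four_sq_le`), and from this a
variance bound for quadratic forms of order the Hilbert–Schmidt norm of the coefficients
(`eLpNorm_bilinear_sub_integral_sq_le`).

Time is cut into blocks of length `ℓ ≪ B`, and `X_t` is replaced by its projection on the
innovations of its own block. The error comes from times near the start of a block, which are a
negligible fraction (`tsum_infl_resid_le`). The kernel coefficients are replaced by ones that are
constant on pairs of blocks, vanish when the two blocks coincide, and vanish between different
groups of `q` consecutive blocks, where `B ≪ q ℓ ≪ T`. Only a proportion `o(1)` of the squared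
Hilbert–Schmidt norm `T B ν₀` is lost.

What remains is exactly a sum of `p → ∞` i.i.d. variables, each an off-diagonal quadratic form in
i.i.d. block sums. Adding one block sum at a time gives martingale increments, hence the exact
variance and a fourth moment of the order of the squared variance (`iid_quadratic_moments`).
Lyapunov's theorem (`tendsto_charFun_pow`) then applies. The variance of a block sum is
asymptotically `ℓ σ²`: autocovariances are summable uniformly in `N`, so kernel weights and block
lengths do not matter in the limit (`tendsto_integral_sq_blockSum`). This yields the limiting
variance `2 ν₀ σ⁴`. -/

theorem integral_comp_measurePreserving {α β : Type*} [MeasurableSpace α] [MeasurableSpace β]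
    {m : Measure α} {n : Measure β} {φ : α → β} (hφ : MeasurePreserving φ m n) {g : β → ℝ}
    (hg : AEStronglyMeasurable g n) : ∫ x, g (φ x) ∂m = ∫ y, g y ∂n := by
  rw [← hφ.map_eq] at hg ⊢
  exact (integral_map hφ.measurable.aemeasurable hg).symm

/-! ### Resampling and averaging coordinates of an i.i.d. sequence. -/

section Resampling

variable {ι E : Type*} [MeasurableSpace E]

/-- The i.i.d. product law on `ι → E` with marginal `μ`. -/
abbrev iidLaw (ι : Type*) {E : Type*} [MeasurableSpace E] (μ : Measure E) : Measure (ι → E) :=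
  Measure.infinitePi (fun _ : ι => μ)

open Classical in
/-- Replace the coordinates in `S` of the first sequence by those of the second one. -/
def resample (S : Set ι) (p : (ι → E) × (ι → E)) : ι → E :=
  fun i => if i ∈ S then p.2 i else p.1 i

theorem measurable_resample (S : Set ι) : Measurable (resample (E := E) S) := by
  classical
  refine measurable_pi_lambda _ fun i => ?_
  by_cases h : i ∈ S <;> simp only [resample, h, if_true, if_false] <;> fun_prop

variable (μ : Measure E) [IsProbabilityMeasure μ]

theorem map_sumElim_prod_iidLaw :
    ((iidLaw ι μ).prod (iidLaw ι μ)).map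
      (fun p => (Sum.elim p.1 p.2 : ι ⊕ ι → E)) = iidLaw (ι ⊕ ι) μ := by
  have hm : Measurable (fun p : (ι → E) × (ι → E) => (Sum.elim p.1 p.2 : ι ⊕ ι → E)) := by
    refine measurable_pi_lambda _ fun i => ?_
    cases i <;> simp only [Sum.elim_inl, Sum.elim_inr] <;> fun_prop
  refine Measure.eq_infinitePi _ fun s t ht => ?_
  rw [Measure.map_apply hm (.pi s.countable_toSet fun _ _ => ht _)]
  have : (fun p : (ι → E) × (ι → E) => (Sum.elim p.1 p.2 : ι ⊕ ι → E)) ⁻¹' ((s : Set (ι ⊕ ι)).pi t)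
      = ((s.toLeft : Set ι).pi (fun i => t (Sum.inl i))) ×ˢ
        ((s.toRight : Set ι).pi (fun i => t (Sum.inr i))) := by
    ext p
    simp [Set.mem_pi]
  rw [this, Measure.prod_prod, Measure.infinitePi_pi _ (fun i _ => ht _),
    Measure.infinitePi_pi _ (fun i _ => ht _), Finset.prod_sum_eq_prod_toLeft_mul_prod_toRight]

theorem measurePreserving_sumElim :
    MeasurePreserving (fun p : (ι → E) × (ι → E) => (Sum.elim p.1 p.2 : ι ⊕ ι → E))
      ((iidLaw ι μ).prod (iidLaw ι μ)) (iidLaw (ι ⊕ ι) μ) where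
  measurable := by
    refine measurable_pi_lambda _ fun i => ?_
    cases i <;> simp only [Sum.elim_inl, Sum.elim_inr] <;> fun_prop
  map_eq := map_sumElim_prod_iidLaw μ

theorem measurePreserving_reindex {κ : Type*} {f : κ → ι} (hf : Function.Injective f) :
    MeasurePreserving (fun (x : ι → E) k => x (f k)) (iidLaw ι μ) (iidLaw κ μ) where
  measurable := by fun_prop
  map_eq := Measure.map_infinitePi_infinitePi_of_inj hf

theorem measurePreserving_prod_of_sumElim :
    MeasurePreserving (fun x : ι ⊕ ι → E => ((fun i => x (Sum.inl i)), fun i => x (Sum.inr i)))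
      (iidLaw (ι ⊕ ι) μ) ((iidLaw ι μ).prod (iidLaw ι μ)) where
  measurable := by fun_prop
  map_eq := by
    rw [← map_sumElim_prod_iidLaw, Measure.map_map (by fun_prop)
      (measurePreserving_sumElim μ).measurable]
    exact Measure.map_id

/-- Resampling selects coordinates of a doubled i.i.d. family along an injection `ι → ι ⊕ ι`, and an
injective selection of i.i.d. coordinates is again i.i.d. -/
theorem measurePreserving_resample (S : Set ι) :
    MeasurePreserving (resample (E := E) S) ((iidLaw ι μ).prod (iidLaw ι μ)) (iidLaw ι μ) := by
  classical
  let f : ι → ι ⊕ ι := fun i => if i ∈ S then Sum.inr i else Sum.inl i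
  have hf : Function.Injective f := by
    intro i j h
    by_cases hi : i ∈ S <;> by_cases hj : j ∈ S <;> simp_all [f]
  have := (measurePreserving_reindex μ hf).comp (measurePreserving_sumElim μ)
  convert! this using 1
  ext p i
  by_cases hi : i ∈ S <;> simp [resample, f, hi]

/-- The map exchanges the coordinates in `S` between the two sequences, so it only permutes a
doubled i.i.d. family. This symmetry makes `avg` self-adjoint. -/
theorem measurePreserving_resample_swap (S : Set ι) :
    MeasurePreserving (fun p : (ι → E) × (ι → E) => (resample S p, resample Sᶜ p))
      ((iidLaw ι μ).prod (iidLaw ι μ)) ((iidLaw ι μ).prod (iidLaw ι μ)) := by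
  classical
  let f : ι ⊕ ι → ι ⊕ ι := Sum.elim (fun i => if i ∈ S then Sum.inr i else Sum.inl i)
    (fun i => if i ∈ S then Sum.inl i else Sum.inr i)
  have hf : Function.Injective f := by
    rintro (i | i) (j | j) h <;> by_cases hi : i ∈ S <;> by_cases hj : j ∈ S <;> simp_all [f]
  have := (measurePreserving_prod_of_sumElim μ).comp
    ((measurePreserving_reindex μ hf).comp (measurePreserving_sumElim μ))
  convert! this using 1
  ext p i <;> by_cases hi : i ∈ S <;> simp [resample, f, hi]

theorem resample_resample_swap (S : Set ι) (p : (ι → E) × (ι → E)) :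
    resample S (resample S p, resample Sᶜ p) = p.1 := by
  ext i
  by_cases hi : i ∈ S <;> simp [resample, hi]

theorem resample_resample (S T : Set ι) (x y z : ι → E) :
    resample T (resample S (x, y), z) = resample (S ∪ T) (x, resample T (y, z)) := by
  ext i
  by_cases hi : i ∈ S <;> by_cases hj : i ∈ T <;> simp [resample, hi, hj]

/-- Integrate out the coordinates in `S`. -/
def avg (S : Set ι) (f : (ι → E) → ℝ) (x : ι → E) : ℝ :=
  ∫ y, f (resample S (x, y)) ∂(iidLaw ι μ)

variable {μ}

theorem measurable_avg (S : Set ι) {f : (ι → E) → ℝ} (hf : Measurable f) :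
    Measurable (avg μ S f) := by
  have : StronglyMeasurable (fun p : (ι → E) × (ι → E) => f (resample S p)) :=
    (hf.comp (measurable_resample S)).stronglyMeasurable
  exact (this.integral_prod_right' (ν := iidLaw ι μ)).measurable

theorem avg_dependsOn (S : Set ι) (f : (ι → E) → ℝ) : DependsOn (avg μ S f) Sᶜ := by
  intro x y h
  unfold avg
  congr 1
  ext z
  congr 1
  ext i
  by_cases hi : i ∈ S <;> simp [resample, hi]
  exact h i hi

/-- Jensen's inequality for integrating out one variable. -/
theorem eLpNorm_integral_prod_le {α β : Type*} [MeasurableSpace α] [MeasurableSpace β]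
    {m : Measure α} [SFinite m] {ν : Measure β} [IsProbabilityMeasure ν] {F : α × β → ℝ}
    (hF : Measurable F) {p : ℝ≥0∞} (hp : 1 ≤ p) (hp' : p ≠ ∞) :
    eLpNorm (fun x => ∫ y, F (x, y) ∂ν) p m ≤ eLpNorm F p (m.prod ν) := by
  have hp0 : p ≠ 0 := (zero_lt_one.trans_le hp).ne'
  have hpr : 0 < p.toReal := ENNReal.toReal_pos hp0 hp'
  rw [eLpNorm_eq_lintegral_rpow_enorm_toReal hp0 hp', eLpNorm_eq_lintegral_rpow_enorm_toReal hp0 hp',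
    lintegral_prod _ (by fun_prop)]
  gcongr with x
  have h1 : ‖∫ y, F (x, y) ∂ν‖ₑ ≤ eLpNorm (fun y => F (x, y)) p ν := by
    refine (enorm_integral_le_lintegral_enorm _).trans ?_
    rw [← eLpNorm_one_eq_lintegral_enorm]
    exact eLpNorm_le_eLpNorm_of_exponent_le hp
      (hF.comp measurable_prodMk_left).aestronglyMeasurable
  calc ‖∫ y, F (x, y) ∂ν‖ₑ ^ p.toReal ≤ (eLpNorm (fun y => F (x, y)) p ν) ^ p.toReal := by gcongr
    _ = _ := by
      rw [eLpNorm_eq_lintegral_rpow_enorm_toReal hp0 hp', ← ENNReal.rpow_mul]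
      simp [hpr.ne']

theorem eLpNorm_avg_le (S : Set ι) {f : (ι → E) → ℝ} (hf : Measurable f) {p : ℝ≥0∞} (hp : 1 ≤ p)
    (hp' : p ≠ ∞) : eLpNorm (avg μ S f) p (iidLaw ι μ) ≤ eLpNorm f p (iidLaw ι μ) := by
  refine (eLpNorm_integral_prod_le (F := fun q => f (resample S q))
    (hf.comp (measurable_resample S)) hp hp').trans ?_
  exact (eLpNorm_comp_measurePreserving hf.aestronglyMeasurable
    (measurePreserving_resample μ S)).le

theorem memLp_avg (S : Set ι) {f : (ι → E) → ℝ} (hf : Measurable f) {p : ℝ≥0∞} (hp : 1 ≤ p)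
    (hp' : p ≠ ∞) (h : MemLp f p (iidLaw ι μ)) : MemLp (avg μ S f) p (iidLaw ι μ) :=
  ⟨(measurable_avg S hf).aestronglyMeasurable, (eLpNorm_avg_le S hf hp hp').trans_lt h.2⟩

theorem ae_integrable_resample (S : Set ι) {f : (ι → E) → ℝ} (hi : Integrable f (iidLaw ι μ)) :
    ∀ᵐ x ∂(iidLaw ι μ), Integrable (fun y => f (resample S (x, y))) (iidLaw ι μ) :=
  (((measurePreserving_resample μ S).integrable_comp_of_integrable hi)).prod_right_ae

theorem avg_sub_ae (S : Set ι) {f g : (ι → E) → ℝ} (hf : Integrable f (iidLaw ι μ))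
    (hg : Integrable g (iidLaw ι μ)) :
    avg μ S (fun x => f x - g x) =ᵐ[iidLaw ι μ] fun x => avg μ S f x - avg μ S g x := by
  filter_upwards [ae_integrable_resample S hf, ae_integrable_resample S hg] with x h1 h2
  exact integral_sub h1 h2

/-- Two successive resamplings of `x` amount to one, from a sequence that is itself resampled and
hence i.i.d. The identity holds only almost everywhere because Fubini needs integrability of the
slice at `x`. -/
theorem avg_avg_ae (S T : Set ι) {f : (ι → E) → ℝ} (hf : Integrable f (iidLaw ι μ)) :
    avg μ S (avg μ T f) =ᵐ[iidLaw ι μ] avg μ (S ∪ T) f := by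
  filter_upwards [ae_integrable_resample (S ∪ T) hf] with x hx
  have h2 := (measurePreserving_resample μ T).integrable_comp_of_integrable hx
  simp only [avg, resample_resample]
  rw [← integral_prod (fun q : (ι → E) × (ι → E) => f (resample (S ∪ T) (x, resample T q))) h2]
  exact integral_comp_measurePreserving (measurePreserving_resample μ T)
    (g := fun w => f (resample (S ∪ T) (x, w))) hx.1

theorem avg_empty (f : (ι → E) → ℝ) : avg μ ∅ f = f := by
  ext x
  have : ∀ y, resample (∅ : Set ι) (x, y) = x := fun y => by ext i; simp [resample]
  simp [avg, this]

theorem avg_univ (f : (ι → E) → ℝ) (x) : avg μ Set.univ f x = ∫ y, f y ∂(iidLaw ι μ) := by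
  have : ∀ y, resample (Set.univ : Set ι) (x, y) = y := fun y => by ext i; simp [resample]
  simp [avg, this]

theorem avg_congr {S S' T : Set ι} {f : (ι → E) → ℝ} (hf : DependsOn f T)
    (h : ∀ i ∈ T, i ∈ S ↔ i ∈ S') : avg μ S f = avg μ S' f := by
  ext x
  unfold avg
  congr 1
  ext y
  refine hf fun i hi => ?_
  have := h i hi
  by_cases h1 : i ∈ S <;> simp_all [resample]

theorem memLp_comp_fst {p : ℝ≥0∞} {f : (ι → E) → ℝ} (h : MemLp f p (iidLaw ι μ)) :
    MemLp (fun q : (ι → E) × (ι → E) => f q.1) p ((iidLaw ι μ).prod (iidLaw ι μ)) :=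
  h.comp_measurePreserving measurePreserving_fst

theorem memLp_comp_resample {p : ℝ≥0∞} {f : (ι → E) → ℝ} (S : Set ι)
    (h : MemLp f p (iidLaw ι μ)) :
    MemLp (fun q => f (resample S q)) p ((iidLaw ι μ).prod (iidLaw ι μ)) :=
  h.comp_measurePreserving (measurePreserving_resample μ S)

theorem integral_avg_mul (S : Set ι) {f g : (ι → E) → ℝ} (hf : MemLp f 2 (iidLaw ι μ))
    (hg : MemLp g 2 (iidLaw ι μ)) :
    ∫ x, avg μ S f x * g x ∂(iidLaw ι μ) =
      ∫ q, f (resample S q) * g q.1 ∂((iidLaw ι μ).prod (iidLaw ι μ)) := by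
  rw [integral_prod]
  · simp [avg, integral_mul_const]
  · exact (memLp_comp_resample S hf).integrable_mul (memLp_comp_fst hg)

/-- Self-adjointness of `avg`: exchanging the coordinates in `S` between the two sequences preserves
the product law and moves the resampling from `f` to `g`. -/
theorem integral_avg_mul_comm (S : Set ι) {f g : (ι → E) → ℝ} (hfm : Measurable f)
    (hgm : Measurable g) (hf : MemLp f 2 (iidLaw ι μ)) (hg : MemLp g 2 (iidLaw ι μ)) :
    ∫ x, avg μ S f x * g x ∂(iidLaw ι μ) = ∫ x, f x * avg μ S g x ∂(iidLaw ι μ) := by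
  simp_rw [mul_comm (f _)]
  rw [integral_avg_mul S hf hg, integral_avg_mul S hg hf]
  have h2 : ∀ q : (ι → E) × (ι → E), resample S (resample S q, resample Sᶜ q) = q.1 :=
    resample_resample_swap S
  rw [← integral_comp_measurePreserving (measurePreserving_resample_swap μ S)
    (g := fun q => f (resample S q) * g q.1) ((hfm.comp (measurable_resample S)).mul (hgm.comp measurable_fst)).aestronglyMeasurable]
  simp only [h2]
  simp_rw [mul_comm]

end Resampling

/-! ### The Efron–Stein inequality. -/

section EfronStein

variable {ι E : Type*} [MeasurableSpace E] {μ : Measure E} [IsProbabilityMeasure μ]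

/-- Cylinders form an algebra generating the product σ-algebra, so they approximate every measurable
set in measure; simple functions do the rest. -/
theorem exists_finite_dependsOn_approx {f : (ι → E) → ℝ} (hf : MemLp f 2 (iidLaw ι μ)) {ε : ℝ≥0∞}
    (hε : ε ≠ 0) : ∃ g : (ι → E) → ℝ, eLpNorm (f - g) 2 (iidLaw ι μ) ≤ ε ∧
      (Measurable g ∧ MemLp g 2 (iidLaw ι μ) ∧ ∃ F : Finset ι, DependsOn g F) := by
  classical
  refine hf.induction_dense (by simp) _ ?_ ?_ ?_ hε
  · intro c s hs _ ε hε
    obtain ⟨η, hη, h⟩ := exists_eLpNorm_indicator_le (μ := iidLaw ι μ) (p := 2) (by simp) c hε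
    have hd := Measure.MeasureDense.of_generateFrom_isSetAlgebra_finite (iidLaw ι μ)
      (isSetAlgebra_measurableCylinders (α := fun _ : ι => E)) generateFrom_measurableCylinders.symm
    obtain ⟨t, ht, hst⟩ := hd.approx s hs (measure_ne_top _ _) η (by exact_mod_cast hη)
    have htm := MeasurableSet.of_mem_measurableCylinders ht
    obtain ⟨F, A, hA, rfl⟩ := (mem_measurableCylinders t).1 ht
    refine ⟨(cylinder F A).indicator fun _ => c, ?_, measurable_const.indicator htm,
      memLp_indicator_const _ htm _ (Or.inr (measure_ne_top _ _)), F,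
      dependsOn_cylinder_indicator_const _ _⟩
    rw [eLpNorm_indicator_sub_indicator]
    refine h _ ?_
    rw [symmDiff_comm]
    simpa using hst.le
  · rintro f g ⟨hf, hf', F, hF⟩ ⟨hg, hg', G, hG⟩
    refine ⟨hf.add hg, hf'.add hg', F ∪ G, fun x y h => ?_⟩
    simp only [Pi.add_apply]
    rw [hF fun i hi => h i (by simp_all), hG fun i hi => h i (by simp_all)]
  · exact fun f h => h.1.aestronglyMeasurable

/-- For a function of the coordinates in `F`, averaging over `S` depends only on `S ∩ F`; since
`avg` is an `L²` contraction, approximation transfers this to `f`. It permits the passage from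
finite to infinite sets of averaged coordinates. -/
theorem exists_finset_avg_approx {f : (ι → E) → ℝ} (hfm : Measurable f)
    (hf : MemLp f 2 (iidLaw ι μ)) {ε : ℝ≥0∞} (hε : ε ≠ 0) :
    ∃ F : Finset ι, ∀ S T : Set ι, (∀ i ∈ F, i ∈ S ↔ i ∈ T) →
      eLpNorm (fun x => avg μ S f x - avg μ T f x) 2 (iidLaw ι μ) ≤ ε := by
  obtain ⟨g, hg, hgm, hg2, F, hF⟩ := exists_finite_dependsOn_approx hf (ε := ε / 2) (by simpa)
  refine ⟨F, fun S T h => ?_⟩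
  have key : ∀ S, eLpNorm (fun x => avg μ S f x - avg μ S g x) 2 (iidLaw ι μ) ≤ ε / 2 := by
    intro S
    refine le_trans (le_of_eq ?_) ((eLpNorm_avg_le S (hfm.sub hgm) (p := 2) (by norm_num)
      (by simp)).trans hg)
    exact (eLpNorm_congr_ae (avg_sub_ae S (hf.integrable (by norm_num))
      (hg2.integrable (by norm_num)))).symm
  have h1 : (fun x => avg μ S f x - avg μ T f x) =
      (fun x => avg μ S f x - avg μ S g x) - (fun x => avg μ T f x - avg μ T g x) := by
    ext x
    simp [avg_congr hF h]
  rw [h1]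
  refine (eLpNorm_sub_le ?_ ?_ (by norm_num)).trans
    ((add_le_add (key S) (key T)).trans (ENNReal.add_halves ε).le) <;>
  exact ((measurable_avg _ hfm).sub (measurable_avg _ hgm)).aestronglyMeasurable

theorem tendsto_avg_finset {f : (ι → E) → ℝ} (hfm : Measurable f)
    (hf : MemLp f 2 (iidLaw ι μ)) (S : Set ι) :
    Tendsto (fun F : Finset ι => eLpNorm (fun x => avg μ (↑F ∩ S) f x - avg μ S f x) 2
      (iidLaw ι μ)) atTop (𝓝 0) := by
  rw [ENNReal.tendsto_nhds_zero]
  intro ε hε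
  obtain ⟨F, hF⟩ := exists_finset_avg_approx hfm hf (ε := ε) hε.ne'
  filter_upwards [eventually_ge_atTop F] with G hG
  exact hF _ _ fun i hi => by simp [hG hi]

/-- The influence of the coordinates in `S` on `f`, in `L^p`. -/
def infl (μ : Measure E) (p : ℝ≥0∞) (S : Set ι) (f : (ι → E) → ℝ) : ℝ≥0∞ :=
  eLpNorm (fun q => f q.1 - f (resample S q)) p ((iidLaw ι μ).prod (iidLaw ι μ))

theorem eLpNorm_sub_avg_le_infl (S : Set ι) {f : (ι → E) → ℝ} (hfm : Measurable f)
    (hf : Integrable f (iidLaw ι μ)) {p : ℝ≥0∞} (hp : 1 ≤ p) (hp' : p ≠ ∞) :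
    eLpNorm (fun x => f x - avg μ S f x) p (iidLaw ι μ) ≤ infl μ p S f := by
  refine le_trans (le_of_eq (eLpNorm_congr_ae ?_)) (eLpNorm_integral_prod_le
    (m := iidLaw ι μ) (ν := iidLaw ι μ) (F := fun q => f q.1 - f (resample S q))
    ((hfm.comp measurable_fst).sub (hfm.comp (measurable_resample S))) hp hp')
  filter_upwards [ae_integrable_resample S hf] with x hx
  rw [integral_sub (integrable_const _) hx]
  simp [avg]

theorem avg_union_sub_ae (S T : Set ι) {f : (ι → E) → ℝ} (hfm : Measurable f)
    (hf : Integrable f (iidLaw ι μ)) :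
    avg μ S (fun x => f x - avg μ T f x) =ᵐ[iidLaw ι μ]
      fun x => avg μ S f x - avg μ (S ∪ T) f x := by
  have hT : Integrable (avg μ T f) (iidLaw ι μ) := by
    rw [← memLp_one_iff_integrable] at hf ⊢
    exact memLp_avg T hfm le_rfl (by simp) hf
  filter_upwards [avg_sub_ae S hf hT, avg_avg_ae S T hf] with x h1 h2
  rw [h1, h2]

/-- The difference is `avg μ S` applied to `f - avg μ T f`; `avg` is a contraction, and Jensen
bounds the norm of the argument by the influence of `T`. -/
theorem eLpNorm_avg_sub_avg_union_le (S T : Set ι) {f : (ι → E) → ℝ} (hfm : Measurable f)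
    (hf : Integrable f (iidLaw ι μ)) {p : ℝ≥0∞} (hp : 1 ≤ p) (hp' : p ≠ ∞) :
    eLpNorm (fun x => avg μ S f x - avg μ (S ∪ T) f x) p (iidLaw ι μ) ≤ infl μ p T f := by
  rw [← eLpNorm_congr_ae (avg_union_sub_ae S T hfm hf)]
  exact (eLpNorm_avg_le S (hfm.sub (measurable_avg T hfm)) hp hp').trans
    (eLpNorm_sub_avg_le_infl T hfm hf hp hp')

theorem eLpNorm_sub_avg_finset_le (F : Finset ι) {f : (ι → E) → ℝ} (hfm : Measurable f)
    (hf : Integrable f (iidLaw ι μ)) {p : ℝ≥0∞} (hp : 1 ≤ p) (hp' : p ≠ ∞) :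
    eLpNorm (fun x => f x - avg μ F f x) p (iidLaw ι μ) ≤ ∑ u ∈ F, infl μ p {u} f := by
  classical
  induction F using Finset.induction_on with
  | empty => simp [avg_empty]
  | insert u F hu ih =>
    rw [Finset.sum_insert hu, add_comm]
    have hins : (↑(insert u F) : Set ι) = ↑F ∪ {u} := by
      rw [Finset.coe_insert, Set.insert_eq, Set.union_comm]
    rw [hins]
    have : (fun x => f x - avg μ (↑F ∪ {u}) f x) = (fun x => f x - avg μ F f x) +
        fun x => avg μ F f x - avg μ (↑F ∪ {u}) f x := by
      ext x
      simp only [Pi.add_apply]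
      ring
    rw [this]
    have h1 := eLpNorm_avg_sub_avg_union_le (μ := μ) (↑F : Set ι) {u} hfm hf hp hp'
    refine (eLpNorm_add_le ?_ ?_ hp).trans (add_le_add ih h1)
    · exact (hfm.sub (measurable_avg _ hfm)).aestronglyMeasurable
    · exact ((measurable_avg _ hfm).sub (measurable_avg _ hfm)).aestronglyMeasurable

theorem tendstoInMeasure_sub_avg [Countable ι] {f : (ι → E) → ℝ} (hfm : Measurable f)
    (hf : MemLp f 2 (iidLaw ι μ)) (S : Set ι) :
    TendstoInMeasure (iidLaw ι μ) (fun (F : Finset ι) x => f x - avg μ (↑F ∩ S) f x) atTop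
      (fun x => f x - avg μ S f x) := by
  refine tendstoInMeasure_of_tendsto_eLpNorm (p := 2) (by simp)
    (fun F => (hfm.sub (measurable_avg _ hfm)).aestronglyMeasurable)
    (hfm.sub (measurable_avg _ hfm)).aestronglyMeasurable ?_
  convert! tendsto_avg_finset hfm hf S using 2 with F
  rw [← eLpNorm_neg]
  congr 1
  ext x
  simp

/-- Telescoping over finite subsets of `S`, then Fatou along convergence in measure. Convergence
comes from `L²`, while the bound is in `L^p`; with `p = 4` this yields fourth moments for a function
only known to be square integrable. -/
theorem eLpNorm_sub_avg_le_tsum [Countable ι] (S : Set ι) {f : (ι → E) → ℝ} (hfm : Measurable f)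
    (hf : MemLp f 2 (iidLaw ι μ)) {p : ℝ≥0∞} (hp : 1 ≤ p) (hp' : p ≠ ∞) :
    eLpNorm (fun x => f x - avg μ S f x) p (iidLaw ι μ) ≤
      ∑' u, S.indicator (fun u => infl μ p {u} f) u := by
  classical
  refine eLpNorm_le_of_tendstoInMeasure (Eventually.of_forall fun F => ?_)
    (tendstoInMeasure_sub_avg hfm hf S)
    (fun F => (hfm.sub (measurable_avg _ hfm)).aestronglyMeasurable)
  have : (↑F ∩ S : Set ι) = ↑(F.filter (· ∈ S)) := by ext; simp
  rw [this]
  refine (eLpNorm_sub_avg_finset_le _ hfm (hf.integrable (by norm_num)) hp hp').trans ?_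
  refine le_trans (le_of_eq ?_) (ENNReal.sum_le_tsum F)
  rw [Finset.sum_filter]
  simp [Set.indicator_apply]

theorem eLpNorm_two_sq_eq {α : Type*} [MeasurableSpace α] {m : Measure α} {f : α → ℝ}
    (hf : MemLp f 2 m) : eLpNorm f 2 m ^ 2 = ENNReal.ofReal (∫ x, f x ^ 2 ∂m) := by
  rw [hf.eLpNorm_eq_integral_rpow_norm (by simp) (by simp)]
  rw [← ENNReal.ofReal_pow (by positivity)]
  congr 1
  simp only [ENNReal.toReal_ofNat, Real.rpow_ofNat, Real.norm_eq_abs, sq_abs]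
  rw [← Real.rpow_natCast, ← Real.rpow_mul (by positivity)]
  norm_num

/-- Pythagoras: the operators `avg` are self-adjoint and idempotent, and nested sets give nested
projections. -/
theorem integral_sub_avg_sq (S T : Set ι) (hST : S ⊆ T) {f : (ι → E) → ℝ} (hfm : Measurable f)
    (hf : MemLp f 2 (iidLaw ι μ)) :
    ∫ x, (avg μ S f x - avg μ T f x) ^ 2 ∂(iidLaw ι μ) =
      (∫ x, f x * avg μ S f x ∂(iidLaw ι μ)) - ∫ x, f x * avg μ T f x ∂(iidLaw ι μ) := by
  have hfi : Integrable f (iidLaw ι μ) := hf.integrable (by norm_num)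
  have hm : ∀ U, MemLp (avg μ U f) 2 (iidLaw ι μ) :=
    fun U => memLp_avg U hfm (by norm_num) (by simp) hf
  have key : ∀ U V : Set ι, ∫ x, avg μ U f x * avg μ V f x ∂(iidLaw ι μ) =
      ∫ x, f x * avg μ (U ∪ V) f x ∂(iidLaw ι μ) := by
    intro U V
    rw [integral_avg_mul_comm U hfm (measurable_avg V hfm) hf (hm V)]
    refine integral_congr_ae ?_
    filter_upwards [avg_avg_ae U V hfi] with x hx
    rw [hx]
  have hi : ∀ U V : Set ι, Integrable (fun x => avg μ U f x * avg μ V f x) (iidLaw ι μ) :=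
    fun U V => (hm U).integrable_mul (hm V)
  have : ∀ x, (avg μ S f x - avg μ T f x) ^ 2 = (avg μ S f x * avg μ S f x
      + avg μ T f x * avg μ T f x) - 2 * (avg μ S f x * avg μ T f x) := fun x => by ring
  simp_rw [this]
  rw [integral_sub ((hi S S).fun_add (hi T T)) ((hi S T).const_mul 2),
    integral_add (hi S S) (hi T T), integral_const_mul, key, key, key,
    Set.union_self, Set.union_self, Set.union_eq_self_of_subset_left hST]
  ring

/-- Averaging out one more coordinate `u` adds to the squared norm exactly that of an orthogonal
increment, whose norm is at most the influence of `u`. -/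
theorem efronStein_finset (F : Finset ι) {f : (ι → E) → ℝ} (hfm : Measurable f)
    (hf : MemLp f 2 (iidLaw ι μ)) :
    eLpNorm (fun x => f x - avg μ F f x) 2 (iidLaw ι μ) ^ 2 ≤ ∑ u ∈ F, infl μ 2 {u} f ^ 2 := by
  classical
  have hm : ∀ U, MemLp (avg μ U f) 2 (iidLaw ι μ) :=
    fun U => memLp_avg U hfm (by norm_num) (by simp) hf
  have h0 : ∀ U : Set ι, eLpNorm (fun x => f x - avg μ U f x) 2 (iidLaw ι μ) ^ 2 =
      ENNReal.ofReal ((∫ x, f x * avg μ ∅ f x ∂(iidLaw ι μ)) -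
        ∫ x, f x * avg μ U f x ∂(iidLaw ι μ)) := by
    intro U
    rw [eLpNorm_two_sq_eq (f := fun x => f x - avg μ U f x) (hf.sub (hm U)),
      ← integral_sub_avg_sq ∅ U (by simp) hfm hf, avg_empty]
  induction F using Finset.induction_on with
  | empty => simp [avg_empty]
  | insert u F hu ih =>
    rw [Finset.sum_insert hu, add_comm]
    have hins : (↑(insert u F) : Set ι) = ↑F ∪ {u} := by
      rw [Finset.coe_insert, Set.insert_eq, Set.union_comm]
    rw [hins]
    have h1 : eLpNorm (fun x => avg μ F f x - avg μ (↑F ∪ {u}) f x) 2 (iidLaw ι μ) ^ 2 ≤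
        infl μ 2 {u} f ^ 2 := by
      have := eLpNorm_avg_sub_avg_union_le (μ := μ) (↑F : Set ι) {u} hfm
        (hf.integrable (by norm_num)) (p := 2) (by norm_num) (by simp)
      gcongr
    refine le_trans ?_ (add_le_add ih h1)
    rw [eLpNorm_two_sq_eq (f := fun x => avg μ F f x - avg μ (↑F ∪ {u}) f x) ((hm _).sub (hm _)),
      integral_sub_avg_sq _ _ Set.subset_union_left hfm hf, h0, h0]
    refine le_trans (ENNReal.ofReal_le_ofReal (le_of_eq ?_)) ENNReal.ofReal_add_le
    ring

/-- The Efron–Stein inequality. -/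
theorem efronStein [Countable ι] {f : (ι → E) → ℝ} (hfm : Measurable f)
    (hf : MemLp f 2 (iidLaw ι μ)) :
    eLpNorm (fun x => f x - ∫ y, f y ∂(iidLaw ι μ)) 2 (iidLaw ι μ) ^ 2 ≤
      ∑' u, infl μ 2 {u} f ^ 2 := by
  have h : eLpNorm (fun x => f x - avg μ Set.univ f x) 2 (iidLaw ι μ) ≤
      (∑' u, infl μ 2 {u} f ^ 2) ^ (2⁻¹ : ℝ) := by
    refine eLpNorm_le_of_tendstoInMeasure (Eventually.of_forall fun F => ?_)
      (tendstoInMeasure_sub_avg hfm hf Set.univ)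
      (fun F => (hfm.sub (measurable_avg _ hfm)).aestronglyMeasurable)
    rw [Set.inter_univ, ENNReal.le_rpow_inv_iff (by norm_num), ENNReal.rpow_ofNat]
    exact (efronStein_finset F hfm hf).trans (ENNReal.sum_le_tsum F)
  simp only [avg_univ] at h
  rwa [ENNReal.le_rpow_inv_iff (by norm_num), ENNReal.rpow_ofNat] at h

end EfronStein

/-! ### Influences in `L⁴` and a fourth moment inequality. -/

section Influence

variable {ι E : Type*} [MeasurableSpace E] {μ : Measure E} [IsProbabilityMeasure μ]

instance holderTriple_four_four_two : ENNReal.HolderTriple 4 4 2 where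
  inv_add_inv_eq_inv := by
    rw [← ENNReal.toReal_eq_toReal_iff' (by simp) (by simp),
      ENNReal.toReal_add (by simp) (by simp)]
    norm_num

theorem eLpNorm_mul_le_four {α : Type*} [MeasurableSpace α] {m : Measure α} {f g : α → ℝ}
    (hf : AEStronglyMeasurable f m) (hg : AEStronglyMeasurable g m) :
    eLpNorm (fun x => f x * g x) 2 m ≤ eLpNorm f 4 m * eLpNorm g 4 m := by
  have := eLpNorm_le_eLpNorm_mul_eLpNorm_of_nnnorm (p := 4) (q := 4) (r := 2) hf hg
    (fun a b : ℝ => a * b) 1 (Eventually.of_forall fun x => by simp)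
  rwa [ENNReal.coe_one, one_mul] at this

theorem memLp_two_of_four {α : Type*} [MeasurableSpace α] {m : Measure α} [IsProbabilityMeasure m]
    {f : α → ℝ} (hf : MemLp f 4 m) : MemLp f 2 m := hf.mono_exponent (by norm_num)

theorem memLp_mul_of_four {α : Type*} [MeasurableSpace α] {m : Measure α} {f g : α → ℝ}
    (hf : MemLp f 4 m) (hg : MemLp g 4 m) : MemLp (fun x => f x * g x) 2 m :=
  ⟨hf.1.mul hg.1, (eLpNorm_mul_le_four hf.1 hg.1).trans_lt (ENNReal.mul_lt_top hf.2 hg.2)⟩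

theorem eLpNorm_sq_two {α : Type*} [MeasurableSpace α] {m : Measure α} {f : α → ℝ} :
    eLpNorm (fun x => f x ^ 2) 2 m = eLpNorm f 4 m ^ 2 := by
  have := eLpNorm_norm_rpow (p := 2) (μ := m) f (q := 2) (by norm_num)
  have h4 : (2 : ℝ≥0∞) * ENNReal.ofReal 2 = 4 := by
    rw [ENNReal.ofReal_ofNat]; norm_num
  rw [h4] at this
  simpa using this

theorem sq_sum_mul_le {τ : Type*} (s : Finset τ) (w f : τ → ℝ≥0∞) :
    (∑ t ∈ s, w t * f t) ^ 2 ≤ (∑ t ∈ s, w t) * ∑ t ∈ s, w t * f t ^ 2 := by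
  have h := ENNReal.inner_le_weight_mul_Lp_of_nonneg s (p := 2) (by norm_num) w f
  calc (∑ t ∈ s, w t * f t) ^ 2 ≤ _ := pow_le_pow_left' h 2
    _ = _ := by
      rw [mul_pow, ← ENNReal.rpow_mul_natCast, ← ENNReal.rpow_mul_natCast]
      norm_num

theorem add_sq_le_two (x y : ℝ≥0∞) : (x + y) ^ 2 ≤ 2 * x ^ 2 + 2 * y ^ 2 := by
  have := sq_sum_mul_le Finset.univ (fun _ : Fin 2 => (1 : ℝ≥0∞)) ![x, y]
  simp only [one_mul, Fin.sum_univ_two, Matrix.cons_val_zero, Matrix.cons_val_one] at this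
  calc _ ≤ _ := this
    _ = _ := by ring

theorem infl_le_four (S : Set ι) {f : (ι → E) → ℝ} (hfm : Measurable f) :
    infl μ 2 S f ≤ infl μ 4 S f :=
  eLpNorm_le_eLpNorm_of_exponent_le (by norm_num)
    ((hfm.comp measurable_fst).sub (hfm.comp (measurable_resample S))).aestronglyMeasurable

theorem eLpNorm_comp_fst {p : ℝ≥0∞} {f : (ι → E) → ℝ} (hfm : Measurable f) :
    eLpNorm (fun q : (ι → E) × (ι → E) => f q.1) p ((iidLaw ι μ).prod (iidLaw ι μ)) =
      eLpNorm f p (iidLaw ι μ) :=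
  eLpNorm_comp_measurePreserving hfm.aestronglyMeasurable measurePreserving_fst

theorem eLpNorm_comp_resample (S : Set ι) {p : ℝ≥0∞} {f : (ι → E) → ℝ} (hfm : Measurable f) :
    eLpNorm (fun q => f (resample S q)) p ((iidLaw ι μ).prod (iidLaw ι μ)) =
      eLpNorm f p (iidLaw ι μ) :=
  eLpNorm_comp_measurePreserving hfm.aestronglyMeasurable (measurePreserving_resample μ S)

theorem infl_le_two_mul (S : Set ι) {p : ℝ≥0∞} (hp : 1 ≤ p) {f : (ι → E) → ℝ}
    (hfm : Measurable f) : infl μ p S f ≤ 2 * eLpNorm f p (iidLaw ι μ) := by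
  refine (eLpNorm_sub_le (hfm.comp measurable_fst).aestronglyMeasurable
    (hfm.comp (measurable_resample S)).aestronglyMeasurable hp).trans (le_of_eq ?_)
  rw [two_mul]
  exact congrArg₂ _ (eLpNorm_comp_fst hfm) (eLpNorm_comp_resample S hfm)

theorem infl_eq_zero {S T : Set ι} {p : ℝ≥0∞} {f : (ι → E) → ℝ} (hf : DependsOn f T)
    (h : Disjoint S T) : infl μ p S f = 0 := by
  have : (fun q : (ι → E) × (ι → E) => f q.1 - f (resample S q)) = fun _ => 0 := by
    ext q
    rw [sub_eq_zero]
    refine hf fun i hi => ?_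
    have : i ∉ S := fun h' => Set.disjoint_left.1 h h' hi
    simp [resample, this]
  rw [infl, this, eLpNorm_zero']

theorem infl_sub_le (S : Set ι) {p : ℝ≥0∞} (hp : 1 ≤ p) {f g : (ι → E) → ℝ}
    (hfm : Measurable f) (hgm : Measurable g) :
    infl μ p S (fun x => f x - g x) ≤ infl μ p S f + infl μ p S g := by
  have : (fun q : (ι → E) × (ι → E) => (f q.1 - g q.1) - (f (resample S q) - g (resample S q))) =
      (fun q => f q.1 - f (resample S q)) - fun q => g q.1 - g (resample S q) := by
    ext q; simp only [Pi.sub_apply]; ring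
  rw [infl, this]
  exact eLpNorm_sub_le
    ((hfm.comp measurable_fst).sub (hfm.comp (measurable_resample S))).aestronglyMeasurable
    ((hgm.comp measurable_fst).sub (hgm.comp (measurable_resample S))).aestronglyMeasurable hp

theorem infl_add_le (S : Set ι) {p : ℝ≥0∞} (hp : 1 ≤ p) {f g : (ι → E) → ℝ}
    (hfm : Measurable f) (hgm : Measurable g) :
    infl μ p S (fun x => f x + g x) ≤ infl μ p S f + infl μ p S g := by
  have : (fun q : (ι → E) × (ι → E) => (f q.1 + g q.1) - (f (resample S q) + g (resample S q))) =
      (fun q => f q.1 - f (resample S q)) + fun q => g q.1 - g (resample S q) := by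
    ext q; simp only [Pi.add_apply]; ring
  rw [infl, this]
  exact eLpNorm_add_le
    ((hfm.comp measurable_fst).sub (hfm.comp (measurable_resample S))).aestronglyMeasurable
    ((hgm.comp measurable_fst).sub (hgm.comp (measurable_resample S))).aestronglyMeasurable hp

theorem infl_sum_le {τ : Type*} (s : Finset τ) (a : τ → ℝ) {G : τ → (ι → E) → ℝ}
    (hG : ∀ t, Measurable (G t)) (S : Set ι) {p : ℝ≥0∞} (hp : 1 ≤ p) :
    infl μ p S (fun x => ∑ t ∈ s, a t * G t x) ≤ ∑ t ∈ s, ‖a t‖ₑ * infl μ p S (G t) := by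
  have : (fun q : (ι → E) × (ι → E) => (∑ t ∈ s, a t * G t q.1) -
      ∑ t ∈ s, a t * G t (resample S q)) =
      ∑ t ∈ s, a t • (fun q : (ι → E) × (ι → E) => G t q.1 - G t (resample S q)) := by
    ext q
    rw [← Finset.sum_sub_distrib, Finset.sum_apply]
    refine Finset.sum_congr rfl fun t _ => ?_
    simp only [Pi.smul_apply, smul_eq_mul]
    ring
  rw [infl, this]
  have hm : ∀ t, AEStronglyMeasurable
      (fun q : (ι → E) × (ι → E) => G t q.1 - G t (resample S q))
      ((iidLaw ι μ).prod (iidLaw ι μ)) := fun t =>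
    (((hG t).comp measurable_fst).sub ((hG t).comp (measurable_resample S))).aestronglyMeasurable
  refine (eLpNorm_sum_le (fun t _ => (hm t).const_smul _) hp).trans ?_
  exact Finset.sum_le_sum fun t _ => (eLpNorm_const_smul _ _ _ _).le

/-- If `u ∈ S`, the average no longer depends on `u`. Otherwise resampling at `u` commutes with
resampling on `S` from a third independent sequence, and Jensen over that sequence applies. -/
theorem infl_avg_le (S : Set ι) (u : ι) {f : (ι → E) → ℝ} (hfm : Measurable f)
    (hf : Integrable f (iidLaw ι μ)) {p : ℝ≥0∞} (hp : 1 ≤ p) (hp' : p ≠ ∞) :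
    infl μ p {u} (avg μ S f) ≤ infl μ p {u} f := by
  by_cases hu : u ∈ S
  · rw [infl_eq_zero (avg_dependsOn S f) (by simpa using hu)]
    exact zero_le
  -- The third sequence `z.2` replaces the coordinates in `S`; `z.1.2` stays available to resample
  -- at `u`.
  let Φ : ((ι → E) × (ι → E)) × (ι → E) → (ι → E) × (ι → E) :=
    fun z => (resample S (z.1.1, z.2), z.1.2)
  have hΦ : MeasurePreserving Φ (((iidLaw ι μ).prod (iidLaw ι μ)).prod (iidLaw ι μ))
      ((iidLaw ι μ).prod (iidLaw ι μ)) := by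
    have h1 : MeasurePreserving (fun z : ((ι → E) × (ι → E)) × (ι → E) => ((z.1.1, z.2), z.1.2))
        (((iidLaw ι μ).prod (iidLaw ι μ)).prod (iidLaw ι μ))
        (((iidLaw ι μ).prod (iidLaw ι μ)).prod (iidLaw ι μ)) := by
      have e1 := measurePreserving_prodAssoc (iidLaw ι μ) (iidLaw ι μ) (iidLaw ι μ)
      have e2 := (MeasurePreserving.id (iidLaw ι μ)).prod
        (Measure.measurePreserving_swap (μ := iidLaw ι μ) (ν := iidLaw ι μ))
      exact e1.symm.comp (e2.comp e1)
    exact ((measurePreserving_resample μ S).prod (MeasurePreserving.id (iidLaw ι μ))).comp h1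
  have hmD : Measurable (fun q : (ι → E) × (ι → E) => f q.1 - f (resample {u} q)) :=
    (hfm.comp measurable_fst).sub (hfm.comp (measurable_resample _))
  have hcomm : ∀ z : ((ι → E) × (ι → E)) × (ι → E),
      resample {u} (Φ z) = resample S (resample {u} z.1, z.2) := by
    intro z
    ext i
    by_cases hi : i ∈ S
    · have : i ≠ u := fun h => hu (h ▸ hi)
      simp [resample, Φ, hi, this]
    · simp [resample, Φ, hi]
  calc infl μ p {u} (avg μ S f)
      = eLpNorm (fun q => ∫ w, (fun z : ((ι → E) × (ι → E)) × (ι → E) =>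
          f (Φ z).1 - f (resample {u} (Φ z))) (q, w) ∂(iidLaw ι μ)) p
          ((iidLaw ι μ).prod (iidLaw ι μ)) := by
        refine eLpNorm_congr_ae ?_
        have h1 := ae_integrable_resample S hf
        filter_upwards [measurePreserving_fst.quasiMeasurePreserving.ae h1,
          (measurePreserving_resample μ {u}).quasiMeasurePreserving.ae h1] with q hq hq'
        simp only [hcomm]
        exact (integral_sub hq hq').symm
    _ ≤ eLpNorm (fun z => f (Φ z).1 - f (resample {u} (Φ z))) p
          (((iidLaw ι μ).prod (iidLaw ι μ)).prod (iidLaw ι μ)) :=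
        eLpNorm_integral_prod_le (hmD.comp hΦ.measurable) hp hp'
    _ = infl μ p {u} f :=
        eLpNorm_comp_measurePreserving (g := fun q => f q.1 - f (resample {u} q))
          hmD.aestronglyMeasurable hΦ

/-- Efron–Stein is used twice, for `f` and for `f²`. The increment of `f²` factors as `(f + f') (f -
f')`, so its `L²` norm is at most `2 ‖f‖₄` times the `L⁴` influence. With `X = ‖f‖₄` and `d²` the
sum of squared influences, `X² ≤ 2 X d + d²`. This takes the place of Burkholder's inequality. -/
theorem eLpNorm_four_sq_le [Countable ι] {f : (ι → E) → ℝ} (hfm : Measurable f)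
    (hf : MemLp f 4 (iidLaw ι μ)) (h0 : ∫ x, f x ∂(iidLaw ι μ) = 0) :
    eLpNorm f 4 (iidLaw ι μ) ^ 2 ≤ 9 * ∑' u, infl μ 4 {u} f ^ 2 := by
  set D := ∑' u, infl μ 4 {u} f ^ 2 with hD
  set X := eLpNorm f 4 (iidLaw ι μ) with hX
  by_cases hDt : D = ∞
  · simp [hDt]
  set d : ℝ≥0∞ := D ^ (2⁻¹ : ℝ) with hd
  have hd2 : d ^ 2 = D := by
    rw [hd, ← ENNReal.rpow_mul_natCast]; norm_num
  have hf2 := memLp_two_of_four hf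
  have hgm : Measurable (fun x => f x ^ 2) := hfm.pow_const 2
  have hg2 : MemLp (fun x => f x ^ 2) 2 (iidLaw ι μ) := by
    simpa [sq] using memLp_mul_of_four hf hf
  have h1 : eLpNorm (fun x => f x ^ 2 - ∫ y, f y ^ 2 ∂(iidLaw ι μ)) 2 (iidLaw ι μ) ≤
      2 * X * d := by
    rw [← (ENNReal.pow_right_strictMono two_ne_zero).le_iff_le]
    refine (efronStein hgm hg2).trans ?_
    rw [mul_pow, hd2, hD, ← ENNReal.tsum_mul_left]
    refine ENNReal.tsum_le_tsum fun u => ?_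
    rw [← mul_pow]
    refine pow_le_pow_left' ?_ 2
    have hfac : (fun q : (ι → E) × (ι → E) => f q.1 ^ 2 - f (resample {u} q) ^ 2) =
        fun q => (f q.1 + f (resample {u} q)) * (f q.1 - f (resample {u} q)) := by
      ext q; ring
    have hm1 : AEStronglyMeasurable (fun q : (ι → E) × (ι → E) => f q.1)
        ((iidLaw ι μ).prod (iidLaw ι μ)) := (hfm.comp measurable_fst).aestronglyMeasurable
    have hm2 : AEStronglyMeasurable (fun q : (ι → E) × (ι → E) => f (resample {u} q))
        ((iidLaw ι μ).prod (iidLaw ι μ)) := (hfm.comp (measurable_resample {u})).aestronglyMeasurable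
    rw [infl, hfac]
    refine (eLpNorm_mul_le_four (hm1.add hm2) (hm1.sub hm2)).trans ?_
    refine mul_le_mul' ?_ le_rfl
    refine (eLpNorm_add_le hm1 hm2 (by norm_num)).trans (le_of_eq ?_)
    rw [two_mul]
    exact congrArg₂ _ (eLpNorm_comp_fst hfm) (eLpNorm_comp_resample _ hfm)
  have h2 : ENNReal.ofReal (∫ y, f y ^ 2 ∂(iidLaw ι μ)) ≤ d ^ 2 := by
    rw [← eLpNorm_two_sq_eq hf2, hd2]
    have := efronStein hfm hf2
    simp only [h0, sub_zero] at this
    exact this.trans (ENNReal.tsum_le_tsum fun u => pow_le_pow_left' (infl_le_four _ hfm) 2)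
  have h3 : X ^ 2 ≤ 2 * X * d + d ^ 2 := by
    rw [hX, ← eLpNorm_sq_two]
    have : (fun x => f x ^ 2) = (fun x => f x ^ 2 - ∫ y, f y ^ 2 ∂(iidLaw ι μ)) +
        fun _ => ∫ y, f y ^ 2 ∂(iidLaw ι μ) := by ext x; simp
    calc eLpNorm (fun x => f x ^ 2) 2 (iidLaw ι μ)
        ≤ eLpNorm (fun x => f x ^ 2 - ∫ y, f y ^ 2 ∂(iidLaw ι μ)) 2 (iidLaw ι μ) +
          eLpNorm (fun _ => ∫ y, f y ^ 2 ∂(iidLaw ι μ)) 2 (iidLaw ι μ) := by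
          conv_lhs => rw [this]
          exact eLpNorm_add_le (hgm.sub measurable_const).aestronglyMeasurable
            aestronglyMeasurable_const (by norm_num)
      _ ≤ _ := by
          refine add_le_add h1 (le_trans (le_of_eq ?_) h2)
          rw [eLpNorm_const _ (by simp) (by simp [NeZero.ne])]
          simp only [measure_univ, ENNReal.one_rpow, mul_one]
          exact Real.enorm_of_nonneg (integral_nonneg fun _ => sq_nonneg _)
  have hXt : X ≠ ∞ := hf.2.ne
  have hdt : d ≠ ∞ := by
    intro h; rw [h] at hd2; exact hDt (by rw [← hd2]; simp)
  rw [← hd2]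
  clear_value X d
  lift X to NNReal using hXt
  lift d to NNReal using hdt
  norm_cast at h3 ⊢
  -- The quadratic inequality gives `X ≤ (1 + √2) d`; the constant `3` is a convenient upper bound.
  -- Finiteness of `X` is essential here.
  have h4 : X ≤ 3 * d := by
    by_contra! hlt
    have hpos : 0 < X := lt_of_le_of_lt zero_le hlt
    have h5 : (3 * d) * X < X * X := by gcongr
    have h6 : (3 * d) * d ≤ X * d := by gcongr
    have h3' : (X : ℝ) ^ 2 ≤ 2 * X * d + d ^ 2 := by exact_mod_cast h3
    have h5' : (3 * d : ℝ) * X < X * X := by exact_mod_cast h5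
    have h6' : (3 * d : ℝ) * d ≤ X * d := by exact_mod_cast h6
    nlinarith [sq_nonneg (d : ℝ)]
  calc X ^ 2 ≤ (3 * d) ^ 2 := by gcongr
    _ = 9 * d ^ 2 := by ring

end Influence

/-! ### Variance of quadratic forms in dependent variables. -/

section QuadraticVariance

variable {ι E : Type*} [MeasurableSpace E] {μ : Measure E} [IsProbabilityMeasure μ]

theorem memLp_linear {τ α : Type*} [MeasurableSpace α] {m : Measure α} {p : ℝ≥0∞} (s : Finset τ)
    (a : τ → ℝ) {G : τ → α → ℝ} (hG : ∀ t ∈ s, MemLp (G t) p m) :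
    MemLp (fun x => ∑ t ∈ s, a t * G t x) p m :=
  memLp_finsetSum _ fun t ht => (hG t ht).const_mul (a t)

theorem measurable_linear {τ α : Type*} [MeasurableSpace α] (s : Finset τ)
    (a : τ → ℝ) {G : τ → α → ℝ} (hG : ∀ t, Measurable (G t)) :
    Measurable (fun x => ∑ t ∈ s, a t * G t x) :=
  Finset.measurable_fun_sum _ fun t _ => (hG t).const_mul (a t)

/-- Schur's test: weighted Cauchy–Schwarz uses the bound `R` on the sums over `t`, and exchanging
the summations leaves the sums over `u`. -/
theorem tsum_sq_sum_mul_le {ι τ : Type*} (s : Finset τ) (g : τ → ι → ℝ≥0∞) (b : τ → ℝ≥0∞)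
    {R : ℝ≥0∞} (hR : ∀ u, ∑ t ∈ s, g t u ≤ R) :
    ∑' u, (∑ t ∈ s, g t u * b t) ^ 2 ≤ R * ∑ t ∈ s, b t ^ 2 * ∑' u, g t u := by
  calc ∑' u, (∑ t ∈ s, g t u * b t) ^ 2 ≤ ∑' u, R * ∑ t ∈ s, g t u * b t ^ 2 :=
        ENNReal.tsum_le_tsum fun u => (sq_sum_mul_le s _ _).trans (mul_le_mul' (hR u) le_rfl)
    _ = _ := by
        rw [ENNReal.tsum_mul_left, Summable.tsum_finsetSum fun _ _ => ENNReal.summable]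
        congr 1
        refine Finset.sum_congr rfl fun t _ => ?_
        rw [ENNReal.tsum_mul_right, mul_comm]

theorem eLpNorm_four_linear_sq_le [Countable ι] {τ : Type*} (s : Finset τ) (a : τ → ℝ)
    {G : τ → (ι → E) → ℝ} (hGm : ∀ t, Measurable (G t)) (hG : ∀ t, MemLp (G t) 4 (iidLaw ι μ))
    (hG0 : ∀ t, ∫ x, G t x ∂(iidLaw ι μ) = 0) {R : ℝ≥0∞}
    (hR : ∀ u, ∑ t ∈ s, infl μ 4 {u} (G t) ≤ R) :
    eLpNorm (fun x => ∑ t ∈ s, a t * G t x) 4 (iidLaw ι μ) ^ 2 ≤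
      9 * (R * ∑ t ∈ s, ‖a t‖ₑ ^ 2 * ∑' u, infl μ 4 {u} (G t)) := by
  have h0 : ∫ x, ∑ t ∈ s, a t * G t x ∂(iidLaw ι μ) = 0 := by
    rw [integral_finsetSum _ fun t _ => ((hG t).integrable (by norm_num)).const_mul _]
    exact Finset.sum_eq_zero fun t _ => by rw [integral_const_mul, hG0, mul_zero]
  refine (eLpNorm_four_sq_le (measurable_linear s a hGm) (memLp_linear s a fun t _ => hG t)
    h0).trans (mul_le_mul' le_rfl (le_trans (ENNReal.tsum_le_tsum fun u => ?_)
      (tsum_sq_sum_mul_le s (fun t u => infl μ 4 {u} (G t)) (fun t => ‖a t‖ₑ) hR)))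
  refine pow_le_pow_left' ((infl_sum_le s a hGm {u} (by norm_num)).trans (le_of_eq ?_)) 2
  exact Finset.sum_congr rfl fun t _ => mul_comm _ _

theorem measurable_bilinear {τ α : Type*} [MeasurableSpace α] (s : Finset τ)
    (a : τ → τ → ℝ) {F G : τ → α → ℝ} (hF : ∀ t, Measurable (F t)) (hG : ∀ t, Measurable (G t)) :
    Measurable (fun x => ∑ t ∈ s, ∑ r ∈ s, a t r * (F t x * G r x)) :=
  Finset.measurable_fun_sum _ fun t _ => Finset.measurable_fun_sum _ fun r _ =>
    ((hF t).mul (hG r)).const_mul _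

theorem memLp_bilinear {τ α : Type*} [MeasurableSpace α] {m : Measure α} (s : Finset τ)
    (a : τ → τ → ℝ) {F G : τ → α → ℝ} (hF : ∀ t, MemLp (F t) 4 m) (hG : ∀ t, MemLp (G t) 4 m) :
    MemLp (fun x => ∑ t ∈ s, ∑ r ∈ s, a t r * (F t x * G r x)) 2 m :=
  memLp_finsetSum _ fun t _ => memLp_finsetSum _ fun r _ =>
    (memLp_mul_of_four (hF t) (hG r)).const_mul _

/-- Product rule `F G - F' G' = (F - F') G + F' (G - G')` and Hölder. Summing first over the
undifferenced factor leaves `L⁴` norms of the linear forms given by rows and columns of `a`, which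
keeps the cancellation in these sums. -/
theorem infl_bilinear_le {τ : Type*} (s : Finset τ) (a : τ → τ → ℝ) {F G : τ → (ι → E) → ℝ}
    (hF : ∀ t, Measurable (F t)) (hG : ∀ t, Measurable (G t)) (S : Set ι) :
    infl μ 2 S (fun x => ∑ t ∈ s, ∑ r ∈ s, a t r * (F t x * G r x)) ≤
      (∑ t ∈ s, infl μ 4 S (F t) * eLpNorm (fun x => ∑ r ∈ s, a t r * G r x) 4 (iidLaw ι μ)) +
      ∑ r ∈ s, infl μ 4 S (G r) * eLpNorm (fun x => ∑ t ∈ s, a t r * F t x) 4 (iidLaw ι μ) := by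
  have : (fun q : (ι → E) × (ι → E) => (∑ t ∈ s, ∑ r ∈ s, a t r * (F t q.1 * G r q.1)) -
      ∑ t ∈ s, ∑ r ∈ s, a t r * (F t (resample S q) * G r (resample S q))) =
      (∑ t ∈ s, fun q : (ι → E) × (ι → E) =>
        (F t q.1 - F t (resample S q)) * ∑ r ∈ s, a t r * G r q.1) +
      ∑ r ∈ s, fun q : (ι → E) × (ι → E) =>
        (G r q.1 - G r (resample S q)) * ∑ t ∈ s, a t r * F t (resample S q) := by
    ext q
    simp only [Pi.add_apply, Finset.sum_apply, Finset.mul_sum]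
    rw [Finset.sum_comm (s := s) (t := s)
      (f := fun r t => (G r q.1 - G r (resample S q)) * (a t r * F t (resample S q))),
      ← Finset.sum_add_distrib, ← Finset.sum_sub_distrib]
    refine Finset.sum_congr rfl fun t _ => ?_
    rw [← Finset.sum_add_distrib, ← Finset.sum_sub_distrib]
    refine Finset.sum_congr rfl fun r _ => ?_
    ring
  have hd : ∀ {f : (ι → E) → ℝ}, Measurable f →
      AEStronglyMeasurable (fun q : (ι → E) × (ι → E) => f q.1 - f (resample S q))
        ((iidLaw ι μ).prod (iidLaw ι μ)) := fun h =>
    ((h.comp measurable_fst).sub (h.comp (measurable_resample S))).aestronglyMeasurable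
  have h1 : ∀ {f : (ι → E) → ℝ}, Measurable f →
      AEStronglyMeasurable (fun q : (ι → E) × (ι → E) => f q.1)
        ((iidLaw ι μ).prod (iidLaw ι μ)) := fun h => (h.comp measurable_fst).aestronglyMeasurable
  have h2 : ∀ {f : (ι → E) → ℝ}, Measurable f →
      AEStronglyMeasurable (fun q : (ι → E) × (ι → E) => f (resample S q))
        ((iidLaw ι μ).prod (iidLaw ι μ)) := fun h =>
    (h.comp (measurable_resample S)).aestronglyMeasurable
  have hA := fun t => measurable_linear s (fun r => a t r) hG
  have hB := fun r => measurable_linear s (fun t => a t r) hF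
  rw [infl, this]
  refine (eLpNorm_add_le
    (Finset.aestronglyMeasurable_sum _ fun t _ => (hd (hF t)).mul (h1 (hA t)))
    (Finset.aestronglyMeasurable_sum _ fun r _ => (hd (hG r)).mul (h2 (hB r)))
    (by norm_num)).trans (add_le_add ?_ ?_)
  · refine (eLpNorm_sum_le (fun t _ => (hd (hF t)).mul (h1 (hA t))) (by norm_num)).trans
      (Finset.sum_le_sum fun t _ => (eLpNorm_mul_le_four (hd (hF t)) (h1 (hA t))).trans ?_)
    exact (congrArg₂ _ rfl (eLpNorm_comp_fst (hA t))).le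
  · refine (eLpNorm_sum_le (fun r _ => (hd (hG r)).mul (h2 (hB r))) (by norm_num)).trans
      (Finset.sum_le_sum fun r _ => (eLpNorm_mul_le_four (hd (hG r)) (h2 (hB r))).trans ?_)
    exact (congrArg₂ _ rfl (eLpNorm_comp_resample S (hB r))).le

/-- The variance of a quadratic form in terms of the influences of single innovations. -/
theorem eLpNorm_bilinear_sub_integral_sq_le [Countable ι] {τ : Type*} (s : Finset τ)
    (a : τ → τ → ℝ) {F G : τ → (ι → E) → ℝ}
    (hFm : ∀ t, Measurable (F t)) (hF : ∀ t, MemLp (F t) 4 (iidLaw ι μ))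
    (hF0 : ∀ t, ∫ x, F t x ∂(iidLaw ι μ) = 0)
    (hGm : ∀ t, Measurable (G t)) (hG : ∀ t, MemLp (G t) 4 (iidLaw ι μ))
    (hG0 : ∀ t, ∫ x, G t x ∂(iidLaw ι μ) = 0) {R : ℝ≥0∞}
    (hRF : ∀ u, ∑ t ∈ s, infl μ 4 {u} (F t) ≤ R) (hRG : ∀ u, ∑ t ∈ s, infl μ 4 {u} (G t) ≤ R)
    (hRG' : ∀ t, ∑' u, infl μ 4 {u} (G t) ≤ R) :
    eLpNorm (fun x => (∑ t ∈ s, ∑ r ∈ s, a t r * (F t x * G r x)) -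
      ∫ y, ∑ t ∈ s, ∑ r ∈ s, a t r * (F t y * G r y) ∂(iidLaw ι μ)) 2 (iidLaw ι μ) ^ 2 ≤
      36 * R ^ 3 * ∑ t ∈ s, (∑ r ∈ s, ‖a t r‖ₑ ^ 2) * ∑' u, infl μ 4 {u} (F t) := by
  refine (efronStein (measurable_bilinear s a hFm hGm) (memLp_bilinear s a hF hG)).trans ?_
  set α : τ → ℝ≥0∞ := fun t => eLpNorm (fun x => ∑ r ∈ s, a t r * G r x) 4 (iidLaw ι μ) with hα
  set β : τ → ℝ≥0∞ := fun r => eLpNorm (fun x => ∑ t ∈ s, a t r * F t x) 4 (iidLaw ι μ) with hβ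
  have hα2 : ∀ t, α t ^ 2 ≤ 9 * (R * ∑ r ∈ s, ‖a t r‖ₑ ^ 2 * R) := fun t =>
    (eLpNorm_four_linear_sq_le s (fun r => a t r) hGm hG hG0 hRG).trans
      (mul_le_mul' le_rfl (mul_le_mul' le_rfl
        (Finset.sum_le_sum fun r _ => mul_le_mul' le_rfl (hRG' r))))
  have hβ2 : ∀ r, β r ^ 2 ≤ 9 * (R * ∑ t ∈ s, ‖a t r‖ₑ ^ 2 * ∑' u, infl μ 4 {u} (F t)) := fun r =>
    eLpNorm_four_linear_sq_le s (fun t => a t r) hFm hF hF0 hRF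
  -- The total influences of `F` stay inside `M` instead of being bounded by `R`: with `F` the error
  -- of a projection, their smallness is the gain sought.
  set M := ∑ t ∈ s, (∑ r ∈ s, ‖a t r‖ₑ ^ 2) * ∑' u, infl μ 4 {u} (F t) with hM
  have h1 : ∑' u, (∑ t ∈ s, infl μ 4 {u} (F t) * α t) ^ 2 ≤ 9 * R ^ 3 * M := by
    refine (tsum_sq_sum_mul_le s (fun t u => infl μ 4 {u} (F t)) α hRF).trans ?_
    calc R * ∑ t ∈ s, α t ^ 2 * ∑' u, infl μ 4 {u} (F t)
        ≤ R * ∑ t ∈ s, (9 * (R * ∑ r ∈ s, ‖a t r‖ₑ ^ 2 * R)) * ∑' u, infl μ 4 {u} (F t) := by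
          gcongr with t _
          exact hα2 t
      _ = 9 * R ^ 3 * M := by
          rw [hM, Finset.mul_sum, Finset.mul_sum]
          refine Finset.sum_congr rfl fun t _ => ?_
          rw [← Finset.sum_mul]
          ring
  have h2 : ∑' u, (∑ r ∈ s, infl μ 4 {u} (G r) * β r) ^ 2 ≤ 9 * R ^ 3 * M := by
    refine (tsum_sq_sum_mul_le s (fun t u => infl μ 4 {u} (G t)) β hRG).trans ?_
    calc R * ∑ r ∈ s, β r ^ 2 * ∑' u, infl μ 4 {u} (G r)
        ≤ R * ∑ r ∈ s, (9 * (R * ∑ t ∈ s, ‖a t r‖ₑ ^ 2 * ∑' u, infl μ 4 {u} (F t))) * R := by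
          gcongr with r _
          · exact hβ2 r
          · exact hRG' r
      _ = 9 * R ^ 3 * M := by
          have : M = ∑ r ∈ s, ∑ t ∈ s, ‖a t r‖ₑ ^ 2 * ∑' u, infl μ 4 {u} (F t) := by
            rw [hM, Finset.sum_comm]
            exact Finset.sum_congr rfl fun t _ => by rw [Finset.sum_mul]
          rw [this, Finset.mul_sum, Finset.mul_sum]
          refine Finset.sum_congr rfl fun t _ => ?_
          ring
  calc ∑' u, infl μ 2 {u} (fun x => ∑ t ∈ s, ∑ r ∈ s, a t r * (F t x * G r x)) ^ 2
      ≤ ∑' u, (2 * (∑ t ∈ s, infl μ 4 {u} (F t) * α t) ^ 2 +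
          2 * (∑ r ∈ s, infl μ 4 {u} (G r) * β r) ^ 2) :=
        ENNReal.tsum_le_tsum fun u =>
          (pow_le_pow_left' (infl_bilinear_le s a hFm hGm {u}) 2).trans (add_sq_le_two _ _)
    _ ≤ 2 * (9 * R ^ 3 * M) + 2 * (9 * R ^ 3 * M) := by
        rw [ENNReal.tsum_add, ENNReal.tsum_mul_left, ENNReal.tsum_mul_left]
        gcongr
    _ = 36 * R ^ 3 * M := by ring

end QuadraticVariance

/-! ### Causal processes and summability of their influences. -/

section CausalProcess

variable {E : Type*} [MeasurableSpace E]

/-- The causal process `X_t = f(x_t, x_{t-1}, …)` driven by the sequence `x`. -/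
def causal (f : (ℕ → E) → ℝ) (t : ℤ) (x : ℤ → E) : ℝ := f fun k => x (t - k)

theorem measurable_causal {f : (ℕ → E) → ℝ} (hf : Measurable f) (t : ℤ) :
    Measurable (causal f t) := hf.comp (by fun_prop)

theorem causal_dependsOn (f : (ℕ → E) → ℝ) (t : ℤ) : DependsOn (causal f t) (Set.Iic t) := by
  intro x y h
  unfold causal
  congr 1
  ext k
  exact h _ (by simp)

/-- A centred square integrable causal process whose functional dependence measure decays
cubically. -/
structure CubicDecay (μ : Measure E) (f : (ℕ → E) → ℝ) (C : ℝ) : Prop where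
  nonneg : 0 ≤ C
  measurable : Measurable f
  memLp : MemLp (causal f 0) 2 (iidLaw ℤ μ)
  mean_zero : ∫ x, causal f 0 x ∂(iidLaw ℤ μ) = 0
  infl_le : ∀ m : ℕ, infl μ 4 {0} (causal f m) ≤ ENNReal.ofReal (C / ((m : ℝ) + 1) ^ 3)

variable (μ : Measure E) [IsProbabilityMeasure μ]

theorem measurePreserving_shift (s : ℤ) :
    MeasurePreserving (fun (x : ℤ → E) i => x (i + s)) (iidLaw ℤ μ) (iidLaw ℤ μ) :=
  measurePreserving_reindex μ (add_left_injective s)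

variable {μ}

theorem causal_shift (f : (ℕ → E) → ℝ) (t s : ℤ) (x : ℤ → E) :
    causal f t (fun i => x (i + s)) = causal f (t + s) x := by
  unfold causal
  congr 1
  ext k
  exact congrArg x (by ring)

theorem infl_causal_eq {f : (ℕ → E) → ℝ} (hf : Measurable f) (t u : ℤ) {p : ℝ≥0∞} :
    infl μ p {u} (causal f t) = infl μ p {0} (causal f (t - u)) := by
  have hm : Measurable (fun q : (ℤ → E) × (ℤ → E) =>
      causal f (t - u) q.1 - causal f (t - u) (resample {0} q)) :=
    ((measurable_causal hf _).comp measurable_fst).sub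
      ((measurable_causal hf _).comp (measurable_resample _))
  have h2 := (measurePreserving_shift μ u).prod (measurePreserving_shift μ u)
  have := eLpNorm_comp_measurePreserving (p := p) hm.aestronglyMeasurable h2
  rw [infl, infl, ← this]
  congr 1
  ext q
  simp only [Function.comp_apply, Prod.map]
  rw [causal_shift, sub_add_cancel]
  have e : causal f t (resample {u} q) = causal f (t - u) (fun i => resample {u} q (i + u)) := by
    rw [causal_shift, sub_add_cancel]
  rw [e]
  congr 2
  ext i
  by_cases hi : i = 0 <;> simp [resample, hi]

theorem infl_causal_of_lt (f : (ℕ → E) → ℝ) {t u : ℤ} (h : t < u) {p : ℝ≥0∞} :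
    infl μ p {u} (causal f t) = 0 :=
  infl_eq_zero (causal_dependsOn f t) (by simpa using h)

theorem sum_range_inv_cube_le (i n : ℕ) :
    ∑ k ∈ Finset.range n, 1 / ((k : ℝ) + i + 1) ^ 3 ≤
      2 / ((i : ℝ) + 1) ^ 2 - 2 / ((n : ℝ) + i + 1) ^ 2 := by
  induction n with
  | zero => simp
  | succ n ih =>
    rw [Finset.sum_range_succ]
    have hx : (1 : ℝ) ≤ (n : ℝ) + i + 1 := by
      have : (0 : ℝ) ≤ (n : ℝ) + i := by positivity
      linarith
    set x : ℝ := (n : ℝ) + i + 1 with hxdef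
    have hc : ((n + 1 : ℕ) : ℝ) + i + 1 = x + 1 := by push_cast; rw [hxdef]; ring
    rw [hc]
    -- The telescoping comparison: after clearing denominators it reads `1 ≤ 3 x²`.
    have key : 1 / x ^ 3 ≤ 2 / x ^ 2 - 2 / (x + 1) ^ 2 := by
      rw [div_sub_div _ _ (by positivity) (by positivity), div_le_div_iff₀ (by positivity)
        (by positivity)]
      have : (2 * (x + 1) ^ 2 - x ^ 2 * 2) * x ^ 3 - 1 * (x ^ 2 * (x + 1) ^ 2)
          = x ^ 2 * (3 * x ^ 2 - 1) := by ring
      nlinarith [mul_nonneg (sq_nonneg x) (by nlinarith : (0 : ℝ) ≤ 3 * x ^ 2 - 1)]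
    linarith

theorem tsum_inv_cube_le {C : ℝ} (hC : 0 ≤ C) (i : ℕ) :
    ∑' n : ℕ, ENNReal.ofReal (C / ((n : ℝ) + i + 1) ^ 3) ≤
      ENNReal.ofReal (2 * C / ((i : ℝ) + 1) ^ 2) := by
  rw [ENNReal.tsum_eq_iSup_nat]
  refine iSup_le fun n => ?_
  rw [← ENNReal.ofReal_sum_of_nonneg fun k _ => by positivity]
  refine ENNReal.ofReal_le_ofReal ?_
  have h := mul_le_mul_of_nonneg_left (sum_range_inv_cube_le i n) hC
  rw [Finset.mul_sum] at h
  simp only [mul_one_div] at h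
  refine h.trans ?_
  rw [mul_sub]
  have : 0 ≤ C * (2 / ((n : ℝ) + i + 1) ^ 2) := by positivity
  have h2 : C * (2 / ((i : ℝ) + 1) ^ 2) = 2 * C / ((i : ℝ) + 1) ^ 2 := by ring
  linarith

namespace CubicDecay

variable {f : (ℕ → E) → ℝ} {C : ℝ} (h : CubicDecay μ f C)
include h

theorem memLp_two (t : ℤ) : MemLp (causal f t) 2 (iidLaw ℤ μ) := by
  have := h.memLp.comp_measurePreserving (measurePreserving_shift μ t)
  refine this.ae_eq (Eventually.of_forall fun x => ?_)
  simp only [Function.comp_apply]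
  rw [causal_shift, zero_add]

theorem integral_eq_zero (t : ℤ) : ∫ x, causal f t x ∂(iidLaw ℤ μ) = 0 := by
  have := integral_comp_measurePreserving (measurePreserving_shift μ t)
    (measurable_causal h.measurable 0).aestronglyMeasurable
  simp only [causal_shift, zero_add] at this
  rw [this, h.mean_zero]

/-- Total influence of the innovations at distance at least `i` in the past. -/
theorem tsum_infl_le (t : ℤ) (i : ℕ) :
    ∑' u, (Set.Iic (t - i)).indicator (fun u => infl μ 4 {u} (causal f t)) u ≤
      ENNReal.ofReal (2 * C / ((i : ℝ) + 1) ^ 2) := by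
  have hinj : Function.Injective (fun n : ℕ => t - i - (n : ℤ)) := by
    intro a b hab; simp only at hab; omega
  rw [← hinj.tsum_eq]
  · refine le_trans (ENNReal.tsum_le_tsum fun n => ?_) (tsum_inv_cube_le h.nonneg i)
    rw [Set.indicator_of_mem (by simp), infl_causal_eq h.measurable]
    have : t - (t - i - (n : ℤ)) = ((n + i : ℕ) : ℤ) := by push_cast; ring
    rw [this]
    refine (h.infl_le _).trans (le_of_eq ?_)
    push_cast
    rfl
  · intro u hu
    have : u ∈ Set.Iic (t - (i : ℤ)) := by
      by_contra hn
      exact hu (Set.indicator_of_notMem hn _)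
    rw [Set.mem_Iic] at this
    exact ⟨(t - i - u).toNat, by simp only; omega⟩

theorem tsum_infl_le_two_mul (t : ℤ) :
    ∑' u, infl μ 4 {u} (causal f t) ≤ ENNReal.ofReal (2 * C) := by
  refine le_trans (ENNReal.tsum_le_tsum fun u => ?_) ((h.tsum_infl_le t 0).trans (by simp))
  by_cases hu : u ≤ t
  · rw [Set.indicator_of_mem (by simpa using hu)]
  · rw [infl_causal_of_lt f (by omega)]
    exact zero_le

/-- By stationarity the influence depends only on the lag, so summing over times for one innovation
is the same as summing over innovations for one time. -/
theorem sum_infl_le_two_mul (s : Finset ℕ) (u : ℤ) :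
    ∑ t ∈ s, infl μ 4 {u} (causal f t) ≤ ENNReal.ofReal (2 * C) := by
  calc ∑ t ∈ s, infl μ 4 {u} (causal f t)
      = ∑ t ∈ s, infl μ 4 {-(t : ℤ)} (causal f (-u)) := by
        refine Finset.sum_congr rfl fun t _ => ?_
        rw [infl_causal_eq h.measurable, infl_causal_eq h.measurable (-u)]
        congr 2
        ring
    _ ≤ ∑' t : ℕ, infl μ 4 {-(t : ℤ)} (causal f (-u)) := ENNReal.sum_le_tsum s
    _ ≤ ∑' v : ℤ, infl μ 4 {v} (causal f (-u)) :=
        ENNReal.tsum_comp_le_tsum_of_injective (f := fun t : ℕ => -(t : ℤ))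
          (fun a b hab => by simpa using hab) (fun v => infl μ 4 {v} (causal f (-u)))
    _ ≤ _ := h.tsum_infl_le_two_mul _

/-- Averaging out all innovations turns the process into its mean, which is zero; the total
influence therefore bounds the `L⁴` norm itself. -/
theorem eLpNorm_four_le (t : ℤ) :
    eLpNorm (causal f t) 4 (iidLaw ℤ μ) ≤ ENNReal.ofReal (2 * C) := by
  have := eLpNorm_sub_avg_le_tsum Set.univ (measurable_causal h.measurable t) (h.memLp_two t)
    (p := 4) (by norm_num) (by simp)
  simp only [avg_univ, h.integral_eq_zero t, sub_zero, Set.indicator_univ] at this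
  exact this.trans (h.tsum_infl_le_two_mul t)

theorem memLp_four (t : ℤ) : MemLp (causal f t) 4 (iidLaw ℤ μ) :=
  ⟨(measurable_causal h.measurable t).aestronglyMeasurable,
    (h.eLpNorm_four_le t).trans_lt ENNReal.ofReal_lt_top⟩

end CubicDecay

end CausalProcess

/-! ### Projection on the innovations of a block. -/

section Blocks

theorem integral_avg {ι E : Type*} [MeasurableSpace E] {μ : Measure E} [IsProbabilityMeasure μ]
    (S : Set ι) {f : (ι → E) → ℝ} (hf : Integrable f (iidLaw ι μ)) :
    ∫ x, avg μ S f x ∂(iidLaw ι μ) = ∫ x, f x ∂(iidLaw ι μ) := by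
  have h := (measurePreserving_resample μ S).integrable_comp_of_integrable hf
  rw [← integral_comp_measurePreserving (measurePreserving_resample μ S) hf.1]
  exact (integral_prod _ h).symm

variable {E : Type*} [MeasurableSpace E] {μ : Measure E} [IsProbabilityMeasure μ]

/-- The coordinates outside of the block of length `ℓ` that contains `t`. -/
def blockCompl (ℓ : ℕ) (t : ℤ) : Set ℤ := {u | u / (ℓ : ℤ) ≠ t / (ℓ : ℤ)}

/-- The projection of `X_t` on the innovations in its own block of length `ℓ`. -/
def trunc (μ : Measure E) (f : (ℕ → E) → ℝ) (ℓ : ℕ) (t : ℤ) : (ℤ → E) → ℝ :=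
  avg μ (blockCompl ℓ t) (causal f t)

theorem avg_shift (S T : Set ℤ) (s : ℤ) (hST : ∀ i, i + s ∈ T ↔ i ∈ S) {f : (ℤ → E) → ℝ}
    (hf : Measurable f) (x : ℤ → E) :
    avg μ S f (fun i => x (i + s)) = avg μ T (fun z => f fun i => z (i + s)) x := by
  unfold avg
  have hm : Measurable (fun y => f (resample S (fun i => x (i + s), y))) :=
    hf.comp ((measurable_resample S).comp measurable_prodMk_left)
  rw [← integral_comp_measurePreserving (measurePreserving_shift μ s) hm.aestronglyMeasurable]
  congr 1
  ext y
  congr 1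
  ext i
  by_cases hi : i ∈ S
  · simp [resample, hi, (hST i).2 hi]
  · have hn : i + s ∉ T := fun h' => hi ((hST i).1 h')
    simp [resample, hi, hn]

namespace CubicDecay

variable {f : (ℕ → E) → ℝ} {C : ℝ} (h : CubicDecay μ f C) {ℓ : ℕ}
include h

/-- Only shifts by multiples of `ℓ` respect the partition into blocks; this is the stationarity the
projected process retains. -/
theorem trunc_shift (hℓ : 0 < ℓ) (t k : ℤ) (x : ℤ → E) :
    trunc μ f ℓ t (fun i => x (i + k * ℓ)) = trunc μ f ℓ (t + k * ℓ) x := by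
  have hℓ' : (ℓ : ℤ) ≠ 0 := by exact_mod_cast hℓ.ne'
  rw [trunc, avg_shift (blockCompl ℓ t) (blockCompl ℓ (t + k * ℓ)) (k * ℓ) ?_
    (measurable_causal h.measurable t)]
  · simp_rw [causal_shift]
    rfl
  · intro i
    simp [blockCompl, Int.add_mul_ediv_right _ _ hℓ']

theorem measurable_trunc (t : ℤ) : Measurable (trunc μ f ℓ t) :=
  measurable_avg _ (measurable_causal h.measurable t)

theorem memLp_trunc (t : ℤ) : MemLp (trunc μ f ℓ t) 4 (iidLaw ℤ μ) :=
  memLp_avg _ (measurable_causal h.measurable t) (by norm_num) (by simp) (h.memLp_four t)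

theorem integral_trunc (t : ℤ) : ∫ x, trunc μ f ℓ t x ∂(iidLaw ℤ μ) = 0 := by
  rw [trunc, integral_avg _ ((h.memLp_two t).integrable (by norm_num)), h.integral_eq_zero]

theorem infl_trunc_le (t u : ℤ) : infl μ 4 {u} (trunc μ f ℓ t) ≤ infl μ 4 {u} (causal f t) :=
  infl_avg_le _ _ (measurable_causal h.measurable t) ((h.memLp_two t).integrable (by norm_num))
    (by norm_num) (by simp)

theorem tsum_infl_trunc_le (t : ℤ) :
    ∑' u, infl μ 4 {u} (trunc μ f ℓ t) ≤ ENNReal.ofReal (2 * C) :=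
  (ENNReal.tsum_le_tsum fun u => h.infl_trunc_le t u).trans (h.tsum_infl_le_two_mul t)

theorem sum_infl_trunc_le (s : Finset ℕ) (u : ℤ) :
    ∑ t ∈ s, infl μ 4 {u} (trunc μ f ℓ t) ≤ ENNReal.ofReal (2 * C) :=
  (Finset.sum_le_sum fun (t : ℕ) _ => h.infl_trunc_le t u).trans (h.sum_infl_le_two_mul s u)

omit h in
theorem two_mul_ofReal_two_mul (C : ℝ) :
    ENNReal.ofReal (2 * C) + ENNReal.ofReal (2 * C) = ENNReal.ofReal (4 * C) := by
  rw [← two_mul]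
  have : (2 : ℝ≥0∞) = ENNReal.ofReal 2 := by simp
  rw [this, ← ENNReal.ofReal_mul (by norm_num)]
  ring_nf

theorem infl_resid_le (t u : ℤ) : infl μ 4 {u} (fun x => causal f t x - trunc μ f ℓ t x) ≤
    infl μ 4 {u} (causal f t) + infl μ 4 {u} (trunc μ f ℓ t) :=
  infl_sub_le _ (by norm_num) (measurable_causal h.measurable t) (h.measurable_trunc t)

theorem sum_infl_resid_le (s : Finset ℕ) (u : ℤ) :
    ∑ t ∈ s, infl μ 4 {u} (fun x => causal f t x - trunc μ f ℓ t x) ≤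
      ENNReal.ofReal (4 * C) := by
  refine (Finset.sum_le_sum fun (t : ℕ) _ => h.infl_resid_le t u).trans ?_
  rw [Finset.sum_add_distrib, ← two_mul_ofReal_two_mul]
  exact add_le_add (h.sum_infl_le_two_mul s u) (h.sum_infl_trunc_le s u)

theorem infl_sum_pair_le (t u : ℤ) : infl μ 4 {u} (fun x => causal f t x + trunc μ f ℓ t x) ≤
    infl μ 4 {u} (causal f t) + infl μ 4 {u} (trunc μ f ℓ t) :=
  infl_add_le _ (by norm_num) (measurable_causal h.measurable t) (h.measurable_trunc t)

/-- Total influence of all innovations on the error made by projecting on blocks. -/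
theorem tsum_infl_resid_le (hℓ : 0 < ℓ) (t : ℕ) :
    ∑' u, infl μ 4 {u} (fun x => causal f t x - trunc μ f ℓ t x) ≤
      ENNReal.ofReal (6 * C / (((t % ℓ : ℕ) : ℝ) + 1)) := by
  classical
  set i := t % ℓ with hi
  set D : (ℤ → E) → ℝ := fun x => causal f t x - trunc μ f ℓ t x with hD
  set τ := ENNReal.ofReal (2 * C / (((i + 1 : ℕ) : ℝ) + 1) ^ 2) with hτ
  have hdm : Measurable D := (measurable_causal h.measurable t).sub (h.measurable_trunc t)
  have hti : (t : ℤ) = ℓ * ((t : ℤ) / ℓ) + i := by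
    rw [hi, Int.natCast_mod]
    exact (Int.mul_ediv_add_emod _ _).symm
  -- `i` is the position of `t` in its block, so among past and present innovations exactly those of
  -- lag at least `i + 1` fall outside.
  have hmem : ∀ u : ℤ, u ≤ t → (u ∈ blockCompl ℓ t ↔ u ≤ (t : ℤ) - ((i + 1 : ℕ) : ℤ)) := by
    intro u hu
    have hℓ' : (0 : ℤ) < ℓ := by exact_mod_cast hℓ
    have h1 : u / (ℓ : ℤ) ≤ (t : ℤ) / ℓ := Int.ediv_le_ediv hℓ' hu
    have h2 : (t : ℤ) / ℓ ≤ u / (ℓ : ℤ) ↔ (t : ℤ) / ℓ * ℓ ≤ u := Int.le_ediv_iff_mul_le hℓ'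
    have h3 : u ∈ blockCompl ℓ t ↔ ¬ (t : ℤ) / ℓ ≤ u / (ℓ : ℤ) := by
      simp only [blockCompl, Set.mem_ofPred_eq]
      omega
    rw [h3, h2, mul_comm]
    push_cast
    omega
  have hD4 : eLpNorm D 4 (iidLaw ℤ μ) ≤ τ := by
    refine (eLpNorm_sub_avg_le_tsum (blockCompl ℓ t) (measurable_causal h.measurable t)
      (h.memLp_two t) (by norm_num) (by simp)).trans
      (le_trans (ENNReal.tsum_le_tsum fun u => ?_) (h.tsum_infl_le t (i + 1)))
    by_cases hu : u ≤ t
    · by_cases hb : u ∈ blockCompl ℓ t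
      · rw [Set.indicator_of_mem hb, Set.indicator_of_mem (by simpa using (hmem u hu).1 hb)]
      · rw [Set.indicator_of_notMem hb]
        exact zero_le
    · refine le_trans (Set.indicator_le_self' (fun _ _ => zero_le) _) ?_
      rw [infl_causal_of_lt f (by omega)]
      exact zero_le
  -- Before the block the projection ignores `u`, leaving the influence on `X_t`. For the `i + 1`
  -- innovations of the block up to time `t`, the influence is at most twice the norm of `D`, which
  -- is `O((i + 2)⁻²)`. Later innovations have no influence. Both parts together are `O(1 / (i +
  -- 1))`.
  have hpt : ∀ u : ℤ, infl μ 4 {u} D ≤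
      (Set.Iic ((t : ℤ) - ((i + 1 : ℕ) : ℤ))).indicator (fun u => infl μ 4 {u} (causal f t)) u +
      (↑(Finset.Icc ((t : ℤ) - i) t) : Set ℤ).indicator (fun _ => 2 * τ) u := by
    intro u
    by_cases hu : u ≤ t
    · by_cases hb : u ≤ (t : ℤ) - ((i + 1 : ℕ) : ℤ)
      · rw [Set.indicator_of_mem (by simpa using hb)]
        refine le_trans ((h.infl_resid_le t u).trans (le_of_eq ?_)) le_self_add
        rw [trunc, infl_eq_zero (avg_dependsOn _ _)
          (by simpa using (hmem u hu).2 hb), add_zero]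
      · rw [Set.indicator_of_mem (s := (↑(Finset.Icc ((t : ℤ) - i) t) : Set ℤ))
          (by simp; push_cast at hb; omega)]
        refine le_trans ((infl_le_two_mul _ (by norm_num) hdm).trans ?_) le_add_self
        exact mul_le_mul' le_rfl hD4
    · refine le_trans (h.infl_resid_le t u) ?_
      have h0 := infl_causal_of_lt (μ := μ) f (t := t) (u := u) (p := 4) (by omega)
      have := h.infl_trunc_le (ℓ := ℓ) t u
      rw [h0] at this
      rw [h0, le_antisymm this zero_le]
      simp
  refine (ENNReal.tsum_le_tsum hpt).trans ?_
  rw [ENNReal.tsum_add]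
  have hfin : ∑' u : ℤ, (↑(Finset.Icc ((t : ℤ) - i) t) : Set ℤ).indicator
      (fun _ => 2 * τ) u = ((i + 1 : ℕ) : ℝ≥0∞) * (2 * τ) := by
    rw [← tsum_subtype, Finset.tsum_subtype' (Finset.Icc ((t : ℤ) - i) t) (fun _ => 2 * τ),
      Finset.sum_const, nsmul_eq_mul]
    congr 2
    simp
    omega
  rw [hfin]
  refine (add_le_add (h.tsum_infl_le t (i + 1)) le_rfl).trans ?_
  have h2τ : (2 : ℝ≥0∞) * τ = ENNReal.ofReal (2 * (2 * C / (((i + 1 : ℕ) : ℝ) + 1) ^ 2)) := by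
    rw [ENNReal.ofReal_mul (by norm_num)]; simp [hτ]
  have hC := h.nonneg
  rw [h2τ, ← ENNReal.ofReal_natCast, ← ENNReal.ofReal_mul (by positivity),
    ← ENNReal.ofReal_add (by positivity) (by positivity)]
  refine ENNReal.ofReal_le_ofReal ?_
  push_cast
  have h0 : (0 : ℝ) ≤ i := by positivity
  have e : 2 * C / ((i : ℝ) + 1 + 1) ^ 2 + ((i : ℝ) + 1) * (2 * (2 * C / ((i : ℝ) + 1 + 1) ^ 2)) =
      2 * C * (2 * i + 3) / ((i : ℝ) + 1 + 1) ^ 2 := by ring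
  rw [e, div_le_div_iff₀ (by positivity) (by positivity)]
  nlinarith [mul_nonneg hC h0, mul_nonneg hC (mul_nonneg h0 h0)]

/-- Replacing `X` by its blockwise projections in a symmetric quadratic form. -/
theorem quad_sub_quad_trunc_le (hℓ : 0 < ℓ) (n : ℕ) (a : ℕ → ℕ → ℝ) (ha : ∀ t r, a t r = a r t)
    {A : ℝ≥0∞} (hA : ∀ t, ∑ r ∈ Finset.range n, ‖a t r‖ₑ ^ 2 ≤ A) :
    eLpNorm (fun x =>
      ((∑ t ∈ Finset.range n, ∑ r ∈ Finset.range n, a t r * (causal f t x * causal f r x)) -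
        ∫ y, ∑ t ∈ Finset.range n, ∑ r ∈ Finset.range n, a t r * (causal f t y * causal f r y)
          ∂(iidLaw ℤ μ)) -
      ((∑ t ∈ Finset.range n, ∑ r ∈ Finset.range n, a t r * (trunc μ f ℓ t x * trunc μ f ℓ r x)) -
        ∫ y, ∑ t ∈ Finset.range n, ∑ r ∈ Finset.range n,
          a t r * (trunc μ f ℓ t y * trunc μ f ℓ r y) ∂(iidLaw ℤ μ))) 2 (iidLaw ℤ μ) ^ 2 ≤
      36 * ENNReal.ofReal (4 * C) ^ 3 *
        (A * ∑ t ∈ Finset.range n, ENNReal.ofReal (6 * C / (((t % ℓ : ℕ) : ℝ) + 1))) := by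
  set s := Finset.range n
  have hX4 := fun t : ℕ => h.memLp_four (t : ℤ)
  have hT4 := fun t : ℕ => h.memLp_trunc (ℓ := ℓ) (t : ℤ)
  have hXi := fun t : ℕ => (hX4 t).integrable (by norm_num)
  have hTi := fun t : ℕ => (hT4 t).integrable (by norm_num)
  -- The mixed terms cancel by symmetry of `a`, so the difference of the two forms is a single
  -- bilinear form in the difference and the sum of the variables.
  have hid : ∀ x, (∑ t ∈ s, ∑ r ∈ s, a t r * ((causal f t x - trunc μ f ℓ t x) *
      (causal f r x + trunc μ f ℓ r x))) =
      (∑ t ∈ s, ∑ r ∈ s, a t r * (causal f t x * causal f r x)) -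
      ∑ t ∈ s, ∑ r ∈ s, a t r * (trunc μ f ℓ t x * trunc μ f ℓ r x) := by
    intro x
    have hsw : ∑ t ∈ s, ∑ r ∈ s, a t r * (causal f t x * trunc μ f ℓ r x) =
        ∑ t ∈ s, ∑ r ∈ s, a t r * (trunc μ f ℓ t x * causal f r x) := by
      rw [Finset.sum_comm]
      refine Finset.sum_congr rfl fun t _ => Finset.sum_congr rfl fun r _ => ?_
      rw [ha]; ring
    have : ∀ t r : ℕ, a t r * ((causal f t x - trunc μ f ℓ t x) *
      (causal f r x + trunc μ f ℓ r x)) = a t r * (causal f t x * causal f r x) -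
      a t r * (trunc μ f ℓ t x * trunc μ f ℓ r x) + (a t r * (causal f t x * trunc μ f ℓ r x) -
      a t r * (trunc μ f ℓ t x * causal f r x)) := fun t r => by ring
    simp_rw [this, Finset.sum_add_distrib, Finset.sum_sub_distrib]
    rw [hsw]
    ring
  have hint := ((memLp_bilinear s a hX4 hX4).integrable (by norm_num))
  have hint' := ((memLp_bilinear s a hT4 hT4).integrable (by norm_num))
  have key := eLpNorm_bilinear_sub_integral_sq_le s a
    (F := fun t x => causal f t x - trunc μ f ℓ t x)
    (G := fun t x => causal f t x + trunc μ f ℓ t x) (R := ENNReal.ofReal (4 * C))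
    (fun t => (measurable_causal h.measurable t).sub (h.measurable_trunc t))
    (fun t => (hX4 t).sub (hT4 t))
    (fun t => by rw [integral_sub (hXi t) (hTi t), h.integral_eq_zero, h.integral_trunc, sub_zero])
    (fun t => (measurable_causal h.measurable t).add (h.measurable_trunc t))
    (fun t => (hX4 t).add (hT4 t))
    (fun t => by rw [integral_add (hXi t) (hTi t), h.integral_eq_zero, h.integral_trunc, add_zero])
    (fun u => h.sum_infl_resid_le s u)
    (fun u => by
      refine (Finset.sum_le_sum fun (t : ℕ) _ => h.infl_sum_pair_le t u).trans ?_
      rw [Finset.sum_add_distrib, ← two_mul_ofReal_two_mul]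
      exact add_le_add (h.sum_infl_le_two_mul s u) (h.sum_infl_trunc_le s u))
    (fun t => by
      refine (ENNReal.tsum_le_tsum fun u => h.infl_sum_pair_le t u).trans ?_
      rw [ENNReal.tsum_add, ← two_mul_ofReal_two_mul]
      exact add_le_add (h.tsum_infl_le_two_mul t) (h.tsum_infl_trunc_le t))
  simp only [hid] at key
  rw [integral_sub hint hint'] at key
  refine le_trans (le_of_eq ?_) (key.trans (mul_le_mul' le_rfl ?_))
  · congr 2
    ext x
    ring
  · rw [Finset.mul_sum]
    exact Finset.sum_le_sum fun t _ => mul_le_mul' (hA t) (h.tsum_infl_resid_le hℓ t)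

/-- Used with `b` a difference of two coefficient matrices: changing the coefficients costs only
their Hilbert–Schmidt distance. -/
theorem quad_trunc_le (n : ℕ) (b : ℕ → ℕ → ℝ) :
    eLpNorm (fun x =>
      (∑ t ∈ Finset.range n, ∑ r ∈ Finset.range n, b t r * (trunc μ f ℓ t x * trunc μ f ℓ r x)) -
        ∫ y, ∑ t ∈ Finset.range n, ∑ r ∈ Finset.range n,
          b t r * (trunc μ f ℓ t y * trunc μ f ℓ r y) ∂(iidLaw ℤ μ)) 2 (iidLaw ℤ μ) ^ 2 ≤
      36 * ENNReal.ofReal (2 * C) ^ 4 *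
        ∑ t ∈ Finset.range n, ∑ r ∈ Finset.range n, ‖b t r‖ₑ ^ 2 := by
  have hT4 := fun t : ℕ => h.memLp_trunc (ℓ := ℓ) (t : ℤ)
  have key := eLpNorm_bilinear_sub_integral_sq_le (Finset.range n) b
    (F := fun t => trunc μ f ℓ t) (G := fun t => trunc μ f ℓ t)
    (R := ENNReal.ofReal (2 * C))
    (fun t => h.measurable_trunc t) hT4 (fun t => h.integral_trunc t)
    (fun t => h.measurable_trunc t) hT4 (fun t => h.integral_trunc t)
    (fun u => h.sum_infl_trunc_le _ u) (fun u => h.sum_infl_trunc_le _ u)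
    (fun t => h.tsum_infl_trunc_le t)
  refine key.trans ?_
  rw [show ∀ R S : ℝ≥0∞, 36 * R ^ 4 * S = 36 * R ^ 3 * (S * R) from fun R S => by ring,
    Finset.sum_mul]
  exact mul_le_mul' le_rfl
    (Finset.sum_le_sum fun t _ => mul_le_mul' le_rfl (h.tsum_infl_trunc_le t))

end CubicDecay

end Blocks

/-! ### Independence and moments of block sums. -/

section Regroup

/-- Injectivity of `σ` makes the groups of coordinates disjoint. Selecting them and currying gives
an i.i.d. sequence of groups, to which `H` is applied separately. -/
theorem map_regroup {ι κ E F : Type*} [MeasurableSpace E] [MeasurableSpace F] {μ : Measure E}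
    [IsProbabilityMeasure μ]
    {σ : ℕ × κ → ι} (hσ : Function.Injective σ) {H : (κ → E) → F} (hH : Measurable H) :
    (iidLaw ι μ).map (fun x k => H fun j => x (σ (k, j))) = iidLaw ℕ ((iidLaw κ μ).map H) := by
  have h1 := Measure.infinitePi_map_pi (fun _ : ℕ => iidLaw κ μ) (fun _ => hH)
  rw [show iidLaw ℕ ((iidLaw κ μ).map H) = _ from h1.symm,
    ← Measure.infinitePi_map_curry (fun (_ : ℕ) (_ : κ) => μ),
    show (Measure.infinitePi fun _ : ℕ × κ => μ) = _ from (measurePreserving_reindex μ hσ).map_eq.symm,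
    Measure.map_map (by fun_prop)
      (measurePreserving_reindex μ hσ).measurable, Measure.map_map (by fun_prop) (by fun_prop)]
  rfl

variable {E : Type*} [MeasurableSpace E] {μ : Measure E} [IsProbabilityMeasure μ]

/-- The sum of the projected variables over the `k`-th block of length `ℓ`. -/
def blockSum (μ : Measure E) (f : (ℕ → E) → ℝ) (ℓ k : ℕ) (x : ℤ → E) : ℝ :=
  ∑ i ∈ Finset.range ℓ, trunc μ f ℓ ((k * ℓ + i : ℕ) : ℤ) x

namespace CubicDecay

variable {f : (ℕ → E) → ℝ} {C : ℝ} (h : CubicDecay μ f C) {ℓ : ℕ}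
include h

theorem measurable_blockSum (k : ℕ) : Measurable (blockSum μ f ℓ k) :=
  Finset.measurable_fun_sum _ fun _ _ => h.measurable_trunc _

theorem memLp_blockSum (k : ℕ) : MemLp (blockSum μ f ℓ k) 4 (iidLaw ℤ μ) :=
  memLp_finsetSum _ fun _ _ => h.memLp_trunc _

theorem integral_blockSum (k : ℕ) : ∫ x, blockSum μ f ℓ k x ∂(iidLaw ℤ μ) = 0 := by
  unfold blockSum
  rw [integral_finsetSum _ fun i _ => (h.memLp_trunc _).integrable (by norm_num)]
  exact Finset.sum_eq_zero fun i _ => h.integral_trunc _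

theorem blockSum_shift (hℓ : 0 < ℓ) (k : ℕ) (x : ℤ → E) :
    blockSum μ f ℓ k x = blockSum μ f ℓ 0 (fun i => x (i + k * ℓ)) := by
  unfold blockSum
  refine Finset.sum_congr rfl fun i _ => ?_
  rw [h.trunc_shift hℓ]
  congr 1
  push_cast
  ring

omit h in
theorem blockSum_zero_dependsOn (hℓ : 0 < ℓ) :
    DependsOn (blockSum μ f ℓ 0) (Set.Ico (0 : ℤ) ℓ) := by
  have hℓ' : (0 : ℤ) < ℓ := by exact_mod_cast hℓ
  intro x y hxy
  unfold blockSum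
  refine Finset.sum_congr rfl fun i hi => ?_
  refine avg_dependsOn _ _ fun u hu => hxy u ?_
  have hi' : ((0 * ℓ + i : ℕ) : ℤ) / ℓ = 0 := by
    rw [zero_mul, zero_add]
    exact Int.ediv_eq_zero_of_lt (by positivity) (by simpa using hi)
  simp only [blockCompl, Set.mem_compl_iff, Set.mem_ofPred_eq, not_not, hi'] at hu
  have h1 := Int.mul_ediv_add_emod u ℓ
  have h2 := Int.emod_nonneg u hℓ'.ne'
  have h3 := Int.emod_lt_of_pos u hℓ'
  rw [hu, mul_zero, zero_add] at h1
  exact ⟨by omega, by omega⟩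

/-- The block sums are i.i.d. -/
theorem map_blockSum (hℓ : 0 < ℓ) :
    (iidLaw ℤ μ).map (fun x k => blockSum μ f ℓ k x) =
      iidLaw ℕ ((iidLaw ℤ μ).map (blockSum μ f ℓ 0)) := by
  classical
  obtain ⟨e₀⟩ : Nonempty E := nonempty_of_isProbabilityMeasure μ
  have hℓ' : (0 : ℤ) < ℓ := by exact_mod_cast hℓ
  -- Extends one block of innovations to a full sequence. The filler `e₀` is harmless, since the
  -- block sum reads only the coordinates in `[0, ℓ)`.
  let ext : (Fin ℓ → E) → ℤ → E := fun z i =>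
    if hi : 0 ≤ i ∧ i < ℓ then z ⟨i.toNat, by omega⟩ else e₀
  have hext : Measurable ext := by
    refine measurable_pi_lambda _ fun i => ?_
    by_cases hi : 0 ≤ i ∧ i < ℓ
    · simp only [ext, hi, and_self, dite_true]; exact measurable_pi_apply _
    · simp only [ext, hi, dite_false]; exact measurable_const
  let σ : ℕ × Fin ℓ → ℤ := fun p => (p.1 : ℤ) * ℓ + (p.2 : ℕ)
  have hσ : Function.Injective σ := by
    rintro ⟨a, b⟩ ⟨c, d⟩ hh
    have hb : ((b : ℕ) : ℤ) < ℓ := by exact_mod_cast b.2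
    have hd : ((d : ℕ) : ℤ) < ℓ := by exact_mod_cast d.2
    have e1 : ((a : ℤ) * ℓ + (b : ℕ)) / ℓ = a := by
      rw [add_comm, Int.add_mul_ediv_right _ _ hℓ'.ne', Int.ediv_eq_zero_of_lt (by positivity) hb,
        zero_add]
    have e2 : ((c : ℤ) * ℓ + (d : ℕ)) / ℓ = c := by
      rw [add_comm, Int.add_mul_ediv_right _ _ hℓ'.ne', Int.ediv_eq_zero_of_lt (by positivity) hd,
        zero_add]
    simp only [σ] at hh
    rw [hh, e2] at e1
    have hac : a = c := by exact_mod_cast e1.symm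
    subst hac
    have : b = d := by
      apply Fin.ext
      exact_mod_cast add_left_cancel hh
    rw [this]
  have hH : Measurable fun z => blockSum μ f ℓ 0 (ext z) := (h.measurable_blockSum 0).comp hext
  have key : ∀ (x : ℤ → E) (k : ℕ), blockSum μ f ℓ k x =
      blockSum μ f ℓ 0 (ext fun j => x (σ (k, j))) := by
    intro x k
    rw [h.blockSum_shift hℓ]
    refine blockSum_zero_dependsOn hℓ fun i hi => ?_
    have hi' : 0 ≤ i ∧ i < ℓ := hi
    simp only [ext, hi', and_self, dite_true, σ]
    congr 1
    omega
  have h1 := map_regroup (μ := μ) hσ hH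
  simp only [← key] at h1
  have : IsProbabilityMeasure
      ((iidLaw (Fin ℓ) μ).map fun z => blockSum μ f ℓ 0 (ext z)) :=
    Measure.isProbabilityMeasure_map hH.aemeasurable
  have h2 : ((iidLaw ℤ μ).map (fun x k => blockSum μ f ℓ k x)).map (fun y : ℕ → ℝ => y 0) =
      (iidLaw (Fin ℓ) μ).map fun z => blockSum μ f ℓ 0 (ext z) := by
    rw [h1, Measure.infinitePi_map_eval]
  rw [Measure.map_map (by fun_prop)
    (measurable_pi_lambda _ fun k => h.measurable_blockSum k)] at h2
  rw [h1, ← h2]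
  rfl

/-- The fourth moment of a block sum is of order `ℓ²`, as for independent summands. The constant is
`9 · (2 C) · (2 C)`, with all coefficients equal to one. -/
theorem eLpNorm_blockSum_sq_le (k : ℕ) :
    eLpNorm (blockSum μ f ℓ k) 4 (iidLaw ℤ μ) ^ 2 ≤ ENNReal.ofReal (36 * C ^ 2 * ℓ) := by
  have hC := h.nonneg
  have := eLpNorm_four_linear_sq_le (Finset.range ℓ) (fun _ => 1)
    (G := fun i => trunc μ f ℓ ((k * ℓ + i : ℕ) : ℤ)) (R := ENNReal.ofReal (2 * C))
    (fun i => h.measurable_trunc _) (fun i => h.memLp_trunc _) (fun i => h.integral_trunc _)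
    (fun u => by
      have := h.sum_infl_trunc_le (ℓ := ℓ) ((Finset.range ℓ).map (addLeftEmbedding (k * ℓ))) u
      rw [Finset.sum_map] at this
      exact this)
  simp only [one_mul] at this
  refine this.trans ?_
  refine (mul_le_mul' le_rfl (mul_le_mul' le_rfl (Finset.sum_le_sum fun i _ =>
    mul_le_mul' le_rfl (h.tsum_infl_trunc_le _)))).trans (le_of_eq ?_)
  rw [Finset.sum_const, nsmul_eq_mul, Finset.card_range]
  simp only [enorm_one, one_pow, one_mul]
  have h9 : (9 : ℝ≥0∞) = ENNReal.ofReal 9 := by simp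
  rw [h9, ← ENNReal.ofReal_natCast, ← ENNReal.ofReal_mul (by positivity),
    ← ENNReal.ofReal_mul (by positivity), ← ENNReal.ofReal_mul (by positivity)]
  congr 1
  ring

/-- The bound grows like `log ℓ`, negligible against the order `ℓ` of the variance of a block sum.
-/
theorem eLpNorm_sum_resid_sq_le (hℓ : 0 < ℓ) :
    eLpNorm (fun x => (∑ i ∈ Finset.range ℓ, causal f (i : ℕ) x) - blockSum μ f ℓ 0 x) 2
      (iidLaw ℤ μ) ^ 2 ≤
      9 * (ENNReal.ofReal (4 * C) *
        ∑ i ∈ Finset.range ℓ, ENNReal.ofReal (6 * C / ((i : ℝ) + 1))) := by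
  have key := eLpNorm_four_linear_sq_le (Finset.range ℓ) (fun _ => 1)
    (G := fun (i : ℕ) x => causal f i x - trunc μ f ℓ i x) (R := ENNReal.ofReal (4 * C))
    (fun i => (measurable_causal h.measurable i).sub (h.measurable_trunc i))
    (fun i => (h.memLp_four i).sub (h.memLp_trunc i))
    (fun i => by
      rw [integral_sub ((h.memLp_four i).integrable (by norm_num))
        ((h.memLp_trunc i).integrable (by norm_num)), h.integral_eq_zero, h.integral_trunc,
        sub_zero])
    (fun u => h.sum_infl_resid_le _ u)
  have hid : (fun x => (∑ i ∈ Finset.range ℓ, causal f (i : ℕ) x) - blockSum μ f ℓ 0 x) =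
      fun x => ∑ i ∈ Finset.range ℓ, 1 * (causal f (i : ℕ) x - trunc μ f ℓ (i : ℕ) x) := by
    ext x
    simp [blockSum, Finset.sum_sub_distrib]
  rw [hid]
  refine le_trans (pow_le_pow_left' (eLpNorm_le_eLpNorm_of_exponent_le (q := 4) (by norm_num)
    ?_) 2) (key.trans ?_)
  · exact (measurable_linear (Finset.range ℓ) (fun _ => 1)
      (G := fun (i : ℕ) x => causal f i x - trunc μ f ℓ i x) fun i =>
      (measurable_causal h.measurable i).sub (h.measurable_trunc i)).aestronglyMeasurable
  · refine mul_le_mul' le_rfl (mul_le_mul' le_rfl (Finset.sum_le_sum fun i hi => ?_))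
    simp only [enorm_one, one_pow, one_mul]
    have := h.tsum_infl_resid_le hℓ i
    rwa [Nat.mod_eq_of_lt (Finset.mem_range.1 hi)] at this

end CubicDecay

end Regroup

/-! ### Moments of linear and quadratic forms in i.i.d. variables. -/

section IidQuadratic

/-- The square of the `L⁴` norm, as a real number. -/
def sqNormFour {α : Type*} [MeasurableSpace α] (m : Measure α) (f : α → ℝ) : ℝ :=
  √(∫ x, f x ^ 4 ∂m)

section General

variable {α : Type*} [MeasurableSpace α] {m : Measure α} {a b : α → ℝ}

theorem sqNormFour_nonneg : 0 ≤ sqNormFour m a := Real.sqrt_nonneg _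

theorem sqNormFour_sq : sqNormFour m a ^ 2 = ∫ x, a x ^ 4 ∂m :=
  Real.sq_sqrt (integral_nonneg fun x => by positivity)

theorem memLp_sq_of_four (ha : MemLp a 4 m) : MemLp (fun x => a x ^ 2) 2 m := by
  simpa [sq] using memLp_mul_of_four ha ha

theorem integrable_pow_four (ha : MemLp a 4 m) : Integrable (fun x => a x ^ 4) m := by
  have := (memLp_sq_of_four ha).integrable_mul (memLp_sq_of_four ha)
  refine this.congr (Eventually.of_forall fun x => ?_)
  simp only [Pi.mul_apply]; ring

theorem memLp_four_of_integrable (ha : AEStronglyMeasurable a m)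
    (h : Integrable (fun x => a x ^ 4) m) : MemLp a 4 m := by
  rw [← integrable_norm_rpow_iff ha (by simp) (by simp)]
  refine h.congr (Eventually.of_forall fun x => ?_)
  simp only [ENNReal.toReal_ofNat, Real.rpow_ofNat, Real.norm_eq_abs]
  rw [Even.pow_abs (by decide)]

theorem integrable_mul_sq_sq (ha : MemLp a 4 m) (hb : MemLp b 4 m) :
    Integrable (fun x => a x ^ 2 * b x ^ 2) m :=
  (memLp_sq_of_four ha).integrable_mul (memLp_sq_of_four hb)

theorem integrable_cube_mul (ha : MemLp a 4 m) (hb : MemLp b 4 m) :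
    Integrable (fun x => a x ^ 3 * b x) m := by
  have := (memLp_sq_of_four ha).integrable_mul (memLp_mul_of_four ha hb)
  refine this.congr (Eventually.of_forall fun x => ?_)
  simp only [Pi.mul_apply]; ring

theorem integral_sq_mul_sq_le (ha : MemLp a 4 m) (hb : MemLp b 4 m) :
    ∫ x, a x ^ 2 * b x ^ 2 ∂m ≤ sqNormFour m a * sqNormFour m b := by
  have h := integral_mul_le_Lp_mul_Lq_of_nonneg (μ := m) Real.HolderConjugate.two_two
    (f := fun x => a x ^ 2) (g := fun x => b x ^ 2)
    (Eventually.of_forall fun x => sq_nonneg _) (Eventually.of_forall fun x => sq_nonneg _)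
    (by simpa using memLp_sq_of_four ha) (by simpa using memLp_sq_of_four hb)
  refine h.trans (le_of_eq ?_)
  simp only [Real.rpow_two, ← Real.sqrt_eq_rpow, sqNormFour, ← pow_mul]

theorem sqNormFour_const_mul (c : ℝ) :
    sqNormFour m (fun x => c * a x) = c ^ 2 * sqNormFour m a := by
  unfold sqNormFour
  simp_rw [mul_pow]
  rw [integral_const_mul, show c ^ 4 = (c ^ 2) ^ 2 by ring, Real.sqrt_mul (by positivity),
    Real.sqrt_sq (by positivity)]

/-- In `L⁴`, orthogonality of `b` to `a³` improves the triangle inequality to one for squares. -/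
theorem sqNormFour_add_le (ha : MemLp a 4 m) (hb : MemLp b 4 m) (h : ∫ x, a x ^ 3 * b x ∂m = 0) :
    sqNormFour m (fun x => a x + b x) ≤ sqNormFour m a + 4 * sqNormFour m b := by
  refine Real.sqrt_le_iff.2
    ⟨by have := sqNormFour_nonneg (m := m) (a := a); have := sqNormFour_nonneg (m := m) (a := b); positivity, ?_⟩
  have i1 := integrable_pow_four ha
  have i2 := integrable_pow_four hb
  have i3 := integrable_mul_sq_sq ha hb
  have i4 := integrable_cube_mul ha hb
  -- Pointwise, the right side exceeds the left by `2 b² (a - b)²`; this absorbs the term `4 a b³`.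
  -- After integration the bound is at most `(A + 4 B)²`, where `A` and `B` are the two values of
  -- `sqNormFour`.
  have hle : ∫ x, (a x + b x) ^ 4 ∂m ≤ ∫ x, (a x ^ 4 + 4 * (a x ^ 3 * b x) +
      8 * (a x ^ 2 * b x ^ 2) + 3 * b x ^ 4) ∂m := by
    refine integral_mono (integrable_pow_four (ha.add hb))
      (((i1.add (i4.const_mul 4)).add (i3.const_mul 8)).add (i2.const_mul 3)) fun x => ?_
    simp only
    nlinarith [mul_nonneg (sq_nonneg (b x)) (sq_nonneg (a x - b x))]
  refine hle.trans ?_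
  rw [integral_add (by exact (i1.add (i4.const_mul 4)).add (i3.const_mul 8)) (i2.const_mul 3),
    integral_add (by exact i1.add (i4.const_mul 4)) (i3.const_mul 8),
    integral_add i1 (i4.const_mul 4), integral_const_mul, integral_const_mul, integral_const_mul,
    h, ← sqNormFour_sq, ← sqNormFour_sq]
  have := integral_sq_mul_sq_le ha hb
  nlinarith [sq_nonneg (sqNormFour m b)]

end General

variable {ν : Measure ℝ} [IsProbabilityMeasure ν]

theorem memLp_coord {p : ℝ≥0∞} (hν : MemLp id p ν) (k : ℕ) :
    MemLp (fun y : ℕ → ℝ => y k) p (iidLaw ℕ ν) :=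
  hν.comp_measurePreserving (measurePreserving_eval_infinitePi _ k)

/-- Resampling coordinate `k` does not change the law and makes the two factors functions of two
independent sequences. -/
theorem integrable_integral_mul_coord {F : (ℕ → ℝ) → ℝ} {g : ℝ → ℝ} {k : ℕ}
    (hd : DependsOn F {k}ᶜ) (hFm : Measurable F) (hgm : Measurable g)
    (hF : Integrable F (iidLaw ℕ ν)) (hg : Integrable g ν) :
    Integrable (fun y => F y * g (y k)) (iidLaw ℕ ν) ∧
      ∫ y, F y * g (y k) ∂(iidLaw ℕ ν) = (∫ y, F y ∂(iidLaw ℕ ν)) * ∫ x, g x ∂ν := by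
  have hev := measurePreserving_eval_infinitePi (fun _ : ℕ => ν) k
  have hg' : Integrable (fun y : ℕ → ℝ => g (y k)) (iidLaw ℕ ν) :=
    hev.integrable_comp_of_integrable hg
  have hm : Measurable (fun y : ℕ → ℝ => F y * g (y k)) :=
    hFm.mul (hgm.comp (measurable_pi_apply k))
  have heq : ∀ q : (ℕ → ℝ) × (ℕ → ℝ), F (resample {k} q) * g (resample {k} q k) =
      F q.1 * g (q.2 k) := by
    intro q
    congr 1
    · exact hd fun i hi => by
        have : i ≠ k := hi
        simp [resample, this]
    · simp [resample]
  have hmp := measurePreserving_resample ν ({k} : Set ℕ)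
  constructor
  · rw [← hmp.integrable_comp hm.aestronglyMeasurable]
    refine (hF.mul_prod hg').congr (Eventually.of_forall fun q => ?_)
    exact (heq q).symm
  · rw [← integral_comp_measurePreserving hmp hm.aestronglyMeasurable]
    simp_rw [heq]
    rw [integral_prod_mul F (fun y : ℕ → ℝ => g (y k)),
      integral_comp_measurePreserving hev hgm.aestronglyMeasurable]

theorem linear_dependsOn (n : ℕ) (a : ℕ → ℝ) :
    DependsOn (fun y : ℕ → ℝ => ∑ l ∈ Finset.range n, a l * y l) {n}ᶜ := by
  intro x y h
  refine Finset.sum_congr rfl fun l hl => ?_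
  rw [h l (by simpa using (Finset.mem_range.1 hl).ne)]

variable (hν : MemLp id 4 ν) (h0 : ∫ x, x ∂ν = 0)
include hν h0

/-- Induction on the number of variables: the new term is centred and independent of the previous
sum `L`, hence orthogonal both to `L` and to `L³`. -/
theorem iid_linear_moments (n : ℕ) (a : ℕ → ℝ) :
    ∫ y, (∑ l ∈ Finset.range n, a l * y l) ^ 2 ∂(iidLaw ℕ ν) =
        (∫ x, x ^ 2 ∂ν) * ∑ l ∈ Finset.range n, a l ^ 2 ∧
    sqNormFour (iidLaw ℕ ν) (fun y => ∑ l ∈ Finset.range n, a l * y l) ≤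
        4 * sqNormFour ν id * ∑ l ∈ Finset.range n, a l ^ 2 := by
  induction n with
  | zero => simp [sqNormFour]
  | succ n ih =>
    set L : (ℕ → ℝ) → ℝ := fun y => ∑ l ∈ Finset.range n, a l * y l with hL
    have hLm : Measurable L := by fun_prop
    have hL4 : MemLp L 4 (iidLaw ℕ ν) := memLp_linear _ a fun l _ => memLp_coord hν l
    have hLd : DependsOn L {n}ᶜ := linear_dependsOn n a
    have hyn := memLp_coord hν n
    have hb4 : MemLp (fun y : ℕ → ℝ => a n * y n) 4 (iidLaw ℕ ν) := hyn.const_mul _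
    have hxi : Integrable (fun x : ℝ => x) ν := hν.integrable (by norm_num)
    have hev := measurePreserving_eval_infinitePi (fun _ : ℕ => ν) n
    have hy2 : ∫ y : ℕ → ℝ, y n ^ 2 ∂(iidLaw ℕ ν) = ∫ x, x ^ 2 ∂ν :=
      integral_comp_measurePreserving hev (g := fun x => x ^ 2) (by fun_prop)
    have hy4 : sqNormFour (iidLaw ℕ ν) (fun y => y n) = sqNormFour ν id := by
      unfold sqNormFour
      congr 1
      exact integral_comp_measurePreserving hev (g := fun x => x ^ 4) (by fun_prop)
    have hc1 := (integrable_integral_mul_coord (ν := ν) (k := n) hLd hLm measurable_id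
      (hL4.integrable (by norm_num)) hxi).2
    have hL3i : Integrable (fun y => L y ^ 3) (iidLaw ℕ ν) := by
      have := integrable_cube_mul hL4 (memLp_const (1 : ℝ))
      simpa using this
    have hc3 := (integrable_integral_mul_coord (ν := ν) (k := n) (F := fun y => L y ^ 3)
      (fun x y hxy => by simp only [hLd hxy]) (hLm.pow_const 3) measurable_id hL3i hxi).2
    simp only [id, h0, mul_zero] at hc1 hc3
    simp_rw [Finset.sum_range_succ]
    constructor
    · have hL2i : Integrable (fun y => L y ^ 2) (iidLaw ℕ ν) :=
        (memLp_two_of_four hL4).integrable_sq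
      have hyi : Integrable (fun y : ℕ → ℝ => y n ^ 2) (iidLaw ℕ ν) :=
        (memLp_two_of_four hyn).integrable_sq
      have hLy : Integrable (fun y : ℕ → ℝ => L y * y n) (iidLaw ℕ ν) :=
        (memLp_mul_of_four hL4 hyn).integrable (by norm_num)
      have e : ∀ y : ℕ → ℝ, (L y + a n * y n) ^ 2 =
          L y ^ 2 + ((2 * a n) * (L y * y n) + a n ^ 2 * y n ^ 2) := fun y => by ring
      change ∫ y, (L y + a n * y n) ^ 2 ∂(iidLaw ℕ ν) = _
      simp_rw [e]
      rw [integral_add hL2i (by exact (hLy.const_mul _).add (hyi.const_mul _)),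
        integral_add (hLy.const_mul _) (hyi.const_mul _), integral_const_mul, integral_const_mul,
        hc1, hy2, ih.1]
      ring
    · refine (sqNormFour_add_le (a := L) hL4 hb4 ?_).trans ?_
      · have e : ∀ y : ℕ → ℝ, L y ^ 3 * (a n * y n) = a n * (L y ^ 3 * y n) := fun y => by ring
        simp_rw [e]
        rw [integral_const_mul, hc3, mul_zero]
      · rw [sqNormFour_const_mul, hy4]
        linarith [ih.2]

/-- Since `l < k`, the new summand is `Z y_n` with `Z` linear in earlier variables: a martingale
increment, orthogonal to `W` and `W³`. The constant `16` is `4` from adding an increment times `4`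
from the linear form `Z`. -/
theorem iid_quadratic_moments (n : ℕ) (c : ℕ → ℕ → ℝ) :
    MemLp (fun y : ℕ → ℝ => ∑ k ∈ Finset.range n, ∑ l ∈ Finset.range k, c k l * y l * y k) 4
      (iidLaw ℕ ν) ∧
    ∫ y, ∑ k ∈ Finset.range n, ∑ l ∈ Finset.range k, c k l * y l * y k ∂(iidLaw ℕ ν) = 0 ∧
    ∫ y, (∑ k ∈ Finset.range n, ∑ l ∈ Finset.range k, c k l * y l * y k) ^ 2 ∂(iidLaw ℕ ν) =
        (∫ x, x ^ 2 ∂ν) ^ 2 * ∑ k ∈ Finset.range n, ∑ l ∈ Finset.range k, c k l ^ 2 ∧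
    sqNormFour (iidLaw ℕ ν)
        (fun y => ∑ k ∈ Finset.range n, ∑ l ∈ Finset.range k, c k l * y l * y k) ≤
        16 * sqNormFour ν id ^ 2 * ∑ k ∈ Finset.range n, ∑ l ∈ Finset.range k, c k l ^ 2 := by
  induction n with
  | zero => simp [sqNormFour]
  | succ n ih =>
    obtain ⟨hW4, hW0, hW2, hWn⟩ := ih
    set W : (ℕ → ℝ) → ℝ :=
      fun y => ∑ k ∈ Finset.range n, ∑ l ∈ Finset.range k, c k l * y l * y k with hW
    set Z : (ℕ → ℝ) → ℝ := fun y => ∑ l ∈ Finset.range n, c n l * y l with hZ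
    have hWm : Measurable W := by fun_prop
    have hZm : Measurable Z := by fun_prop
    have hZ4 : MemLp Z 4 (iidLaw ℕ ν) := memLp_linear _ _ fun l _ => memLp_coord hν l
    have hZd : DependsOn Z {n}ᶜ := linear_dependsOn n _
    have hWd : DependsOn W {n}ᶜ := by
      intro x y h
      refine Finset.sum_congr rfl fun k hk => Finset.sum_congr rfl fun l hl => ?_
      have hk' := Finset.mem_range.1 hk
      have hl' := Finset.mem_range.1 hl
      rw [h l (by simpa using (hl'.trans hk').ne), h k (by simpa using hk'.ne)]
    have hxi : Integrable (fun x : ℝ => x) ν := hν.integrable (by norm_num)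
    have hx2 : Integrable (fun x : ℝ => x ^ 2) ν := (memLp_two_of_four hν).integrable_sq
    have hx4 : Integrable (fun x : ℝ => x ^ 4) ν := integrable_pow_four hν
    have hZi := hZ4.integrable (q := 4) (by norm_num)
    have c1 := integrable_integral_mul_coord (ν := ν) (k := n) hZd hZm measurable_id hZi hxi
    have c2 := integrable_integral_mul_coord (ν := ν) (k := n) (F := fun y => Z y ^ 2) (g := fun x => x ^ 2)
      (fun x y hxy => by simp only [hZd hxy]) (hZm.pow_const 2) (by fun_prop)
      (memLp_two_of_four hZ4).integrable_sq hx2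
    have c4 := integrable_integral_mul_coord (ν := ν) (k := n) (F := fun y => Z y ^ 4) (g := fun x => x ^ 4)
      (fun x y hxy => by simp only [hZd hxy]) (hZm.pow_const 4) (by fun_prop)
      (integrable_pow_four hZ4) hx4
    have cWZ := integrable_integral_mul_coord (ν := ν) (k := n) (F := fun y => W y * Z y)
      (fun x y hxy => by simp only [hZd hxy, hWd hxy]) (hWm.mul hZm) measurable_id
      ((memLp_mul_of_four hW4 hZ4).integrable (by norm_num)) hxi
    have cW3Z := integrable_integral_mul_coord (ν := ν) (k := n) (F := fun y => W y ^ 3 * Z y)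
      (fun x y hxy => by simp only [hZd hxy, hWd hxy]) ((hWm.pow_const 3).mul hZm) measurable_id
      (integrable_cube_mul hW4 hZ4) hxi
    simp only [id, h0, mul_zero] at c1 cWZ cW3Z
    obtain ⟨hZ2, hZn⟩ := iid_linear_moments hν h0 n (c n)
    have hb4 : MemLp (fun y => Z y * y n) 4 (iidLaw ℕ ν) := by
      refine memLp_four_of_integrable (hZm.mul (measurable_pi_apply n)).aestronglyMeasurable ?_
      simp_rw [mul_pow]
      exact c4.1
    have hbn : sqNormFour (iidLaw ℕ ν) (fun y => Z y * y n) =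
        sqNormFour (iidLaw ℕ ν) Z * sqNormFour ν id := by
      unfold sqNormFour
      simp_rw [mul_pow]
      rw [c4.2, Real.sqrt_mul (integral_nonneg fun x => by positivity)]
      rfl
    have hstep : ∀ y : ℕ → ℝ, (∑ k ∈ Finset.range (n + 1), ∑ l ∈ Finset.range k,
        c k l * y l * y k) = W y + Z y * y n := by
      intro y
      rw [Finset.sum_range_succ, hZ, Finset.sum_mul]
    simp only [hstep]
    refine ⟨hW4.add hb4, ?_, ?_, ?_⟩
    · rw [integral_add (hW4.integrable (by norm_num)) c1.1, hW0, c1.2, add_zero]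
    · have e : ∀ y : ℕ → ℝ, (W y + Z y * y n) ^ 2 =
          W y ^ 2 + (2 * (W y * Z y * y n) + Z y ^ 2 * y n ^ 2) := fun y => by ring
      simp_rw [e]
      rw [integral_add (memLp_two_of_four hW4).integrable_sq
          (by exact (cWZ.1.const_mul 2).add c2.1),
        integral_add (cWZ.1.const_mul 2) c2.1, integral_const_mul, cWZ.2, c2.2, hW2, hZ2,
        Finset.sum_range_succ]
      ring
    · refine (sqNormFour_add_le hW4 hb4 ?_).trans ?_
      · have e : ∀ y : ℕ → ℝ, W y ^ 3 * (Z y * y n) = W y ^ 3 * Z y * y n := fun y => by ring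
        simp_rw [e]
        exact cW3Z.2
      · rw [hbn, Finset.sum_range_succ]
        have := mul_le_mul_of_nonneg_right hZn (sqNormFour_nonneg (m := ν) (a := id))
        nlinarith [this, hWn]

end IidQuadratic

/-! ### Lyapunov's central limit theorem by characteristic functions. -/

section Lyapunov

theorem norm_pow_sub_pow_le_mul {a b : ℂ} (ha : ‖a‖ ≤ 1) (hb : ‖b‖ ≤ 1) (p : ℕ) :
    ‖a ^ p - b ^ p‖ ≤ p * ‖a - b‖ := by
  induction p with
  | zero => simp
  | succ p ih =>
    have e : a ^ (p + 1) - b ^ (p + 1) = a * (a ^ p - b ^ p) + (a - b) * b ^ p := by ring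
    rw [e]
    refine (norm_add_le _ _).trans ?_
    rw [norm_mul, norm_mul, norm_pow]
    have h1 : ‖b‖ ^ p ≤ 1 := pow_le_one₀ (norm_nonneg _) hb
    have h2 : ‖a‖ * ‖a ^ p - b ^ p‖ ≤ 1 * ‖a ^ p - b ^ p‖ := by gcongr
    have h3 : ‖a - b‖ * ‖b‖ ^ p ≤ ‖a - b‖ * 1 := by gcongr
    push_cast
    linarith

/-- For `|x| ≤ 1` this is the Taylor remainder with `e ≤ 4`; for `|x| > 1` all terms on the left are
dominated by powers up to the cube. -/
theorem norm_exp_I_sub_taylor_le (x : ℝ) :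
    ‖Complex.exp (x * Complex.I) - (1 + x * Complex.I - (x : ℂ) ^ 2 / 2)‖ ≤ 4 * |x| ^ 3 := by
  by_cases hx : |x| ≤ 1
  · have h := Complex.norm_exp_sub_sum_le_norm_mul_exp (x * Complex.I) 3
    have e : ∑ m ∈ Finset.range 3, ((x : ℂ) * Complex.I) ^ m / (m.factorial : ℂ) =
        1 + x * Complex.I - (x : ℂ) ^ 2 / 2 := by
      simp [Finset.sum_range_succ, Nat.factorial, mul_pow]
      ring
    rw [e] at h
    refine h.trans ?_
    have hn : ‖(x : ℂ) * Complex.I‖ = |x| := by simp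
    rw [hn, mul_comm]
    have : Real.exp |x| ≤ 4 :=
      (Real.exp_le_exp.2 hx).trans (Real.exp_one_lt_d9.le.trans (by norm_num))
    gcongr
  · push Not at hx
    have h1 : ‖Complex.exp (x * Complex.I)‖ = 1 := Complex.norm_exp_ofReal_mul_I x
    have h2 : ‖(1 : ℂ) + x * Complex.I - (x : ℂ) ^ 2 / 2‖ ≤ 1 + |x| + |x| ^ 2 / 2 := by
      refine (norm_sub_le _ _).trans (add_le_add ((norm_add_le _ _).trans ?_) ?_) <;> simp
    refine (norm_sub_le _ _).trans ?_
    rw [h1]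
    nlinarith [mul_pos (sub_pos.2 hx) (sub_pos.2 hx), pow_pos (zero_lt_one.trans hx) 2,
      mul_pos (sub_pos.2 hx) (pow_pos (zero_lt_one.trans hx) 2)]

theorem abs_exp_neg_sub_le {s : ℝ} (hs : 0 ≤ s) : |(1 - s) - Real.exp (-s)| ≤ s ^ 2 := by
  by_cases h1 : s ≤ 1
  · have := Real.norm_exp_sub_one_sub_id_le (x := -s) (by simpa [abs_of_nonneg hs] using h1)
    rw [Real.norm_eq_abs, Real.norm_eq_abs, abs_neg, sq_abs] at this
    rw [abs_sub_comm]
    calc _ = |Real.exp (-s) - 1 - -s| := by ring_nf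
      _ ≤ _ := this
  · push Not at h1
    have h2 := Real.add_one_le_exp (-s)
    have h3 : Real.exp (-s) ≤ 1 := Real.exp_le_one_iff.2 (by linarith)
    rw [abs_le]
    constructor <;> nlinarith

/-- Both functions are compared with `1 - t² v / 2`, `v` being the second moment. Cauchy–Schwarz
replaces the third absolute moment by `√m₂ √m₄`, and bounds `v²` by `m₄`. -/
theorem norm_charFun_sub_le {ρ : Measure ℝ} [IsProbabilityMeasure ρ] (h4 : MemLp id 4 ρ)
    (h0 : ∫ x, x ∂ρ = 0) (t : ℝ) :
    ‖charFun ρ t - Real.exp (-(t ^ 2 / 2 * ∫ x, x ^ 2 ∂ρ))‖ ≤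
      4 * |t| ^ 3 * (√(∫ x, x ^ 2 ∂ρ) * √(∫ x, x ^ 4 ∂ρ)) +
        (t ^ 2 / 2) ^ 2 * ∫ x, x ^ 4 ∂ρ := by
  have hx : Integrable (fun x : ℝ => x) ρ := h4.integrable (by norm_num)
  have hx2 : Integrable (fun x : ℝ => x ^ 2) ρ := (memLp_two_of_four h4).integrable_sq
  have hx4 : Integrable (fun x : ℝ => x ^ 4) ρ := integrable_pow_four h4
  have habs2 : MemLp (fun x : ℝ => |x|) 2 ρ := (memLp_two_of_four h4).abs
  have hsq2 : MemLp (fun x : ℝ => x ^ 2) 2 ρ := memLp_sq_of_four h4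
  have hx3 : Integrable (fun x : ℝ => |x| ^ 3) ρ := by
    refine (habs2.integrable_mul hsq2).congr (Eventually.of_forall fun x => ?_)
    simp only [Pi.mul_apply, ← sq_abs x]; ring
  have h3 : ∫ x, |x| ^ 3 ∂ρ ≤ √(∫ x, x ^ 2 ∂ρ) * √(∫ x, x ^ 4 ∂ρ) := by
    have h := integral_mul_le_Lp_mul_Lq_of_nonneg (μ := ρ) Real.HolderConjugate.two_two
      (f := fun x => |x|) (g := fun x => x ^ 2)
      (Eventually.of_forall fun x => abs_nonneg _) (Eventually.of_forall fun x => sq_nonneg _)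
      (by simpa using habs2) (by simpa using hsq2)
    refine le_trans (le_of_eq ?_) (h.trans (le_of_eq ?_))
    · congr 1; ext x; rw [← sq_abs x]; ring
    · simp only [Real.rpow_two, ← Real.sqrt_eq_rpow, ← pow_mul, sq_abs]
  have hvar : (∫ x, x ^ 2 ∂ρ) ^ 2 ≤ ∫ x, x ^ 4 ∂ρ := by
    have h := integral_mul_le_Lp_mul_Lq_of_nonneg (μ := ρ) Real.HolderConjugate.two_two
      (f := fun x => x ^ 2) (g := fun _ => 1)
      (Eventually.of_forall fun x => sq_nonneg _) (Eventually.of_forall fun x => zero_le_one)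
      (by simpa using hsq2) (memLp_const _)
    simp only [mul_one, Real.rpow_two, ← Real.sqrt_eq_rpow, ← pow_mul, one_pow, integral_const,
      probReal_univ, smul_eq_mul, Real.sqrt_one] at h
    have hn : (0 : ℝ) ≤ ∫ x, x ^ 2 ∂ρ := integral_nonneg fun x => sq_nonneg _
    calc (∫ x, x ^ 2 ∂ρ) ^ 2 ≤ √(∫ x, x ^ (2 * 2) ∂ρ) ^ 2 := by gcongr
      _ = _ := Real.sq_sqrt (integral_nonneg fun x => Even.pow_nonneg (by decide) x)
  set v := ∫ x, x ^ 2 ∂ρ with hv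
  have hv0 : 0 ≤ v := integral_nonneg fun x => sq_nonneg _
  have hexp : charFun ρ t - ((1 - t ^ 2 / 2 * v : ℝ) : ℂ) =
      ∫ x, (Complex.exp ((t * x : ℝ) * Complex.I) -
        (1 + (t * x : ℝ) * Complex.I - ((t * x : ℝ) : ℂ) ^ 2 / 2)) ∂ρ := by
    have i1 : Integrable (fun x : ℝ => Complex.exp ((t * x : ℝ) * Complex.I)) ρ := by
      refine Integrable.of_bound (C := 1) (by fun_prop) (Eventually.of_forall fun x => ?_)
      rw [Complex.norm_exp_ofReal_mul_I]
    have i2 : Integrable (fun x : ℝ => ((t * x : ℝ) : ℂ) * Complex.I) ρ :=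
      (hx.const_mul t).ofReal.mul_const _
    have i3 : Integrable (fun x : ℝ => ((t * x : ℝ) : ℂ) ^ 2 / 2) ρ := by
      have := ((hx2.const_mul (t ^ 2 / 2)).ofReal (𝕜 := ℂ))
      refine this.congr (Eventually.of_forall fun x => ?_)
      simp; ring
    have e2 : ∫ x, ((t * x : ℝ) : ℂ) * Complex.I ∂ρ = 0 := by
      rw [integral_mul_const, integral_complex_ofReal, integral_const_mul, h0]
      simp
    have e3 : ∫ x, ((t * x : ℝ) : ℂ) ^ 2 / 2 ∂ρ = ((t ^ 2 / 2 * v : ℝ) : ℂ) := by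
      rw [hv, ← integral_const_mul, ← integral_complex_ofReal]
      congr 1; ext x; push_cast; ring
    rw [integral_sub i1 (by exact ((integrable_const _).add i2).sub i3),
      integral_sub (by exact (integrable_const _).add i2) i3,
      integral_add (integrable_const _) i2, e2, e3, charFun_apply_real]
    simp
  have hA : ‖charFun ρ t - ((1 - t ^ 2 / 2 * v : ℝ) : ℂ)‖ ≤ 4 * |t| ^ 3 * ∫ x, |x| ^ 3 ∂ρ := by
    rw [hexp, ← integral_const_mul]
    refine norm_integral_le_of_norm_le (hx3.const_mul _) (Eventually.of_forall fun x => ?_)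
    refine (norm_exp_I_sub_taylor_le (t * x)).trans (le_of_eq ?_)
    rw [abs_mul, mul_pow, mul_assoc]
  have hB : ‖((1 - t ^ 2 / 2 * v : ℝ) : ℂ) - Real.exp (-(t ^ 2 / 2 * v))‖ ≤
      (t ^ 2 / 2 * v) ^ 2 := by
    rw [← Complex.ofReal_sub, Complex.norm_real]
    exact abs_exp_neg_sub_le (by positivity)
  calc _ ≤ ‖charFun ρ t - ((1 - t ^ 2 / 2 * v : ℝ) : ℂ)‖ +
        ‖((1 - t ^ 2 / 2 * v : ℝ) : ℂ) - Real.exp (-(t ^ 2 / 2 * v))‖ :=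
        norm_sub_le_norm_sub_add_norm_sub _ _ _
    _ ≤ _ := by
        refine add_le_add (hA.trans ?_) (hB.trans ?_)
        · gcongr
        · rw [mul_pow]
          gcongr

/-- Lyapunov's central limit theorem for i.i.d. rows, in terms of characteristic functions. -/
theorem tendsto_charFun_pow {ρ : ℕ → Measure ℝ} [∀ n, IsProbabilityMeasure (ρ n)] {p : ℕ → ℕ}
    {V : ℝ} (h4 : ∀ n, MemLp id 4 (ρ n)) (h0 : ∀ n, ∫ x, x ∂(ρ n) = 0)
    (hV : Tendsto (fun n => p n * ∫ x, x ^ 2 ∂(ρ n)) atTop (𝓝 V))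
    (hL : Tendsto (fun n => p n * ∫ x, x ^ 4 ∂(ρ n)) atTop (𝓝 0)) (t : ℝ) :
    Tendsto (fun n => charFun (ρ n) t ^ p n) atTop (𝓝 (Complex.exp (-(V * t ^ 2 / 2 : ℝ)))) := by
  have h1 : Tendsto (fun n => (Real.exp (-(t ^ 2 / 2 * ∫ x, x ^ 2 ∂(ρ n))) : ℂ) ^ p n) atTop
      (𝓝 (Complex.exp (-(V * t ^ 2 / 2 : ℝ)))) := by
    have : ∀ n, (Real.exp (-(t ^ 2 / 2 * ∫ x, x ^ 2 ∂(ρ n))) : ℂ) ^ p n =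
        ((Real.exp (-(t ^ 2 / 2 * (p n * ∫ x, x ^ 2 ∂(ρ n)))) : ℝ) : ℂ) := by
      intro n
      rw [← Complex.ofReal_pow, ← Real.exp_nat_mul]
      congr 2
      ring
    simp_rw [this]
    rw [← Complex.ofReal_neg, ← Complex.ofReal_exp]
    refine (Complex.continuous_ofReal.tendsto _).comp ((Real.continuous_exp.tendsto _).comp ?_)
    have := (hV.const_mul (t ^ 2 / 2)).neg
    convert! this using 2
    ring
  have h2 : Tendsto (fun n => charFun (ρ n) t ^ p n -
      (Real.exp (-(t ^ 2 / 2 * ∫ x, x ^ 2 ∂(ρ n))) : ℂ) ^ p n) atTop (𝓝 0) := by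
    -- The factor `p` is split as `√p √p` between the two moments, so that the product tends to `√V
    -- · 0`.
    refine squeeze_zero_norm (a := fun n => 4 * |t| ^ 3 * (√(p n * ∫ x, x ^ 2 ∂(ρ n)) *
      √(p n * ∫ x, x ^ 4 ∂(ρ n))) + (t ^ 2 / 2) ^ 2 * (p n * ∫ x, x ^ 4 ∂(ρ n))) (fun n => ?_) ?_
    · refine (norm_pow_sub_pow_le_mul (norm_charFun_le_one t) ?_ _).trans ?_
      · rw [Complex.norm_real, Real.norm_eq_abs, Real.abs_exp, Real.exp_le_one_iff]
        have : 0 ≤ ∫ x, x ^ 2 ∂(ρ n) := integral_nonneg fun x => sq_nonneg _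
        have := mul_nonneg (by positivity : 0 ≤ t ^ 2 / 2) this
        linarith
      · refine (mul_le_mul_of_nonneg_left (norm_charFun_sub_le (h4 n) (h0 n) t)
          (Nat.cast_nonneg _)).trans (le_of_eq ?_)
        rw [Real.sqrt_mul (Nat.cast_nonneg _), Real.sqrt_mul (Nat.cast_nonneg _)]
        have := Real.mul_self_sqrt (Nat.cast_nonneg (α := ℝ) (p n))
        linear_combination (-4 * |t| ^ 3 * (√(∫ x, x ^ 2 ∂(ρ n)) * √(∫ x, x ^ 4 ∂(ρ n)))) * this
    · have e1 := ((Real.continuous_sqrt.tendsto _).comp hV).mul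
        ((Real.continuous_sqrt.tendsto _).comp hL)
      have := (e1.const_mul (4 * |t| ^ 3)).add (hL.const_mul ((t ^ 2 / 2) ^ 2))
      simpa using this
  simpa using h2.add h1

end Lyapunov

/-! ### Replacing kernel coefficients by block coefficients. -/

section Coefficients

theorem sum_range_mul_eq {M : Type*} [AddCommMonoid M] (a b : ℕ) (f : ℕ → M) :
    ∑ t ∈ Finset.range (a * b), f t =
      ∑ k ∈ Finset.range a, ∑ i ∈ Finset.range b, f (k * b + i) := by
  induction a with
  | zero => simp
  | succ a ih => rw [add_mul, one_mul, Finset.sum_range_add, ih, Finset.sum_range_succ]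

theorem sum_range_mod_le (T : ℕ) {m : ℕ} (hm : 0 < m) {f : ℕ → ℝ} (hf : ∀ i, 0 ≤ f i) :
    ∑ t ∈ Finset.range T, f (t % m) ≤ ((T : ℝ) / m + 1) * ∑ i ∈ Finset.range m, f i := by
  have h1 : T ≤ (T / m + 1) * m := by
    have := Nat.div_add_mod T m
    have := Nat.mod_lt T hm
    nlinarith
  calc ∑ t ∈ Finset.range T, f (t % m)
      ≤ ∑ t ∈ Finset.range ((T / m + 1) * m), f (t % m) :=
        Finset.sum_le_sum_of_subset_of_nonneg (Finset.range_mono h1) fun _ _ _ => hf _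
    _ = ((T / m + 1 : ℕ) : ℝ) * ∑ i ∈ Finset.range m, f i := by
        rw [sum_range_mul_eq, Finset.sum_congr rfl (g := fun _ => ∑ i ∈ Finset.range m, f i),
          Finset.sum_const, Finset.card_range, nsmul_eq_mul]
        intro k _
        refine Finset.sum_congr rfl fun i hi => ?_
        rw [mul_comm, Nat.mul_add_mod, Nat.mod_eq_of_lt (Finset.mem_range.1 hi)]
    _ ≤ _ := by
        refine mul_le_mul_of_nonneg_right ?_ (Finset.sum_nonneg fun _ _ => hf _)
        push_cast
        gcongr
        exact Nat.cast_div_le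

theorem sum_range_near_le (T t R : ℕ) {f : ℕ → ℝ} {c : ℝ} (hc : 0 ≤ c) (hle : ∀ s, f s ≤ c)
    (h0 : ∀ s, ¬(s ≤ t + R ∧ t ≤ s + R) → f s ≤ 0) :
    ∑ s ∈ Finset.range T, f s ≤ (2 * R + 1) * c := by
  calc ∑ s ∈ Finset.range T, f s
      ≤ ∑ s ∈ Finset.range T, if s ∈ Finset.Icc (t - R) (t + R) then c else 0 := by
        refine Finset.sum_le_sum fun s _ => ?_
        split_ifs with hs
        · exact hle s
        · refine h0 s fun h => hs (Finset.mem_Icc.2 ?_)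
          omega
    _ = ((Finset.range T).filter (· ∈ Finset.Icc (t - R) (t + R))).card * c := by
        rw [← Finset.sum_filter, Finset.sum_const, nsmul_eq_mul]
    _ ≤ _ := by
        refine mul_le_mul_of_nonneg_right ?_ hc
        have h1 : ((Finset.range T).filter (· ∈ Finset.Icc (t - R) (t + R))).card ≤
            (Finset.Icc (t - R) (t + R)).card :=
          Finset.card_le_card fun s hs => (Finset.mem_filter.1 hs).2
        rw [Nat.card_Icc] at h1
        have h2 : ((Finset.range T).filter (· ∈ Finset.Icc (t - R) (t + R))).card ≤
          2 * R + 1 := by omega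
        exact_mod_cast h2

/-- The coefficients of the quadratic form after passing to blocks of length `ℓ` and cutting the
sequence of blocks into `p` groups of `q` consecutive blocks. -/
def blockCoef (K : ℝ → ℝ) (B : ℝ) (ℓ q p k l : ℕ) : ℝ :=
  if k ≠ l ∧ k / q = l / q ∧ k < p * q then K (((k : ℝ) - l) * ℓ / B) else 0

variable {K : ℝ → ℝ}

theorem IsKernel.exists_bound (hK : IsKernel K) : ∃ M, 0 < M ∧ ∀ u, |K u| ≤ M := by
  obtain ⟨M, hM⟩ := (isCompact_Icc (a := (-1 : ℝ)) (b := 1)).exists_bound_of_continuousOn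
    hK.continuous.continuousOn
  have hM1 := hM 0 (by simp)
  rw [hK.zero, norm_one] at hM1
  refine ⟨M, by linarith, fun u => ?_⟩
  by_cases hu : 1 < |u|
  · rw [hK.support u hu, abs_zero]; linarith
  · exact hM u (abs_le.1 (not_lt.1 hu))

theorem IsKernel.hasCompactSupport (hK : IsKernel K) : HasCompactSupport K := by
  refine HasCompactSupport.intro (isCompact_Icc (a := (-1 : ℝ)) (b := 1)) fun u hu => ?_
  refine hK.support u (not_le.1 fun h => hu (abs_le.1 h))

theorem IsKernel.eq_zero_of_lt (hK : IsKernel K) {B x : ℝ} (hB : 0 < B) (hx : B < |x|) :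
    K (x / B) = 0 := by
  refine hK.support _ ?_
  rwa [abs_div, abs_of_pos hB, one_lt_div hB]

/-- Three errors occur: moving both times to the starts of their blocks (at most `ω`), deleting
pairs within one block, and deleting pairs split between groups or lying after the last group.
Beyond distance `B + ℓ` both coefficients vanish. -/
theorem IsKernel.abs_coef_sub_blockCoef_le (hK : IsKernel K) {M : ℝ} (hM : ∀ u, |K u| ≤ M)
    {B ω : ℝ} (hB : 0 < B) {ℓ q p : ℕ} (hℓ : 0 < ℓ)
    (hω : ∀ u v, |u - v| ≤ ℓ / B → |K u - K v| ≤ ω) (t s : ℕ) :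
    |K (((t : ℝ) - s) / B) - blockCoef K B ℓ q p (t / ℓ) (s / ℓ)| ≤
      if s ≤ t + (⌊B⌋₊ + ℓ) ∧ t ≤ s + (⌊B⌋₊ + ℓ) then
        ω + (if t / ℓ = s / ℓ then M else 0) +
          (if t / ℓ / q = s / ℓ / q ∧ t / ℓ < p * q then 0 else M) else 0 := by
  have hω0 : 0 ≤ ω := (abs_nonneg _).trans (hω 0 0 (by simp; positivity))
  have hM0 : 0 ≤ M := (abs_nonneg _).trans (hM 0)
  have ht := Nat.div_add_mod t ℓ
  have hs := Nat.div_add_mod s ℓ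
  have ht' := Nat.mod_lt t hℓ
  have hs' := Nat.mod_lt s hℓ
  have hdiff : |((t : ℝ) - s) - (((t / ℓ : ℕ) : ℝ) - (s / ℓ : ℕ)) * ℓ| ≤ ℓ := by
    have e : ((t : ℝ) - s) - (((t / ℓ : ℕ) : ℝ) - (s / ℓ : ℕ)) * ℓ =
        ((t % ℓ : ℕ) : ℝ) - (s % ℓ : ℕ) := by
      have h1 : ((t : ℕ) : ℝ) = (ℓ * (t / ℓ) + t % ℓ : ℕ) := by rw [ht]
      have h2 : ((s : ℕ) : ℝ) = (ℓ * (s / ℓ) + s % ℓ : ℕ) := by rw [hs]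
      rw [h1, h2]; push_cast; ring
    rw [e, abs_le]
    have : ((t % ℓ : ℕ) : ℝ) < ℓ := by exact_mod_cast ht'
    have : ((s % ℓ : ℕ) : ℝ) < ℓ := by exact_mod_cast hs'
    have : (0 : ℝ) ≤ ((t % ℓ : ℕ) : ℝ) := by positivity
    have : (0 : ℝ) ≤ ((s % ℓ : ℕ) : ℝ) := by positivity
    constructor <;> linarith
  split_ifs with hnear hsame hgrp hgrp
  · rw [blockCoef, if_neg (fun h => h.1 hsame), sub_zero]
    have := hM (((t : ℝ) - s) / B)
    linarith
  · rw [blockCoef, if_neg (fun h => h.1 hsame), sub_zero]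
    have := hM (((t : ℝ) - s) / B)
    linarith
  · rw [blockCoef, if_pos ⟨hsame, hgrp⟩, add_zero, add_zero]
    refine hω _ _ ?_
    rw [← sub_div, abs_div, abs_of_pos hB]
    gcongr
  · rw [blockCoef, if_neg (fun h => hgrp h.2), sub_zero]
    have := hM (((t : ℝ) - s) / B)
    linarith
  · have hfl := Nat.lt_floor_add_one B
    have hfar : B + ℓ < |(t : ℝ) - s| := by
      by_cases h : s ≤ t + (⌊B⌋₊ + ℓ)
      · have h2 : s + (⌊B⌋₊ + ℓ) + 1 ≤ t := by omega
        have h3 : (s : ℝ) + (⌊B⌋₊ + ℓ) + 1 ≤ t := by exact_mod_cast h2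
        exact lt_of_lt_of_le (by linarith) (le_abs_self _)
      · have h2 : t + (⌊B⌋₊ + ℓ) + 1 ≤ s := by omega
        have h3 : (t : ℝ) + (⌊B⌋₊ + ℓ) + 1 ≤ s := by exact_mod_cast h2
        exact lt_of_lt_of_le (by linarith) (neg_le_abs _)
    have hℓ0 : (0 : ℝ) < ℓ := by exact_mod_cast hℓ
    have h1 : K (((t : ℝ) - s) / B) = 0 := hK.eq_zero_of_lt hB (by linarith)
    have h2 : blockCoef K B ℓ q p (t / ℓ) (s / ℓ) = 0 := by
      unfold blockCoef
      split_ifs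
      · refine hK.eq_zero_of_lt hB ?_
        have := abs_sub_abs_le_abs_sub ((t : ℝ) - s) ((((t / ℓ : ℕ) : ℝ) - (s / ℓ : ℕ)) * ℓ)
        linarith
      · rfl
    rw [h1, h2, sub_zero, abs_zero]

/-- Counting: a row has at most `2 R + 1` near entries and `ℓ` entries in its own block. A near pair
can be deleted by the grouping only if `t` is within `R` of an end of its group, or comes after the
last full group. -/
theorem IsKernel.sum_abs_coef_sub_blockCoef_le (hK : IsKernel K) {M : ℝ} (hM : ∀ u, |K u| ≤ M)
    {B ω : ℝ} (hB : 0 < B) {ℓ q p T : ℕ} (hℓ : 0 < ℓ) (hq : 0 < q)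
    (hω : ∀ u v, |u - v| ≤ ℓ / B → |K u - K v| ≤ ω) {R : ℕ} (hR : ⌊B⌋₊ + ℓ = R)
    (hp : T ≤ p * (q * ℓ) + q * ℓ) :
    ∑ t ∈ Finset.range T, ∑ s ∈ Finset.range T,
      |K (((t : ℝ) - s) / B) - blockCoef K B ℓ q p (t / ℓ) (s / ℓ)| ≤
      T * ((2 * R + 1) * ω) + T * (ℓ * M) +
        (((T : ℝ) / (q * ℓ : ℕ) + 1) * (2 * R) + (q * ℓ : ℕ)) * ((2 * R + 1) * M) := by
  have hω0 : 0 ≤ ω := (abs_nonneg _).trans (hω 0 0 (by simp; positivity))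
  have hM0 : 0 ≤ M := (abs_nonneg _).trans (hM 0)
  set L := q * ℓ with hL
  have hL0 : 0 < L := by positivity
  -- `bad` marks the at most `2 R` positions near either end of a group of length `L`, `late` the at
  -- most `L` times not covered by the `p` groups.
  let bad : ℕ → ℝ := fun i => if i < R ∨ L ≤ i + R then 1 else 0
  let late : ℕ → ℝ := fun t => if p * L ≤ t then 1 else 0
  have hbad0 : ∀ i, 0 ≤ bad i := fun i => by simp only [bad]; split_ifs <;> norm_num
  have hlate0 : ∀ i, 0 ≤ late i := fun i => by simp only [late]; split_ifs <;> norm_num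
  have hrow : ∀ t ∈ Finset.range T, ∑ s ∈ Finset.range T,
      |K (((t : ℝ) - s) / B) - blockCoef K B ℓ q p (t / ℓ) (s / ℓ)| ≤
      (2 * R + 1) * ω + ℓ * M + (bad (t % L) + late t) * ((2 * R + 1) * M) := by
    intro t _
    have hA := sum_range_near_le T t R (f := fun s =>
      if s ≤ t + R ∧ t ≤ s + R then ω else 0) hω0
      (fun s => by split_ifs <;> [exact le_rfl; exact hω0])
      (fun s hs => by rw [if_neg hs])
    have hBs : ∑ s ∈ Finset.range T, (if t / ℓ = s / ℓ then M else 0) ≤ ℓ * M := by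
      rw [← Finset.sum_filter, Finset.sum_const, nsmul_eq_mul]
      refine mul_le_mul_of_nonneg_right ?_ hM0
      have h1 : ((Finset.range T).filter fun s => t / ℓ = s / ℓ).card ≤
          (Finset.Ico (t / ℓ * ℓ) (t / ℓ * ℓ + ℓ)).card := by
        refine Finset.card_le_card fun s hs => ?_
        have hs2 := (Finset.mem_filter.1 hs).2
        have h3 := Nat.div_add_mod s ℓ
        have h4 := Nat.mod_lt s hℓ
        rw [Finset.mem_Ico, hs2, mul_comm]
        omega
      rw [Nat.card_Ico, Nat.add_sub_cancel_left] at h1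
      exact_mod_cast h1
    have hC := sum_range_near_le T t R (f := fun s =>
      if s ≤ t + R ∧ t ≤ s + R then
        (if t / ℓ / q = s / ℓ / q ∧ t / ℓ < p * q then 0 else M) else 0)
      (c := (bad (t % L) + late t) * M)
      (mul_nonneg (add_nonneg (hbad0 _) (hlate0 _)) hM0)
      (fun s => by
        have hnn : 0 ≤ (bad (t % L) + late t) * M :=
          mul_nonneg (add_nonneg (hbad0 _) (hlate0 _)) hM0
        split_ifs with hnear hgrp
        · exact hnn
        · have hge : 1 ≤ bad (t % L) + late t := by
            by_contra hlt
            have hb : ¬(t % L < R ∨ L ≤ t % L + R) := fun h => hlt (by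
              have : bad (t % L) = 1 := by simp only [bad]; rw [if_pos h]
              rw [this]; linarith [hlate0 t])
            have hl : ¬(p * L ≤ t) := fun h => hlt (by
              have : late t = 1 := by simp only [late]; rw [if_pos h]
              rw [this]; linarith [hbad0 (t % L)])
            apply hgrp
            have e := Nat.div_add_mod t L
            constructor
            · rw [Nat.div_div_eq_div_mul, Nat.div_div_eq_div_mul, mul_comm ℓ q, ← hL]
              symm
              rw [Nat.div_eq_iff hL0]
              have : t / L * L = L * (t / L) := mul_comm _ _
              omega
            · rw [Nat.div_lt_iff_lt_mul hℓ, mul_assoc, ← hL]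
              omega
          nlinarith
        · exact hnn)
      (fun s hs => by rw [if_neg hs])
    calc _ ≤ ∑ s ∈ Finset.range T, ((if s ≤ t + R ∧ t ≤ s + R then ω else 0) +
          (if t / ℓ = s / ℓ then M else 0) +
          (if s ≤ t + R ∧ t ≤ s + R then
            (if t / ℓ / q = s / ℓ / q ∧ t / ℓ < p * q then 0 else M) else 0)) := by
          refine Finset.sum_le_sum fun s _ => ?_
          refine (hK.abs_coef_sub_blockCoef_le hM hB hℓ hω t s).trans ?_
          rw [hR]
          split_ifs <;> linarith
      _ ≤ _ := by
          rw [Finset.sum_add_distrib, Finset.sum_add_distrib]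
          have : (2 * (R : ℝ) + 1) * ((bad (t % L) + late t) * M) =
            (bad (t % L) + late t) * ((2 * R + 1) * M) := by ring
          linarith
  refine (Finset.sum_le_sum hrow).trans ?_
  rw [Finset.sum_add_distrib, ← Finset.sum_mul, Finset.sum_add_distrib, Finset.sum_const,
    Finset.sum_const, Finset.sum_add_distrib, Finset.card_range, nsmul_eq_mul, nsmul_eq_mul]
  refine add_le_add le_rfl (mul_le_mul_of_nonneg_right (add_le_add ?_ ?_) (by positivity))
  · refine (sum_range_mod_le T hL0 hbad0).trans (mul_le_mul_of_nonneg_left ?_ (by positivity))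
    simp only [bad]
    rw [← Finset.sum_filter, Finset.sum_const, nsmul_one]
    have h1 : ((Finset.range L).filter fun i => i < R ∨ L ≤ i + R).card ≤
        (Finset.range R ∪ Finset.Ico (L - R) L).card := by
      refine Finset.card_le_card fun i hi => ?_
      have h2 := Finset.mem_filter.1 hi
      have h3 := Finset.mem_range.1 h2.1
      rw [Finset.mem_union, Finset.mem_range, Finset.mem_Ico]
      omega
    have h2 := h1.trans (Finset.card_union_le _ _)
    rw [Finset.card_range, Nat.card_Ico] at h2
    have h3 : ((Finset.range L).filter fun i => i < R ∨ L ≤ i + R).card ≤ 2 * R := by omega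
    exact_mod_cast h3
  · simp only [late]
    rw [← Finset.sum_filter, Finset.sum_const, nsmul_one]
    have h1 : ((Finset.range T).filter fun t => p * L ≤ t).card ≤
        (Finset.Ico (p * L) (p * L + L)).card := by
      refine Finset.card_le_card fun i hi => ?_
      have h2 := Finset.mem_filter.1 hi
      have h3 := Finset.mem_range.1 h2.1
      rw [Finset.mem_Ico]
      omega
    rw [Nat.card_Ico, Nat.add_sub_cancel_left] at h1
    exact_mod_cast h1

end Coefficients

/-! ### Riemann sums of the squared kernel. -/

section RiemannSum

variable {K : ℝ → ℝ}

/-- The support of a continuous function is open, hence contained in the interior of `[-1, 1]`: the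
kernel also vanishes at the endpoints. -/
theorem IsKernel.support_subset (hK : IsKernel K) : Function.support K ⊆ Set.Ioo (-1) 1 := by
  rw [← interior_Icc]
  refine interior_maximal (fun u hu => ?_) (hK.continuous.isOpen_support)
  by_contra h
  exact hu (hK.support u (not_le.1 fun h' => h (abs_le.1 h')))

theorem IsKernel.eq_zero_of_le (hK : IsKernel K) {B x : ℝ} (hB : 0 < B) (hx : B ≤ |x|) :
    K (x / B) = 0 := by
  by_contra h
  have := abs_lt.2 (hK.support_subset h)
  rw [abs_div, abs_of_pos hB, div_lt_one hB] at this
  linarith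

theorem IsKernel.uniformContinuous (hK : IsKernel K) : UniformContinuous K :=
  hK.hasCompactSupport.uniformContinuous_of_continuous hK.continuous

theorem IsKernel.eventually_modulus (hK : IsKernel K) {δ : ℕ → ℝ} (hδ : Tendsto δ atTop (𝓝 0))
    {ε : ℝ} (hε : 0 < ε) : ∀ᶠ n in atTop, ∀ u v, |u - v| ≤ δ n → |K u - K v| ≤ ε := by
  obtain ⟨η, hη, h⟩ := Metric.uniformContinuous_iff.1 hK.uniformContinuous ε hε
  filter_upwards [hδ.eventually (gt_mem_nhds hη)] with n hn u v huv
  exact (h (lt_of_le_of_lt huv hn)).le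

theorem IsKernel.abs_sum_sq_sub_le (hK : IsKernel K) {M : ℝ} (hM : ∀ u, |K u| ≤ M)
    {B ω : ℝ} (hB : 0 < B) (hω : ∀ u v, |u - v| ≤ 1 / B → |K u - K v| ≤ ω) {m : ℕ}
    (hm : B ≤ m) :
    |∑ i ∈ Finset.range (2 * m), K (((i : ℝ) - m) / B) ^ 2 - B * ∫ u in (-1 : ℝ)..1, K u ^ 2| ≤
      2 * m * (2 * M * ω) := by
  have hcont : Continuous fun x : ℝ => K (x / B) ^ 2 := by
    have := hK.continuous
    fun_prop
  have hsupp : Function.support (fun u => K u ^ 2) ⊆ Set.Ioo (-1) 1 := fun u hu =>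
    hK.support_subset fun h => hu (by simp [h])
  have hmB : 1 ≤ (m : ℝ) / B := (one_le_div hB).2 hm
  have h1 : B * ∫ u in (-1 : ℝ)..1, K u ^ 2 =
      ∑ i ∈ Finset.range (2 * m), ∫ x in ((i : ℝ) - m)..((i + 1 : ℕ) - m : ℝ), K (x / B) ^ 2 := by
    rw [intervalIntegral.sum_integral_adjacent_intervals (a := fun i : ℕ => (i : ℝ) - m)
      fun k _ => hcont.intervalIntegrable _ _,
      intervalIntegral.integral_comp_div (fun u => K u ^ 2) hB.ne', smul_eq_mul,
      intervalIntegral.integral_eq_integral_of_support_subset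
        (hsupp.trans Set.Ioo_subset_Ioc_self),
      intervalIntegral.integral_eq_integral_of_support_subset]
    refine hsupp.trans (Set.Ioo_subset_Ioc_self.trans (Set.Ioc_subset_Ioc ?_ ?_))
    · push_cast
      rw [zero_sub, neg_div]
      linarith
    · push_cast
      rwa [two_mul, add_sub_cancel_right]
  rw [h1, ← Finset.sum_sub_distrib]
  refine (Finset.abs_sum_le_sum_abs _ _).trans ((Finset.sum_le_card_nsmul _ _ (2 * M * ω)
    fun i _ => ?_).trans (le_of_eq (by simp)))
  have h2 : K (((i : ℝ) - m) / B) ^ 2 - ∫ x in ((i : ℝ) - m)..((i + 1 : ℕ) - m : ℝ), K (x / B) ^ 2 =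
      ∫ x in ((i : ℝ) - m)..((i + 1 : ℕ) - m : ℝ), (K (((i : ℝ) - m) / B) ^ 2 - K (x / B) ^ 2) := by
    rw [intervalIntegral.integral_sub intervalIntegrable_const (hcont.intervalIntegrable _ _),
      intervalIntegral.integral_const]
    push_cast
    simp
  rw [h2, ← Real.norm_eq_abs]
  refine (intervalIntegral.norm_integral_le_of_norm_le_const (C := 2 * M * ω)
    fun x hx => ?_).trans (le_of_eq ?_)
  · push_cast at hx
    rw [Set.uIoc_of_le (by linarith)] at hx
    have hω' := hω (((i : ℝ) - m) / B) (x / B) (by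
      rw [← sub_div, abs_div, abs_of_pos hB]
      gcongr
      rw [abs_le]
      constructor <;> linarith [hx.1, hx.2])
    rw [Real.norm_eq_abs, sq_sub_sq, abs_mul]
    have h3 := abs_add_le (K (((i : ℝ) - m) / B)) (K (x / B))
    have h4 := hM (((i : ℝ) - m) / B)
    have h5 := hM (x / B)
    exact mul_le_mul (by linarith) hω' (abs_nonneg _) (by linarith [abs_nonneg (K (x / B))])
  · push_cast
    rw [show ((i : ℝ) + 1 - m) - (i - m) = 1 by ring]
    simp

/-- Rows at distance at least `m ≥ B` from both ends contain the complete Riemann sum. The at most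
`2 m` other rows are bounded crudely: `2 m + 1` entries for the sum and `2 m` for the Riemann sum to
which the integral is compared. -/
theorem IsKernel.abs_sum_sum_sq_sub_le (hK : IsKernel K) {M : ℝ} (hM : ∀ u, |K u| ≤ M)
    {B ω : ℝ} (hB : 0 < B) (hω : ∀ u v, |u - v| ≤ 1 / B → |K u - K v| ≤ ω) {m T : ℕ}
    (hm : B ≤ m) :
    |∑ t ∈ Finset.range T, ∑ s ∈ Finset.range T, K (((t : ℝ) - s) / B) ^ 2 -
      T * (B * ∫ u in (-1 : ℝ)..1, K u ^ 2)| ≤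
      T * (2 * m * (2 * M * ω)) + 2 * m * ((4 * m + 1) * M ^ 2) := by
  set I := B * ∫ u in (-1 : ℝ)..1, K u ^ 2 with hI
  have key := hK.abs_sum_sq_sub_le hM hB hω hm
  rw [← hI] at key
  have hM2 : ∀ u, K u ^ 2 ≤ M ^ 2 := fun u => by rw [← sq_abs]; gcongr; exact hM u
  have hω0 : 0 ≤ ω := (abs_nonneg _).trans (hω 0 0 (by simp; positivity))
  have hM0 : 0 ≤ M := (abs_nonneg _).trans (hM 0)
  set D := 2 * m * (2 * M * ω) with hD
  have hD0 : 0 ≤ D := by positivity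
  have hS : ∑ i ∈ Finset.range (2 * m), K (((i : ℝ) - m) / B) ^ 2 ≤ 2 * m * M ^ 2 :=
    (Finset.sum_le_card_nsmul _ _ (M ^ 2) fun i _ => hM2 _).trans (le_of_eq (by simp))
  have hI0 : 0 ≤ I := mul_nonneg hB.le
    (intervalIntegral.integral_nonneg (by norm_num) fun u _ => sq_nonneg _)
  have hrow : ∀ t ∈ Finset.range T,
      |∑ s ∈ Finset.range T, K (((t : ℝ) - s) / B) ^ 2 - I| ≤
        D + if t ∈ Finset.Ico m (T - m) then 0 else (4 * m + 1) * M ^ 2 := by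
    intro t ht
    split_ifs with hgood
    · rw [Finset.mem_Ico] at hgood
      rw [add_zero]
      have : ∑ s ∈ Finset.range T, K (((t : ℝ) - s) / B) ^ 2 =
          ∑ i ∈ Finset.range (2 * m), K (((i : ℝ) - m) / B) ^ 2 := by
        rw [← Finset.sum_subset (s₁ := Finset.Ico (t - m) (t - m + 2 * m)),
          Finset.sum_Ico_eq_sum_range, Nat.add_sub_cancel_left]
        · refine Finset.sum_congr rfl fun i _ => ?_
          rw [← hK.symm, ← neg_div]
          congr 3
          push_cast [Nat.cast_sub hgood.1]
          ring
        · intro s hs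
          rw [Finset.mem_Ico] at hs
          rw [Finset.mem_range]
          omega
        · intro s _ hs
          rw [Finset.mem_Ico] at hs
          rw [hK.eq_zero_of_le hB, zero_pow two_ne_zero]
          refine hm.trans ?_
          by_cases h : s < t - m
          · have : s + m ≤ t := by omega
            have : (s : ℝ) + m ≤ t := by exact_mod_cast this
            exact le_trans (by linarith) (le_abs_self _)
          · have : t + m ≤ s := by omega
            have : (t : ℝ) + m ≤ s := by exact_mod_cast this
            exact le_trans (by linarith) (neg_le_abs _)
      rw [this]
      exact key
    · have hr := sum_range_near_le T t m (f := fun s => K (((t : ℝ) - s) / B) ^ 2)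
        (sq_nonneg M) (fun s => hM2 _) (fun s hs => by
          rw [hK.eq_zero_of_le hB, zero_pow two_ne_zero]
          refine hm.trans ?_
          by_cases h : s ≤ t + m
          · have : s + m ≤ t := by omega
            have : (s : ℝ) + m ≤ t := by exact_mod_cast this
            exact le_trans (by linarith) (le_abs_self _)
          · have : t + m ≤ s := by omega
            have : (t : ℝ) + m ≤ s := by exact_mod_cast this
            exact le_trans (by linarith) (neg_le_abs _))
      have hr0 : 0 ≤ ∑ s ∈ Finset.range T, K (((t : ℝ) - s) / B) ^ 2 :=
        Finset.sum_nonneg fun _ _ => sq_nonneg _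
      have h6 := abs_le.1 key
      have h7 : 0 ≤ (m : ℝ) * M ^ 2 := by positivity
      have h8 : 0 ≤ M ^ 2 := by positivity
      rw [abs_le]
      constructor <;> nlinarith
  rw [show (T : ℝ) * I = ∑ t ∈ Finset.range T, I by simp, ← Finset.sum_sub_distrib]
  refine (Finset.abs_sum_le_sum_abs _ _).trans ((Finset.sum_le_sum hrow).trans ?_)
  rw [Finset.sum_add_distrib, Finset.sum_const, Finset.card_range, nsmul_eq_mul]
  refine add_le_add le_rfl ?_
  simp_rw [← ite_not (p := _ ∈ Finset.Ico m (T - m))]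
  rw [← Finset.sum_filter, Finset.sum_const, nsmul_eq_mul]
  refine mul_le_mul_of_nonneg_right ?_ (by positivity)
  have h1 : ((Finset.range T).filter fun t => t ∉ Finset.Ico m (T - m)).card ≤
      (Finset.range m ∪ Finset.Ico (T - m) T).card := by
    refine Finset.card_le_card fun i hi => ?_
    have h2 := Finset.mem_filter.1 hi
    have h3 := Finset.mem_range.1 h2.1
    have h4 := h2.2
    rw [Finset.mem_Ico] at h4
    rw [Finset.mem_union, Finset.mem_range, Finset.mem_Ico]
    omega
  have h2 := h1.trans (Finset.card_union_le _ _)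
  rw [Finset.card_range, Nat.card_Ico] at h2
  have h3 : ((Finset.range T).filter fun t => t ∉ Finset.Ico m (T - m)).card ≤ 2 * m := by omega
  exact_mod_cast h3

theorem IsKernel.tendsto_sum_sum_sq (hK : IsKernel K) {B : ℕ → ℝ} {T : ℕ → ℕ}
    (hB : Tendsto B atTop atTop) (hT : Tendsto T atTop atTop)
    (hBT : Tendsto (fun n => B n / T n) atTop (𝓝 0)) :
    Tendsto (fun n => (∑ t ∈ Finset.range (T n), ∑ s ∈ Finset.range (T n),
      K (((t : ℝ) - s) / B n) ^ 2) / (T n * B n)) atTop (𝓝 (∫ u in (-1 : ℝ)..1, K u ^ 2)) := by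
  obtain ⟨M, hM0, hM⟩ := hK.exists_bound
  have hm : Tendsto (fun n => ((⌊B n⌋₊ + 1 : ℕ) : ℝ) / B n) atTop (𝓝 1) := by
    have h1 := (tendsto_nat_floor_div_atTop (R := ℝ)).comp hB
    have h2 := hB.const_div_atTop 1
    have := h1.add h2
    rw [add_zero] at this
    refine this.congr fun n => ?_
    simp only [Function.comp_apply]
    push_cast
    rw [add_div]
  rw [Metric.tendsto_atTop']
  intro ε hε
  -- The limit of the error bound is `4 M ω = ε / 4`.
  set ω := ε / (16 * M) with hω
  have hω0 : 0 < ω := by positivity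
  have hlim : Tendsto (fun n => 2 * (((⌊B n⌋₊ + 1 : ℕ) : ℝ) / B n) * (2 * M * ω) +
      2 * (((⌊B n⌋₊ + 1 : ℕ) : ℝ) / B n) *
        ((4 * (((⌊B n⌋₊ + 1 : ℕ) : ℝ) / B n) * (B n / T n) + 1 / T n) * M ^ 2)) atTop
      (𝓝 (2 * 1 * (2 * M * ω) + 2 * 1 * ((4 * 1 * 0 + 0) * M ^ 2))) := by
    have hT1 : Tendsto (fun n => (1 : ℝ) / T n) atTop (𝓝 0) :=
      (tendsto_natCast_atTop_atTop.comp hT).const_div_atTop 1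
    exact ((hm.const_mul 2).mul_const _).add ((hm.const_mul 2).mul
      ((((hm.const_mul 4).mul hBT).add hT1).mul_const _))
  have hval : 2 * 1 * (2 * M * ω) + 2 * 1 * ((4 * 1 * 0 + 0) * M ^ 2) < ε := by
    rw [hω]; field_simp; norm_num; linarith
  have hev := (hlim.eventually (gt_mem_nhds hval)).and
    ((hK.eventually_modulus (hB.const_div_atTop 1) hω0).and
      ((hB.eventually_gt_atTop 0).and (hT.eventually_gt_atTop 0)))
  obtain ⟨n₀, hn₀⟩ := eventually_atTop.1 hev
  refine ⟨n₀, fun n hn => ?_⟩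
  obtain ⟨h1, h2, h3, h4⟩ := hn₀ n hn.le
  have h4' : (0 : ℝ) < T n := by exact_mod_cast h4
  have key := hK.abs_sum_sum_sq_sub_le hM h3 h2 (m := ⌊B n⌋₊ + 1) (T := T n)
    (by push_cast; exact (Nat.lt_floor_add_one _).le)
  rw [Real.dist_eq]
  refine lt_of_le_of_lt ?_ h1
  rw [show (∑ t ∈ Finset.range (T n), ∑ s ∈ Finset.range (T n),
      K (((t : ℝ) - s) / B n) ^ 2) / (T n * B n) - ∫ u in (-1 : ℝ)..1, K u ^ 2 =
      (∑ t ∈ Finset.range (T n), ∑ s ∈ Finset.range (T n),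
      K (((t : ℝ) - s) / B n) ^ 2 - T n * (B n * ∫ u in (-1 : ℝ)..1, K u ^ 2)) / (T n * B n) by
    field_simp, abs_div, abs_of_pos (mul_pos h4' h3), div_le_iff₀ (mul_pos h4' h3)]
  refine key.trans (le_of_eq ?_)
  field_simp

end RiemannSum

/-! ### Choice of scales and limits of coefficient sums. -/

section BlockScales

/-- The scales of the blocking argument: blocks of length `ℓ ≪ B`, grouped into `p` groups of
`q` consecutive blocks, with `B ≪ q ℓ ≪ T`. -/
structure BlockScales (B : ℕ → ℝ) (T ℓ q p : ℕ → ℕ) : Prop where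
  tendsto_B : Tendsto B atTop atTop
  tendsto_T : Tendsto T atTop atTop
  tendsto_B_div_T : Tendsto (fun n => B n / T n) atTop (𝓝 0)
  tendsto_ℓ : Tendsto ℓ atTop atTop
  tendsto_ℓ_div_B : Tendsto (fun n => ℓ n / B n) atTop (𝓝 0)
  q_pos : ∀ᶠ n in atTop, 0 < q n
  tendsto_B_div_L : Tendsto (fun n => B n / (q n * ℓ n : ℕ)) atTop (𝓝 0)
  tendsto_L_div_T : Tendsto (fun n => ((q n * ℓ n : ℕ) : ℝ) / T n) atTop (𝓝 0)
  tendsto_p : Tendsto p atTop atTop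
  mul_le : ∀ n, p n * (q n * ℓ n) ≤ T n
  le_mul : ∀ᶠ n in atTop, T n ≤ p n * (q n * ℓ n) + q n * ℓ n

/-- Geometric means separate the scales: `ℓ` is about `√B`, the group length `q ℓ` is about `√(T
B)`, and `p` is the number of full groups in `T`. -/
theorem exists_blockScales {B : ℕ → ℝ} {T : ℕ → ℕ} (hB : Tendsto B atTop atTop)
    (hT : Tendsto T atTop atTop) (hBT : Tendsto (fun n => B n / T n) atTop (𝓝 0)) :
    ∃ ℓ q p, BlockScales B T ℓ q p := by
  have hsB : Tendsto (fun n => √(B n)) atTop atTop := Real.tendsto_sqrt_atTop.comp hB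
  have hTr : Tendsto (fun n => (T n : ℝ)) atTop atTop := tendsto_natCast_atTop_atTop.comp hT
  have hsBT : Tendsto (fun n => √(B n / T n)) atTop (𝓝 0) := by
    have := (Real.continuous_sqrt.tendsto 0).comp hBT
    rwa [Real.sqrt_zero] at this
  have hBpos := hB.eventually_gt_atTop 0
  have hTpos := hTr.eventually_gt_atTop 0
  let ℓ : ℕ → ℕ := fun n => ⌊√(B n)⌋₊
  let q : ℕ → ℕ := fun n => ⌊√(T n * B n) / ℓ n⌋₊
  let p : ℕ → ℕ := fun n => T n / (q n * ℓ n)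
  have hℓ : Tendsto ℓ atTop atTop := tendsto_nat_floor_atTop.comp hsB
  have hℓpos := hℓ.eventually_gt_atTop 0
  have hℓB : Tendsto (fun n => ℓ n / B n) atTop (𝓝 0) := by
    refine squeeze_zero' (g := fun n => 1 / √(B n)) ?_ ?_ (hsB.const_div_atTop 1)
    · filter_upwards [hBpos] with n hn
      positivity
    · filter_upwards [hBpos] with n hn
      have h1 : (ℓ n : ℝ) ≤ √(B n) := Nat.floor_le (Real.sqrt_nonneg _)
      have h2 : 0 < √(B n) := Real.sqrt_pos.2 hn
      rw [div_le_div_iff₀ hn h2, one_mul]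
      calc _ ≤ √(B n) * √(B n) := by gcongr
        _ = B n := Real.mul_self_sqrt hn.le
  -- `q ℓ` is within `ℓ` of `√(T B)`
  have hLle : ∀ᶠ n in atTop, ((q n * ℓ n : ℕ) : ℝ) ≤ √(T n * B n) := by
    filter_upwards [hℓpos] with n hn
    have hn' : (0 : ℝ) < ℓ n := by exact_mod_cast hn
    have := Nat.floor_le (a := √(T n * B n) / ℓ n) (by positivity)
    push_cast
    rwa [le_div_iff₀ hn'] at this
  have hLge : ∀ᶠ n in atTop, √(T n * B n) / 2 ≤ ((q n * ℓ n : ℕ) : ℝ) := by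
    filter_upwards [hℓpos, hBpos, hTr.eventually_ge_atTop 4] with n hn hb ht
    have hn' : (0 : ℝ) < ℓ n := by exact_mod_cast hn
    have := Nat.lt_floor_add_one (√(T n * B n) / ℓ n)
    rw [div_lt_iff₀ hn'] at this
    have h1 : (ℓ n : ℝ) ≤ √(B n) := Nat.floor_le (Real.sqrt_nonneg _)
    have h2 : 2 ≤ √(T n : ℝ) := Real.le_sqrt_of_sq_le (by linarith)
    have h3 : √(T n * B n) = √(T n : ℝ) * √(B n) := Real.sqrt_mul (by positivity) _
    have h4 := mul_le_mul_of_nonneg_right h2 (Real.sqrt_nonneg (B n))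
    push_cast
    simp only [q] at *
    linarith
  have hsq : ∀ᶠ n in atTop, √(T n * B n) / T n = √(B n / T n) ∧
      B n / √(T n * B n) = √(B n / T n) := by
    filter_upwards [hBpos, hTpos] with n hb ht
    have h3 : √(T n * B n) = √(T n : ℝ) * √(B n) := Real.sqrt_mul (by positivity) _
    have h4 : √(B n / T n) = √(B n) / √(T n : ℝ) := Real.sqrt_div hb.le _
    have h5 : 0 < √(T n : ℝ) := Real.sqrt_pos.2 ht
    have h6 : 0 < √(B n) := Real.sqrt_pos.2 hb
    rw [h3, h4]
    constructor
    · nth_rewrite 2 [← Real.mul_self_sqrt ht.le]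
      field_simp
    · nth_rewrite 1 [← Real.mul_self_sqrt hb.le]
      field_simp
  have hLT : Tendsto (fun n => ((q n * ℓ n : ℕ) : ℝ) / T n) atTop (𝓝 0) := by
    refine squeeze_zero' (g := fun n => √(B n / T n)) (Eventually.of_forall fun n => by positivity)
      ?_ hsBT
    filter_upwards [hLle, hsq] with n h1 h2
    rw [← h2.1]
    gcongr
  have hLpos : ∀ᶠ n in atTop, 0 < q n * ℓ n := by
    filter_upwards [hLge, hBpos, hTpos] with n h1 h2 h3
    have : 0 < √(T n * B n) / 2 := by positivity
    exact_mod_cast this.trans_le h1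
  refine ⟨ℓ, q, p, hB, hT, hBT, hℓ, hℓB, ?_, ?_, hLT, ?_, fun n => Nat.div_mul_le_self _ _, ?_⟩
  · filter_upwards [hLpos] with n hn
    exact Nat.pos_of_mul_pos_right hn
  · have := hsBT.const_mul 2
    rw [mul_zero] at this
    refine squeeze_zero' ?_ ?_ this
    · filter_upwards [hBpos] with n hn
      positivity
    · filter_upwards [hLge, hsq, hBpos, hTpos] with n h1 h2 h3 h4
      have h5 : 0 < √(T n * B n) := by positivity
      rw [← h2.2]
      calc _ ≤ B n / (√(T n * B n) / 2) := by gcongr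
        _ = _ := by field_simp
  · rw [← tendsto_natCast_atTop_iff (R := ℝ)]
    have hinv : Tendsto (fun n => (((q n * ℓ n : ℕ) : ℝ) / T n)⁻¹ - 1) atTop atTop := by
      refine tendsto_atTop_add_const_right _ _ ((tendsto_inv_nhdsGT_zero.comp ?_))
      refine tendsto_nhdsWithin_iff.2 ⟨hLT, ?_⟩
      filter_upwards [hLpos, hTpos] with n h1 h2
      have : (0 : ℝ) < (q n * ℓ n : ℕ) := by exact_mod_cast h1
      exact div_pos this h2
    refine tendsto_atTop_mono' _ ?_ hinv
    filter_upwards with n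
    rw [inv_div, sub_le_iff_le_add]
    rcases Nat.eq_zero_or_pos (q n * ℓ n) with h0 | h0
    · rw [h0]; simp; positivity
    · have h0' : (0 : ℝ) < (q n * ℓ n : ℕ) := by exact_mod_cast h0
      rw [div_le_iff₀ h0']
      have h1 := Nat.div_add_mod (T n) (q n * ℓ n)
      have h2 := Nat.mod_lt (T n) h0
      have h3 : T n ≤ (p n + 1) * (q n * ℓ n) := by
        have : (p n + 1) * (q n * ℓ n) = (q n * ℓ n) * (T n / (q n * ℓ n)) + q n * ℓ n := by
          simp only [p]; ring
        omega
      exact_mod_cast h3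
  · filter_upwards [hLpos] with n h0
    have h1 := Nat.div_add_mod (T n) (q n * ℓ n)
    have h2 := Nat.mod_lt (T n) h0
    have : p n * (q n * ℓ n) = (q n * ℓ n) * (T n / (q n * ℓ n)) := by
      simp only [p]; ring
    omega

namespace BlockScales

variable {B : ℕ → ℝ} {T ℓ q p : ℕ → ℕ} (hS : BlockScales B T ℓ q p)
include hS

theorem tendsto_near_div : Tendsto (fun n => ((⌊B n⌋₊ + ℓ n : ℕ) : ℝ) / B n) atTop (𝓝 1) := by
  have h1 := (tendsto_nat_floor_div_atTop (R := ℝ)).comp hS.tendsto_B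
  have := h1.add hS.tendsto_ℓ_div_B
  rw [add_zero] at this
  refine this.congr fun n => ?_
  simp only [Function.comp_apply]
  push_cast
  rw [add_div]

variable {K : ℝ → ℝ} (hK : IsKernel K)
include hK

/-- Relative to `T B`, the counted errors are the modulus of continuity at scale `ℓ / B`, and
multiples of `ℓ / B`, `B / (q ℓ)`, `B / T` and `q ℓ / T`. -/
theorem tendsto_sum_abs_coef_sub :
    Tendsto (fun n => (∑ t ∈ Finset.range (T n), ∑ s ∈ Finset.range (T n),
      |K (((t : ℝ) - s) / B n) - blockCoef K (B n) (ℓ n) (q n) (p n) (t / ℓ n) (s / ℓ n)|) /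
        (T n * B n)) atTop (𝓝 0) := by
  obtain ⟨M, hM0, hM⟩ := hK.exists_bound
  have hR := hS.tendsto_near_div
  have hB1 : Tendsto (fun n => 1 / B n) atTop (𝓝 0) := hS.tendsto_B.const_div_atTop 1
  rw [Metric.tendsto_atTop']
  intro ε hε
  have hω0 : 0 < ε / 4 := by positivity
  have hlim : Tendsto (fun n =>
      (2 * (((⌊B n⌋₊ + ℓ n : ℕ) : ℝ) / B n) + 1 / B n) * (ε / 4) + ℓ n / B n * M +
      ((B n / (q n * ℓ n : ℕ) + B n / T n) * (2 * (((⌊B n⌋₊ + ℓ n : ℕ) : ℝ) / B n)) +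
        ((q n * ℓ n : ℕ) : ℝ) / T n) *
        ((2 * (((⌊B n⌋₊ + ℓ n : ℕ) : ℝ) / B n) + 1 / B n) * M)) atTop
      (𝓝 ((2 * 1 + 0) * (ε / 4) + 0 * M +
        ((0 + 0) * (2 * 1) + 0) * ((2 * 1 + 0) * M))) :=
    ((((hR.const_mul 2).add hB1).mul_const _).add (hS.tendsto_ℓ_div_B.mul_const _)).add
      ((((hS.tendsto_B_div_L.add hS.tendsto_B_div_T).mul (hR.const_mul 2)).add
        hS.tendsto_L_div_T).mul (((hR.const_mul 2).add hB1).mul_const _))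
  have hval : (2 * 1 + 0) * (ε / 4) + 0 * M +
      ((0 + 0) * (2 * 1) + 0) * ((2 * 1 + 0) * M) < ε := by linarith
  have hev := ((hlim.eventually (gt_mem_nhds hval)).and
    (hK.eventually_modulus hS.tendsto_ℓ_div_B hω0)).and
    (((hS.tendsto_B.eventually_gt_atTop 0).and (hS.tendsto_T.eventually_gt_atTop 0)).and
      ((hS.q_pos.and (hS.tendsto_ℓ.eventually_gt_atTop 0)).and hS.le_mul))
  obtain ⟨n₀, hn₀⟩ := eventually_atTop.1 hev
  refine ⟨n₀, fun n hn => ?_⟩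
  obtain ⟨⟨h1, h2⟩, ⟨h3, h4⟩, ⟨h5, h6⟩, h7⟩ := hn₀ n hn.le
  have h4' : (0 : ℝ) < T n := by exact_mod_cast h4
  have h5' : (0 : ℝ) < q n := by exact_mod_cast h5
  have h6' : (0 : ℝ) < ℓ n := by exact_mod_cast h6
  have key := hK.sum_abs_coef_sub_blockCoef_le hM h3 h6 h5 h2 rfl h7
  rw [Real.dist_eq, sub_zero, abs_of_nonneg (div_nonneg (Finset.sum_nonneg fun _ _ =>
    Finset.sum_nonneg fun _ _ => abs_nonneg _) (by positivity))]
  refine lt_of_le_of_lt ?_ h1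
  rw [div_le_iff₀ (by positivity)]
  refine key.trans (le_of_eq ?_)
  have hL : ((q n * ℓ n : ℕ) : ℝ) ≠ 0 := by push_cast; positivity
  field_simp

omit hS in
theorem _root_.PanelCLT.abs_blockCoef_le {M : ℝ} (hM : ∀ u, |K u| ≤ M) (hM0 : 0 ≤ M) (B : ℝ)
    (ℓ q p k l : ℕ) : |blockCoef K B ℓ q p k l| ≤ M := by
  unfold blockCoef
  split_ifs
  · exact hM _
  · simpa using hM0

theorem tendsto_sum_sq_coef_sub :
    Tendsto (fun n => (∑ t ∈ Finset.range (T n), ∑ s ∈ Finset.range (T n),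
      (K (((t : ℝ) - s) / B n) -
        blockCoef K (B n) (ℓ n) (q n) (p n) (t / ℓ n) (s / ℓ n)) ^ 2) /
        (T n * B n)) atTop (𝓝 0) := by
  obtain ⟨M, hM0, hM⟩ := hK.exists_bound
  have h := (hS.tendsto_sum_abs_coef_sub hK).const_mul (2 * M)
  rw [mul_zero] at h
  refine squeeze_zero' ?_ ?_ h
  · filter_upwards [hS.tendsto_B.eventually_gt_atTop 0] with n hn
    refine div_nonneg (Finset.sum_nonneg fun _ _ => Finset.sum_nonneg fun _ _ => sq_nonneg _)
      (by positivity)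
  · filter_upwards [hS.tendsto_B.eventually_gt_atTop 0] with n hn
    rw [← mul_div_assoc]
    gcongr
    rw [Finset.mul_sum]
    refine Finset.sum_le_sum fun t _ => ?_
    rw [Finset.mul_sum]
    refine Finset.sum_le_sum fun s _ => ?_
    rw [← sq_abs, sq]
    gcongr
    refine (abs_sub _ _).trans ?_
    have := hM (((t : ℝ) - s) / B n)
    have := abs_blockCoef_le hK hM hM0.le (B n) (ℓ n) (q n) (p n) (t / ℓ n) (s / ℓ n)
    linarith

theorem tendsto_sum_sq_blockCoef :
    Tendsto (fun n => (∑ t ∈ Finset.range (T n), ∑ s ∈ Finset.range (T n),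
      blockCoef K (B n) (ℓ n) (q n) (p n) (t / ℓ n) (s / ℓ n) ^ 2) /
        (T n * B n)) atTop (𝓝 (∫ u in (-1 : ℝ)..1, K u ^ 2)) := by
  obtain ⟨M, hM0, hM⟩ := hK.exists_bound
  have h := (hS.tendsto_sum_abs_coef_sub hK).const_mul (2 * M)
  rw [mul_zero] at h
  have h2 := hK.tendsto_sum_sum_sq hS.tendsto_B hS.tendsto_T hS.tendsto_B_div_T
  have h3 : Tendsto (fun n => (∑ t ∈ Finset.range (T n), ∑ s ∈ Finset.range (T n),
      blockCoef K (B n) (ℓ n) (q n) (p n) (t / ℓ n) (s / ℓ n) ^ 2) / (T n * B n) -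
      (∑ t ∈ Finset.range (T n), ∑ s ∈ Finset.range (T n),
      K (((t : ℝ) - s) / B n) ^ 2) / (T n * B n)) atTop (𝓝 0) := by
    refine squeeze_zero_norm' ?_ h
    filter_upwards [hS.tendsto_B.eventually_gt_atTop 0] with n hn
    rw [← sub_div, norm_div, Real.norm_of_nonneg (by positivity : 0 ≤ T n * B n),
      ← mul_div_assoc]
    gcongr
    rw [Real.norm_eq_abs, ← Finset.sum_sub_distrib, Finset.mul_sum]
    refine (Finset.abs_sum_le_sum_abs _ _).trans (Finset.sum_le_sum fun t _ => ?_)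
    rw [← Finset.sum_sub_distrib, Finset.mul_sum]
    refine (Finset.abs_sum_le_sum_abs _ _).trans (Finset.sum_le_sum fun s _ => ?_)
    rw [sq_sub_sq, abs_mul, abs_sub_comm]
    gcongr
    refine (abs_add_le _ _).trans ?_
    have := hM (((t : ℝ) - s) / B n)
    have := abs_blockCoef_le hK hM hM0.le (B n) (ℓ n) (q n) (p n) (t / ℓ n) (s / ℓ n)
    linarith
  simpa using h3.add h2

omit hK in
-- A Cesàro mean over each block of growing length: a quantity that decays with the position in the
-- block is negligible on average.
theorem tendsto_sum_mod {f : ℕ → ℝ} (hf : ∀ i, 0 ≤ f i) (hf0 : Tendsto f atTop (𝓝 0)) :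
    Tendsto (fun n => (∑ t ∈ Finset.range (T n), f (t % ℓ n)) / T n) atTop (𝓝 0) := by
  have h1 := (hf0.cesaro).comp hS.tendsto_ℓ
  have h2 : Tendsto (fun n => (ℓ n : ℝ) / T n) atTop (𝓝 0) := by
    have := hS.tendsto_ℓ_div_B.mul hS.tendsto_B_div_T
    rw [mul_zero] at this
    refine this.congr' ?_
    filter_upwards [hS.tendsto_B.eventually_gt_atTop 0] with n hn
    rw [div_mul_div_cancel₀ hn.ne']
  have h3 := (h2.const_add 1).mul h1
  rw [mul_zero] at h3
  refine squeeze_zero' (Eventually.of_forall fun n => div_nonneg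
    (Finset.sum_nonneg fun _ _ => hf _) (Nat.cast_nonneg _)) ?_ h3
  filter_upwards [hS.tendsto_ℓ.eventually_gt_atTop 0, hS.tendsto_T.eventually_gt_atTop 0]
    with n hn hT
  have hn' : (0 : ℝ) < ℓ n := by exact_mod_cast hn
  have hT' : (0 : ℝ) < T n := by exact_mod_cast hT
  rw [div_le_iff₀ hT']
  refine (sum_range_mod_le (T n) hn hf).trans (le_of_eq ?_)
  simp only [Function.comp_apply]
  field_simp

end BlockScales

end BlockScales

/-! ### Decomposition of the block form into independent groups. -/

section GroupSums

theorem sum_sum_div_eq {b : ℕ → ℕ → ℝ} {n ℓ T : ℕ} (hℓ : 0 < ℓ)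
    (hb : ∀ k l, ¬(k < n ∧ l < n) → b k l = 0) (hT : n * ℓ ≤ T) (u : ℕ → ℝ) :
    ∑ t ∈ Finset.range T, ∑ s ∈ Finset.range T, b (t / ℓ) (s / ℓ) * (u t * u s) =
      ∑ k ∈ Finset.range n, ∑ l ∈ Finset.range n, b k l *
        ((∑ i ∈ Finset.range ℓ, u (k * ℓ + i)) * ∑ j ∈ Finset.range ℓ, u (l * ℓ + j)) := by
  have hdiv : ∀ k, ∀ i ∈ Finset.range ℓ, (k * ℓ + i) / ℓ = k := fun k i hi => by
    rw [mul_comm, Nat.mul_add_div hℓ, Nat.div_eq_of_lt (Finset.mem_range.1 hi), add_zero]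
  have hge : ∀ t, t ∉ Finset.range (n * ℓ) → ¬ t / ℓ < n := fun t ht h =>
    ht (Finset.mem_range.2 ((Nat.div_lt_iff_lt_mul hℓ).1 h))
  have hrow : ∀ t, ∑ s ∈ Finset.range T, b (t / ℓ) (s / ℓ) * (u t * u s) =
      ∑ l ∈ Finset.range n, b (t / ℓ) l * (u t * ∑ j ∈ Finset.range ℓ, u (l * ℓ + j)) := by
    intro t
    rw [← Finset.sum_subset (Finset.range_mono hT), sum_range_mul_eq]
    · refine Finset.sum_congr rfl fun l _ => ?_
      rw [Finset.mul_sum, Finset.mul_sum]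
      exact Finset.sum_congr rfl fun j hj => by rw [hdiv l j hj]
    · intro s _ hs
      rw [hb _ _ fun h => hge s hs h.2, zero_mul]
  simp_rw [hrow]
  rw [← Finset.sum_subset (Finset.range_mono hT), sum_range_mul_eq]
  · refine Finset.sum_congr rfl fun k _ => ?_
    rw [Finset.sum_comm]
    refine Finset.sum_congr rfl fun l _ => ?_
    rw [Finset.sum_mul, Finset.mul_sum]
    exact Finset.sum_congr rfl fun j hj => by rw [hdiv k j hj]
  · intro t _ ht
    refine Finset.sum_eq_zero fun l _ => ?_
    rw [hb _ _ fun h => hge t ht h.1, zero_mul]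

theorem sum_sum_group_eq {b c : ℕ → ℕ → ℝ} {p q : ℕ}
    (hb : ∀ k l, k / q ≠ l / q → b k l = 0)
    (hc : ∀ P < p, ∀ i < q, ∀ j < q, b (P * q + i) (P * q + j) = c i j) (y : ℕ → ℝ) :
    ∑ k ∈ Finset.range (p * q), ∑ l ∈ Finset.range (p * q), b k l * (y k * y l) =
      ∑ P ∈ Finset.range p, ∑ i ∈ Finset.range q, ∑ j ∈ Finset.range q,
        c i j * (y (P * q + i) * y (P * q + j)) := by
  have hdiv : ∀ k, ∀ i ∈ Finset.range q, (k * q + i) / q = k := fun k i hi => by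
    have hi' := Finset.mem_range.1 hi
    rw [mul_comm, Nat.mul_add_div (by omega), Nat.div_eq_of_lt hi', add_zero]
  rw [sum_range_mul_eq]
  refine Finset.sum_congr rfl fun P hP => Finset.sum_congr rfl fun i hi => ?_
  rw [sum_range_mul_eq, Finset.sum_eq_single_of_mem P hP]
  · exact Finset.sum_congr rfl fun j hj => by
      rw [hc P (Finset.mem_range.1 hP) i (Finset.mem_range.1 hi) j (Finset.mem_range.1 hj)]
  · intro R _ hR
    refine Finset.sum_eq_zero fun j hj => ?_
    rw [hb, zero_mul]
    rw [hdiv P i hi, hdiv R j hj]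
    exact hR.symm

/-- The strictly triangular form is the one with martingale increments; the factor `2` is the origin
of the `2` in the limiting variance. -/
theorem sum_sum_symm_eq {c : ℕ → ℕ → ℝ} (hs : ∀ i j, c i j = c j i) (h0 : ∀ i, c i i = 0)
    (q : ℕ) (y : ℕ → ℝ) :
    ∑ i ∈ Finset.range q, ∑ j ∈ Finset.range q, c i j * (y i * y j) =
      ∑ i ∈ Finset.range q, ∑ j ∈ Finset.range i, 2 * c i j * y j * y i := by
  induction q with
  | zero => simp
  | succ q ih =>
    rw [Finset.sum_range_succ _ q]
    simp_rw [Finset.sum_range_succ _ q]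
    rw [Finset.sum_add_distrib, ih, h0, zero_mul, add_zero, add_assoc, ← Finset.sum_add_distrib]
    congr 1
    refine Finset.sum_congr rfl fun j _ => ?_
    rw [hs j q]
    ring

theorem blockCoef_eq_zero {K : ℝ → ℝ} {B : ℝ} {ℓ q p k l : ℕ} (hq : 0 < q)
    (h : ¬(k < p * q ∧ l < p * q)) : blockCoef K B ℓ q p k l = 0 := by
  refine if_neg fun h' => h ⟨h'.2.2, ?_⟩
  rw [← Nat.div_lt_iff_lt_mul hq, ← h'.2.1, Nat.div_lt_iff_lt_mul hq]
  exact h'.2.2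

/-- The coefficients of the quadratic form within one group of blocks. -/
def groupCoef (K : ℝ → ℝ) (B : ℝ) (ℓ i j : ℕ) : ℝ :=
  if i = j then 0 else K (((i : ℝ) - j) * ℓ / B)

theorem blockCoef_group {K : ℝ → ℝ} {B : ℝ} {ℓ q p P i j : ℕ} (hP : P < p) (hi : i < q)
    (hj : j < q) : blockCoef K B ℓ q p (P * q + i) (P * q + j) = groupCoef K B ℓ i j := by
  have hq : 0 < q := by omega
  have hdiv : ∀ {i}, i < q → (P * q + i) / q = P := fun hi => by
    rw [mul_comm, Nat.mul_add_div hq, Nat.div_eq_of_lt hi, add_zero]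
  have hlt : P * q + i < p * q := by nlinarith
  unfold blockCoef groupCoef
  rw [hdiv hi, hdiv hj]
  by_cases hij : i = j
  · simp [hij]
  · rw [if_neg hij, if_pos ⟨by omega, rfl, hlt⟩]
    congr 2
    push_cast
    ring

/-- The quadratic form within one group of blocks, as a function of the block sums. -/
def groupForm (K : ℝ → ℝ) (B : ℝ) (ℓ q : ℕ) (y : ℕ → ℝ) : ℝ :=
  ∑ i ∈ Finset.range q, ∑ j ∈ Finset.range i, 2 * groupCoef K B ℓ i j * y j * y i

theorem measurable_groupForm {K : ℝ → ℝ} {B : ℝ} {ℓ q : ℕ} : Measurable (groupForm K B ℓ q) := by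
  unfold groupForm
  fun_prop

variable {K : ℝ → ℝ} (hK : IsKernel K) {B : ℝ} {ℓ q p T : ℕ}

include hK in
theorem IsKernel.groupCoef_symm (i j : ℕ) : groupCoef K B ℓ i j = groupCoef K B ℓ j i := by
  unfold groupCoef
  by_cases h : i = j
  · simp [h]
  · rw [if_neg h, if_neg (Ne.symm h), ← hK.symm]
    congr 1
    ring

include hK in
theorem IsKernel.blockForm_eq_sum_groupForm (hℓ : 0 < ℓ) (hq : 0 < q) (hT : p * (q * ℓ) ≤ T)
    (u : ℕ → ℝ) :
    ∑ t ∈ Finset.range T, ∑ s ∈ Finset.range T,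
      blockCoef K B ℓ q p (t / ℓ) (s / ℓ) * (u t * u s) =
    ∑ P ∈ Finset.range p, groupForm K B ℓ q fun j =>
      ∑ i ∈ Finset.range ℓ, u ((P * q + j) * ℓ + i) := by
  rw [sum_sum_div_eq hℓ (fun k l h => blockCoef_eq_zero hq h) (by rwa [mul_assoc]),
    sum_sum_group_eq (b := blockCoef K B ℓ q p) (c := groupCoef K B ℓ)
      (fun k l h => if_neg fun h' => h h'.2.1)
      (fun P hP i hi j hj => blockCoef_group hP hi hj)
      (fun k => ∑ i ∈ Finset.range ℓ, u (k * ℓ + i))]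
  refine Finset.sum_congr rfl fun P _ => ?_
  exact sum_sum_symm_eq hK.groupCoef_symm (fun i => if_pos rfl) q
    fun j => ∑ i ∈ Finset.range ℓ, u ((P * q + j) * ℓ + i)

include hK in
-- The regrouping identities applied to the squared coefficients and the constant sequence `1`,
-- whose block sums are `ℓ`. This links the variance of a group form to the Riemann sum of `K²`.
theorem IsKernel.sum_sq_blockCoef_eq (hℓ : 0 < ℓ) (hq : 0 < q) (hT : p * (q * ℓ) ≤ T) :
    2 * ∑ t ∈ Finset.range T, ∑ s ∈ Finset.range T, blockCoef K B ℓ q p (t / ℓ) (s / ℓ) ^ 2 =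
      p * (ℓ : ℝ) ^ 2 *
        ∑ i ∈ Finset.range q, ∑ j ∈ Finset.range i, (2 * groupCoef K B ℓ i j) ^ 2 := by
  have h1 := sum_sum_div_eq (b := fun k l => blockCoef K B ℓ q p k l ^ 2) hℓ
    (fun k l h => by simp [blockCoef_eq_zero hq h]) (n := p * q) (T := T) (by rwa [mul_assoc])
    (fun _ => 1)
  simp only [mul_one] at h1
  rw [h1, sum_sum_group_eq (c := fun i j => groupCoef K B ℓ i j ^ 2)
    (fun k l h => by simp [blockCoef, h])
    (fun P hP i hi j hj => by simp [blockCoef_group hP hi hj])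
    (fun k => ∑ i ∈ Finset.range ℓ, 1)]
  rw [Finset.sum_const, Finset.card_range, nsmul_eq_mul,
    sum_sum_symm_eq (c := fun i j => groupCoef K B ℓ i j ^ 2)
      (fun i j => by rw [hK.groupCoef_symm]) (fun i => by simp [groupCoef]) q
      (fun _ => ∑ i ∈ Finset.range ℓ, 1), Finset.mul_sum, Finset.mul_sum, Finset.mul_sum]
  refine Finset.sum_congr rfl fun i _ => ?_
  rw [Finset.mul_sum, Finset.mul_sum, Finset.mul_sum]
  refine Finset.sum_congr rfl fun j _ => ?_
  simp only [Finset.sum_const, Finset.card_range, nsmul_eq_mul, mul_one]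
  ring

section Law

variable {ν : Measure ℝ} [IsProbabilityMeasure ν]

theorem charFun_map_sum_iidLaw (ρ : Measure ℝ) [IsProbabilityMeasure ρ] (p : ℕ) (t : ℝ) :
    charFun ((iidLaw ℕ ρ).map fun z => ∑ P ∈ Finset.range p, z P) t = charFun ρ t ^ p := by
  have hind : iIndepFun (fun (i : ℕ) (z : ℕ → ℝ) => z i) (iidLaw ℕ ρ) :=
    iIndepFun_infinitePi (X := fun _ x => x) fun _ => measurable_id
  rw [(hind.precomp Subtype.val_injective).charFun_map_fun_finsetSum_eq_prod
    fun i _ => (measurable_pi_apply i).aemeasurable]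
  simp [Measure.infinitePi_map_eval]

theorem map_groupForm (hq : 0 < q) :
    (iidLaw ℕ ν).map (fun y P => groupForm K B ℓ q fun j => y (P * q + j)) =
      iidLaw ℕ ((iidLaw ℕ ν).map (groupForm K B ℓ q)) := by
  let ext : (Fin q → ℝ) → ℕ → ℝ := fun z i => if hi : i < q then z ⟨i, hi⟩ else 0
  have hext : Measurable ext := by
    refine measurable_pi_lambda _ fun i => ?_
    by_cases hi : i < q <;> simp only [ext, hi, dite_true, dite_false] <;> fun_prop
  let σ : ℕ × Fin q → ℕ := fun P => P.1 * q + P.2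
  have hσ : Function.Injective σ := by
    rintro ⟨a, b⟩ ⟨c, d⟩ hh
    simp only [σ] at hh
    have e : ∀ (a : ℕ) (b : Fin q), (a * q + b) / q = a := fun a b => by
      rw [mul_comm, Nat.mul_add_div hq, Nat.div_eq_of_lt b.2, add_zero]
    have h1 := e a b
    rw [hh, e] at h1
    subst h1
    have : b = d := Fin.ext (by omega)
    rw [this]
  have hH : Measurable fun z => groupForm K B ℓ q (ext z) := measurable_groupForm.comp hext
  have key : ∀ (y : ℕ → ℝ) (P : ℕ), groupForm K B ℓ q (fun j => y (P * q + j)) =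
      groupForm K B ℓ q (ext fun j => y (σ (P, j))) := by
    intro y P
    unfold groupForm
    refine Finset.sum_congr rfl fun i hi => Finset.sum_congr rfl fun j hj => ?_
    have hi' := Finset.mem_range.1 hi
    have hj' := (Finset.mem_range.1 hj).trans hi'
    simp only [ext, hi', hj', dite_true, σ]
  have h1 := map_regroup (μ := ν) hσ hH
  simp only [← key] at h1
  have : IsProbabilityMeasure ((iidLaw (Fin q) ν).map fun z => groupForm K B ℓ q (ext z)) :=
    Measure.isProbabilityMeasure_map hH.aemeasurable
  have h2 : ((iidLaw ℕ ν).map (fun y P => groupForm K B ℓ q fun j => y (P * q + j))).map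
      (fun y : ℕ → ℝ => y 0) = (iidLaw (Fin q) ν).map fun z => groupForm K B ℓ q (ext z) := by
    rw [h1, Measure.infinitePi_map_eval]
  have hG : Measurable fun (y : ℕ → ℝ) (P : ℕ) => groupForm K B ℓ q fun j => y (P * q + j) :=
    measurable_pi_lambda _ fun P => measurable_groupForm.comp (by fun_prop)
  rw [Measure.map_map (by fun_prop) hG] at h2
  rw [h1, ← h2]
  simp [Function.comp_def]

/-- The law of one group of blocks. -/
def groupLaw (ν : Measure ℝ) (K : ℝ → ℝ) (B : ℝ) (ℓ q : ℕ) : Measure ℝ :=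
  (iidLaw ℕ ν).map (groupForm K B ℓ q)

instance : IsProbabilityMeasure (groupLaw ν K B ℓ q) :=
  Measure.isProbabilityMeasure_map measurable_groupForm.aemeasurable

theorem groupLaw_moments (hν : MemLp id 4 ν) (h0 : ∫ x, x ∂ν = 0) :
    MemLp id 4 (groupLaw ν K B ℓ q) ∧ ∫ x, x ∂(groupLaw ν K B ℓ q) = 0 ∧
    ∫ x, x ^ 2 ∂(groupLaw ν K B ℓ q) = (∫ x, x ^ 2 ∂ν) ^ 2 *
      ∑ i ∈ Finset.range q, ∑ j ∈ Finset.range i, (2 * groupCoef K B ℓ i j) ^ 2 ∧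
    ∫ x, x ^ 4 ∂(groupLaw ν K B ℓ q) ≤ (16 * (∫ x, x ^ 4 ∂ν) *
      ∑ i ∈ Finset.range q, ∑ j ∈ Finset.range i, (2 * groupCoef K B ℓ i j) ^ 2) ^ 2 := by
  obtain ⟨h4, h1, h2, h3⟩ := iid_quadratic_moments hν h0 q fun i j => 2 * groupCoef K B ℓ i j
  have hm := (measurable_groupForm (K := K) (B := B) (ℓ := ℓ) (q := q)).aemeasurable
    (μ := iidLaw ℕ ν)
  unfold groupLaw
  refine ⟨?_, ?_, ?_, ?_⟩
  · rw [memLp_map_measure_iff (by fun_prop) hm]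
    exact h4
  · rw [integral_map hm (by fun_prop)]
    exact h1
  · rw [integral_map hm (by fun_prop)]
    exact h2
  · rw [integral_map hm (by fun_prop)]
    rw [sqNormFour_sq] at h3
    have h5 := pow_le_pow_left₀ sqNormFour_nonneg h3 2
    rw [sqNormFour_sq] at h5
    exact h5

end Law

end GroupSums

/-! ### Law of the block form. -/

section BlockForm

variable {E : Type*} [MeasurableSpace E] {μ : Measure E} [IsProbabilityMeasure μ]

/-- The law of a block sum. -/
def blockLaw (μ : Measure E) (f : (ℕ → E) → ℝ) (ℓ : ℕ) : Measure ℝ :=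
  (iidLaw ℤ μ).map (blockSum μ f ℓ 0)

/-- The quadratic form in the projected variables with block coefficients. -/
def blockForm (μ : Measure E) (f : (ℕ → E) → ℝ) (K : ℝ → ℝ) (B : ℝ) (T ℓ q p : ℕ)
    (x : ℤ → E) : ℝ :=
  ∑ t ∈ Finset.range T, ∑ s ∈ Finset.range T,
    blockCoef K B ℓ q p (t / ℓ) (s / ℓ) * (trunc μ f ℓ t x * trunc μ f ℓ s x)

variable {K : ℝ → ℝ} {B : ℝ} {ℓ q p T : ℕ} {f : (ℕ → E) → ℝ} {C : ℝ}

namespace CubicDecay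

variable (h : CubicDecay μ f C)
include h

theorem isProbabilityMeasure_blockLaw : IsProbabilityMeasure (blockLaw μ f ℓ) :=
  Measure.isProbabilityMeasure_map (h.measurable_blockSum 0).aemeasurable

theorem memLp_blockLaw : MemLp id 4 (blockLaw μ f ℓ) := by
  unfold blockLaw
  rw [memLp_map_measure_iff (by fun_prop) (h.measurable_blockSum 0).aemeasurable]
  exact h.memLp_blockSum 0

theorem integral_blockLaw : ∫ x, x ∂(blockLaw μ f ℓ) = 0 := by
  unfold blockLaw
  rw [integral_map (h.measurable_blockSum 0).aemeasurable (by fun_prop)]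
  exact h.integral_blockSum 0

theorem integral_sq_blockLaw :
    ∫ x, x ^ 2 ∂(blockLaw μ f ℓ) = ∫ x, blockSum μ f ℓ 0 x ^ 2 ∂(iidLaw ℤ μ) := by
  unfold blockLaw
  rw [integral_map (h.measurable_blockSum 0).aemeasurable (by fun_prop)]

theorem integral_pow_four_blockLaw_le :
    ∫ x, x ^ 4 ∂(blockLaw μ f ℓ) ≤ (36 * C ^ 2 * ℓ) ^ 2 := by
  unfold blockLaw
  rw [integral_map (h.measurable_blockSum 0).aemeasurable (by fun_prop)]
  have h1 := h.eLpNorm_blockSum_sq_le (ℓ := ℓ) 0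
  have h2 : eLpNorm (fun x => blockSum μ f ℓ 0 x ^ 2) 2 (iidLaw ℤ μ) ^ 2 =
      ENNReal.ofReal (∫ x, (blockSum μ f ℓ 0 x ^ 2) ^ 2 ∂(iidLaw ℤ μ)) :=
    eLpNorm_two_sq_eq (memLp_sq_of_four (h.memLp_blockSum 0))
  have h3 : eLpNorm (fun x => blockSum μ f ℓ 0 x ^ 2) 2 (iidLaw ℤ μ) =
      eLpNorm (blockSum μ f ℓ 0) 4 (iidLaw ℤ μ) ^ 2 := eLpNorm_sq_two
  rw [h3] at h2
  have h4 := pow_le_pow_left' h1 2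
  rw [h2, ← ENNReal.ofReal_pow (by positivity), ENNReal.ofReal_le_ofReal_iff (by positivity)] at h4
  simpa only [← pow_mul] using h4

/-- Independence passes in two stages: from innovations to block sums, then from block sums to the
forms within groups. -/
theorem map_blockForm (hK : IsKernel K) (hℓ : 0 < ℓ) (hq : 0 < q) (hT : p * (q * ℓ) ≤ T) :
    (iidLaw ℤ μ).map (blockForm μ f K B T ℓ q p) =
      (iidLaw ℕ (groupLaw (blockLaw μ f ℓ) K B ℓ q)).map
        fun z => ∑ P ∈ Finset.range p, z P := by
  have := h.isProbabilityMeasure_blockLaw (ℓ := ℓ)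
  have hG : Measurable fun (y : ℕ → ℝ) (P : ℕ) => groupForm K B ℓ q fun j => y (P * q + j) :=
    measurable_pi_lambda _ fun P => measurable_groupForm.comp (by fun_prop)
  have hB : Measurable fun (x : ℤ → E) (k : ℕ) => blockSum μ f ℓ k x :=
    measurable_pi_lambda _ h.measurable_blockSum
  rw [groupLaw, ← map_groupForm hq, blockLaw, ← h.map_blockSum hℓ,
    Measure.map_map hG hB, Measure.map_map (by fun_prop) (hG.comp hB)]
  congr 1
  ext x
  exact hK.blockForm_eq_sum_groupForm hℓ hq hT fun t => trunc μ f ℓ t x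

/-- Only products of distinct, hence independent and centred, block sums occur, so the block form
needs no centring. -/
theorem integral_blockForm (hK : IsKernel K) (hℓ : 0 < ℓ) (hq : 0 < q) (hT : p * (q * ℓ) ≤ T) :
    ∫ x, blockForm μ f K B T ℓ q p x ∂(iidLaw ℤ μ) = 0 := by
  have := h.isProbabilityMeasure_blockLaw (ℓ := ℓ)
  have hm : Measurable (blockForm μ f K B T ℓ q p) := by
    unfold blockForm
    have := fun t => h.measurable_trunc (ℓ := ℓ) t
    fun_prop
  obtain ⟨h4, h0, -, -⟩ := groupLaw_moments (K := K) (B := B) (ℓ := ℓ) (q := q)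
    (h.memLp_blockLaw (ℓ := ℓ)) h.integral_blockLaw
  have e : ∫ x, blockForm μ f K B T ℓ q p x ∂(iidLaw ℤ μ) =
      ∫ x, x ∂((iidLaw ℤ μ).map (blockForm μ f K B T ℓ q p)) :=
    (integral_map (f := fun x : ℝ => x) hm.aemeasurable (by fun_prop)).symm
  rw [e, h.map_blockForm hK hℓ hq hT, integral_map (by fun_prop) (by fun_prop),
    integral_finsetSum _ fun P _ => (memLp_coord h4 P).integrable (by norm_num)]
  refine Finset.sum_eq_zero fun P _ => ?_
  rw [← h0]
  exact integral_comp_measurePreserving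
    (measurePreserving_eval_infinitePi (fun _ : ℕ => groupLaw (blockLaw μ f ℓ) K B ℓ q) P)
    (g := fun x => x) (by fun_prop)

theorem charFun_map_blockForm (hK : IsKernel K) (hℓ : 0 < ℓ) (hq : 0 < q)
    (hT : p * (q * ℓ) ≤ T) (t : ℝ) :
    charFun ((iidLaw ℤ μ).map (blockForm μ f K B T ℓ q p)) t =
      charFun (groupLaw (blockLaw μ f ℓ) K B ℓ q) t ^ p := by
  have := h.isProbabilityMeasure_blockLaw (ℓ := ℓ)
  rw [h.map_blockForm hK hℓ hq hT, charFun_map_sum_iidLaw]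

end CubicDecay

end BlockForm

/-! ### Weighted sums of autocovariances. -/

section ToeplitzSums

theorem sum_sum_toeplitz {G : ℤ → ℝ} (hG : ∀ d, G (-d) = G d) (m : ℕ) :
    ∑ t ∈ Finset.range m, ∑ s ∈ Finset.range m, G ((t : ℤ) - s) =
      ∑ d ∈ Finset.range m, (if d = 0 then 1 else 2) * ((m : ℝ) - d) * G d := by
  induction m with
  | zero => simp
  | succ m ih =>
    have hcol : ∑ s ∈ Finset.range m, G ((m : ℤ) - s) = ∑ d ∈ Finset.range m, G (d + 1 : ℕ) := by
      rw [← Finset.sum_range_reflect]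
      refine Finset.sum_congr rfl fun j hj => ?_
      have := Finset.mem_range.1 hj
      congr 1
      push_cast
      omega
    have hcol' : ∑ s ∈ Finset.range m, G ((s : ℤ) - m) = ∑ d ∈ Finset.range m, G (d + 1 : ℕ) := by
      rw [← hcol]
      refine Finset.sum_congr rfl fun j _ => ?_
      rw [← hG, neg_sub]
    rw [Finset.sum_range_succ _ m]
    simp_rw [Finset.sum_range_succ _ m]
    rw [Finset.sum_add_distrib, ih, hcol, hcol', sub_self]
    have e : ∀ d ∈ Finset.range m, (if d = 0 then (1 : ℝ) else 2) * (((m + 1 : ℕ) : ℝ) - d) * G d =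
        (if d = 0 then (1 : ℝ) else 2) * ((m : ℝ) - d) * G d +
          (if d = 0 then (1 : ℝ) else 2) * G d := fun d _ => by push_cast; ring
    rw [Finset.sum_congr rfl e, Finset.sum_add_distrib, add_assoc, add_assoc]
    congr 1
    have e2 : ∑ d ∈ Finset.range m, (if d = 0 then (1 : ℝ) else 2) * G d +
        (if m = 0 then (1 : ℝ) else 2) * (((m + 1 : ℕ) : ℝ) - m) * G m =
        ∑ d ∈ Finset.range (m + 1), (if d = 0 then (1 : ℝ) else 2) * G d := by
      rw [Finset.sum_range_succ]
      push_cast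
      ring
    rw [e2, Finset.sum_range_succ']
    simp only [Nat.succ_ne_zero, if_false, if_true]
    rw [← Finset.mul_sum]
    push_cast
    ring

/-- Cutting the weight `1 - d / m` off at zero gives a series over all lags, a form in which
dominated convergence applies while `m` varies. -/
theorem sum_sum_toeplitz_div_eq_tsum {G : ℤ → ℝ} (hG : ∀ d, G (-d) = G d) {m : ℕ} (hm : 0 < m) :
    (∑ t ∈ Finset.range m, ∑ s ∈ Finset.range m, G ((t : ℤ) - s)) / m =
      ∑' d : ℕ, (if d = 0 then 1 else 2) * (max 0 (1 - (d : ℝ) / m) * G d) := by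
  have h0 : (0 : ℝ) < m := by exact_mod_cast hm
  rw [sum_sum_toeplitz hG, tsum_eq_sum (s := Finset.range m), Finset.sum_div]
  · refine Finset.sum_congr rfl fun d hd => ?_
    have h1 : (d : ℝ) < m := by exact_mod_cast Finset.mem_range.1 hd
    rw [max_eq_right (by rw [sub_nonneg, div_le_one h0]; exact h1.le)]
    field_simp
  · intro d hd
    have hd' : m ≤ d := not_lt.1 fun h => hd (Finset.mem_range.2 h)
    rw [max_eq_left, zero_mul, mul_zero]
    rw [sub_nonpos, one_le_div h0]
    exact_mod_cast hd'

theorem summable_inv_sq_shift (D : ℝ) : Summable fun d : ℕ => D / ((d : ℝ) + 1) ^ 2 := by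
  have := (summable_nat_add_iff 1).2 (Real.summable_one_div_nat_pow.2 (by norm_num : 1 < 2))
  refine (this.mul_left D).congr fun d => ?_
  push_cast
  ring

/-- For uniformly summable covariances, kernel weights at a diverging bandwidth do not change the
long-run variance. -/
theorem IsKernel.tendsto_kernel_sum_sub {K : ℝ → ℝ} (hK : IsKernel K) {γ : ℕ → ℤ → ℝ}
    (hγ : ∀ n d, γ n (-d) = γ n d) {D : ℝ} (hD : ∀ n (d : ℕ), |γ n d| ≤ D / ((d : ℝ) + 1) ^ 2)
    {B : ℕ → ℝ} {T ℓ : ℕ → ℕ} (hB : Tendsto B atTop atTop) (hT : Tendsto T atTop atTop)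
    (hℓ : Tendsto ℓ atTop atTop) :
    Tendsto (fun n =>
      (∑ t ∈ Finset.range (T n), ∑ s ∈ Finset.range (T n),
        γ n ((t : ℤ) - s) * K (((t : ℝ) - s) / B n)) / T n -
      (∑ t ∈ Finset.range (ℓ n), ∑ s ∈ Finset.range (ℓ n), γ n ((t : ℤ) - s)) / ℓ n)
      atTop (𝓝 0) := by
  obtain ⟨M, hM0, hM⟩ := hK.exists_bound
  have hD0 : 0 ≤ D := by simpa using (abs_nonneg _).trans (hD 0 0)
  have hw : ∀ {m : ℕ → ℕ}, Tendsto m atTop atTop → ∀ d : ℕ,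
      Tendsto (fun n => max 0 (1 - (d : ℝ) / m n)) atTop (𝓝 1) := fun hm d => by
    have h1 := (tendsto_natCast_atTop_atTop (R := ℝ)).comp hm |>.const_div_atTop (d : ℝ)
    have h2 := (tendsto_const_nhds (x := (0 : ℝ))).max (h1.const_sub 1)
    simpa using h2
  have hw0 : ∀ (m d : ℕ), 0 ≤ max 0 (1 - (d : ℝ) / m) := fun m d => le_max_left _ _
  have hw1 : ∀ (m d : ℕ), max 0 (1 - (d : ℝ) / m) ≤ 1 := fun m d =>
    max_le zero_le_one (sub_le_self _ (by positivity))
  -- The covariances change with `n` and need not converge, so the difference of the two series is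
  -- treated: at each lag the difference of the weights tends to zero because `K 0 = 1`, and `hD`
  -- provides a summable majorant.
  have hlim := tendsto_tsum_of_dominated_convergence (β := ℕ) (G := ℝ) (𝓕 := atTop)
    (f := fun n d => (if d = 0 then 1 else 2) * (max 0 (1 - (d : ℝ) / T n) *
        (γ n d * K ((d : ℝ) / B n))) -
      (if d = 0 then 1 else 2) * (max 0 (1 - (d : ℝ) / ℓ n) * γ n d))
    (g := fun _ => 0) (bound := fun d => 2 * (M + 1) * D / ((d : ℝ) + 1) ^ 2)
    (summable_inv_sq_shift _)
    (fun d => by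
      have hKd : Tendsto (fun n => K ((d : ℝ) / B n)) atTop (𝓝 1) := by
        rw [← hK.zero]
        exact (hK.continuous.tendsto 0).comp (hB.const_div_atTop _)
      have h1 : Tendsto (fun n => max 0 (1 - (d : ℝ) / T n) * K ((d : ℝ) / B n) -
          max 0 (1 - (d : ℝ) / ℓ n)) atTop (𝓝 0) := by
        have := ((hw hT d).mul hKd).sub (hw hℓ d)
        rwa [mul_one, sub_self] at this
      have h2 := h1.norm.const_mul (2 * (D / ((d : ℝ) + 1) ^ 2))
      rw [norm_zero, mul_zero] at h2
      refine squeeze_zero_norm (fun n => ?_) h2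
      rw [show (if d = 0 then (1 : ℝ) else 2) * (max 0 (1 - (d : ℝ) / T n) *
          (γ n d * K ((d : ℝ) / B n))) -
        (if d = 0 then 1 else 2) * (max 0 (1 - (d : ℝ) / ℓ n) * γ n d) =
        ((if d = 0 then 1 else 2) * γ n d) * (max 0 (1 - (d : ℝ) / T n) * K ((d : ℝ) / B n) -
          max 0 (1 - (d : ℝ) / ℓ n)) by ring, norm_mul]
      refine mul_le_mul_of_nonneg_right ?_ (norm_nonneg _)
      rw [norm_mul]
      refine mul_le_mul ?_ (hD n d) (norm_nonneg _) (by norm_num)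
      split_ifs <;> norm_num)
    (Eventually.of_forall fun n d => by
      rw [show (if d = 0 then (1 : ℝ) else 2) * (max 0 (1 - (d : ℝ) / T n) *
          (γ n d * K ((d : ℝ) / B n))) -
        (if d = 0 then 1 else 2) * (max 0 (1 - (d : ℝ) / ℓ n) * γ n d) =
        (if d = 0 then 1 else 2) * (max 0 (1 - (d : ℝ) / T n) * K ((d : ℝ) / B n) -
          max 0 (1 - (d : ℝ) / ℓ n)) * γ n d by ring,
        show 2 * (M + 1) * D / ((d : ℝ) + 1) ^ 2 = 2 * (M + 1) * (D / ((d : ℝ) + 1) ^ 2) by ring,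
        norm_mul, norm_mul]
      refine mul_le_mul (mul_le_mul ?_ ?_ (norm_nonneg _) (by norm_num)) (hD n d) (norm_nonneg _)
        (by positivity)
      · split_ifs <;> norm_num
      · refine (norm_sub_le _ _).trans (add_le_add ?_ ?_)
        · rw [norm_mul, Real.norm_of_nonneg (hw0 _ _)]
          calc _ ≤ 1 * M := mul_le_mul (hw1 _ _) (hM _) (abs_nonneg _) zero_le_one
            _ = M := one_mul M
        · rw [Real.norm_of_nonneg (hw0 _ _)]
          exact hw1 _ _)
  rw [tsum_zero] at hlim
  have hsum : ∀ (n m : ℕ) (c : ℕ → ℝ), (∀ d, |c d| ≤ M + 1) → Summable fun d : ℕ =>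
      (if d = 0 then (1 : ℝ) else 2) * (max 0 (1 - (d : ℝ) / m) * (γ n d * c d)) := by
    intro n m c hc
    refine Summable.of_norm_bounded (summable_inv_sq_shift (2 * (M + 1) * D)) fun d => ?_
    rw [show (if d = 0 then (1 : ℝ) else 2) * (max 0 (1 - (d : ℝ) / m) * (γ n d * c d)) =
        (if d = 0 then 1 else 2) * (max 0 (1 - (d : ℝ) / m) * c d) * γ n d by ring,
      show 2 * (M + 1) * D / ((d : ℝ) + 1) ^ 2 = 2 * (M + 1) * (D / ((d : ℝ) + 1) ^ 2) by ring,
      norm_mul, norm_mul]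
    refine mul_le_mul (mul_le_mul ?_ ?_ (norm_nonneg _) (by norm_num)) (hD n d) (norm_nonneg _)
        (by positivity)
    · split_ifs <;> norm_num
    · rw [norm_mul, Real.norm_of_nonneg (hw0 _ _)]
      calc _ ≤ 1 * (M + 1) := mul_le_mul (hw1 _ _) (hc _) (abs_nonneg _) zero_le_one
        _ = M + 1 := one_mul _
  refine hlim.congr' ?_
  filter_upwards [hT.eventually_gt_atTop 0, hℓ.eventually_gt_atTop 0] with n h1 h2
  have e1 := sum_sum_toeplitz_div_eq_tsum (G := fun d : ℤ => γ n d * K ((d : ℝ) / B n))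
    (fun d => by
      have : K (((-d : ℤ) : ℝ) / B n) = K ((d : ℝ) / B n) := by
        rw [← hK.symm]
        push_cast
        rw [neg_div, neg_neg]
      rw [hγ, this]) h1
  have e2 := sum_sum_toeplitz_div_eq_tsum (G := γ n) (hγ n) h2
  simp only [Int.cast_sub, Int.cast_natCast] at e1
  rw [e1, e2, ← Summable.tsum_sub]
  · exact hsum n (T n) (fun d => K ((d : ℝ) / B n)) fun d => (hM _).trans (by linarith)
  · have := hsum n (ℓ n) (fun _ => 1) fun d => by rw [abs_one]; linarith
    simpa only [mul_one] using this

end ToeplitzSums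

/-! ### Decay of autocovariances. -/

section Autocovariance

variable {E : Type*} [MeasurableSpace E] {μ : Measure E} [IsProbabilityMeasure μ]

theorem avg_of_dependsOn {ι : Type*} {S : Set ι} {f : (ι → E) → ℝ} (hf : DependsOn f S)
    (x : ι → E) : avg μ S f x = ∫ y, f y ∂(iidLaw ι μ) := by
  unfold avg
  congr 1
  ext y
  exact hf fun i hi => by simp [resample, hi]

theorem enorm_integral_mul_le {α : Type*} [MeasurableSpace α] {m : Measure α} {f g : α → ℝ}
    (hf : AEStronglyMeasurable f m) (hg : AEStronglyMeasurable g m) :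
    ‖∫ x, f x * g x ∂m‖ₑ ≤ eLpNorm f 2 m * eLpNorm g 2 m := by
  have h := eLpNorm_le_eLpNorm_mul_eLpNorm_of_nnnorm (p := 2) (q := 2) (r := 1) hf hg
    (fun a b : ℝ => a * b) 1 (Eventually.of_forall fun x => by simp)
  rw [ENNReal.coe_one, one_mul, eLpNorm_one_eq_lintegral_enorm] at h
  exact (enorm_integral_le_lintegral_enorm _).trans h

/-- The autocovariance function of the causal process. -/
def autocov (μ : Measure E) (f : (ℕ → E) → ℝ) (d : ℤ) : ℝ :=
  ∫ x, causal f 0 x * causal f d x ∂(iidLaw ℤ μ)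

namespace CubicDecay

variable {f : (ℕ → E) → ℝ} {C : ℝ} (h : CubicDecay μ f C)
include h

theorem integral_mul_eq_autocov (t s : ℤ) :
    ∫ x, causal f t x * causal f s x ∂(iidLaw ℤ μ) = autocov μ f (s - t) := by
  have := integral_comp_measurePreserving (measurePreserving_shift μ t)
    (g := fun x => causal f 0 x * causal f (s - t) x)
    ((measurable_causal h.measurable 0).mul (measurable_causal h.measurable _)).aestronglyMeasurable
  simp only [causal_shift, zero_add, sub_add_cancel] at this
  exact this

theorem autocov_neg (d : ℤ) : autocov μ f (-d) = autocov μ f d := by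
  have h1 := h.integral_mul_eq_autocov d 0
  rw [zero_sub] at h1
  rw [← h1, autocov]
  congr 1
  ext x
  ring

/-- `X_0` depends only on innovations up to time `0`, so it is orthogonal to `X_d` with these
averaged out. Only the remainder contributes, and its norm is bounded by the total influence of
innovations of lag at least `d`. -/
theorem abs_autocov_le (d : ℕ) : |autocov μ f d| ≤ 4 * C ^ 2 / ((d : ℝ) + 1) ^ 2 := by
  have hC := h.nonneg
  have hm := measurable_causal h.measurable
  have hav : ∫ x, causal f 0 x * avg μ (Set.Iic 0) (causal f d) x ∂(iidLaw ℤ μ) = 0 := by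
    rw [← integral_avg_mul_comm _ (hm 0) (hm d) (h.memLp_two 0) (h.memLp_two d)]
    simp_rw [avg_of_dependsOn (causal_dependsOn f 0), h.integral_eq_zero, zero_mul, integral_zero]
  have havL : MemLp (avg μ (Set.Iic 0) (causal f d)) 2 (iidLaw ℤ μ) :=
    memLp_avg _ (hm d) (by norm_num) (by norm_num) (h.memLp_two d)
  have e : autocov μ f d =
      ∫ x, causal f 0 x * (causal f d x - avg μ (Set.Iic 0) (causal f d) x) ∂(iidLaw ℤ μ) := by
    simp_rw [mul_sub]
    rw [integral_sub, hav, sub_zero, autocov]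
    · exact (h.memLp_two 0).integrable_mul (h.memLp_two d)
    · exact (h.memLp_two 0).integrable_mul havL
  have key : ‖autocov μ f d‖ₑ ≤ ENNReal.ofReal (4 * C ^ 2 / ((d : ℝ) + 1) ^ 2) := by
    rw [e]
    refine (enorm_integral_mul_le (hm 0).aestronglyMeasurable
      ((hm d).sub (measurable_avg _ (hm d))).aestronglyMeasurable).trans ?_
    have h1 : eLpNorm (causal f 0) 2 (iidLaw ℤ μ) ≤ ENNReal.ofReal (2 * C) :=
      (eLpNorm_le_eLpNorm_of_exponent_le (by norm_num) (hm 0).aestronglyMeasurable).trans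
        (h.eLpNorm_four_le 0)
    have h2 : eLpNorm (fun x => causal f d x - avg μ (Set.Iic 0) (causal f d) x) 2 (iidLaw ℤ μ) ≤
        ENNReal.ofReal (2 * C / ((d : ℝ) + 1) ^ 2) := by
      refine (eLpNorm_le_eLpNorm_of_exponent_le (q := 4) (by norm_num)
        ((hm d).sub (measurable_avg _ (hm d))).aestronglyMeasurable).trans ?_
      refine (eLpNorm_sub_avg_le_tsum (Set.Iic 0) (hm d) (h.memLp_two d) (by norm_num)
        (by norm_num)).trans ?_
      have := h.tsum_infl_le d d
      rwa [sub_self] at this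
    refine (mul_le_mul' h1 h2).trans (le_of_eq ?_)
    rw [← ENNReal.ofReal_mul (by positivity)]
    congr 1
    ring
  rwa [← ofReal_norm, ENNReal.ofReal_le_ofReal_iff (by positivity),
    Real.norm_eq_abs] at key

theorem integral_sq_sum_eq (m : ℕ) :
    ∫ x, (∑ i ∈ Finset.range m, causal f (i : ℕ) x) ^ 2 ∂(iidLaw ℤ μ) =
      ∑ t ∈ Finset.range m, ∑ s ∈ Finset.range m, autocov μ f ((t : ℤ) - s) := by
  simp_rw [sq, Finset.sum_mul_sum]
  have hint : ∀ t s : ℕ, Integrable (fun x => causal f t x * causal f s x) (iidLaw ℤ μ) :=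
    fun t s => (h.memLp_two t).integrable_mul (h.memLp_two s)
  rw [integral_finsetSum _ fun t _ => integrable_finsetSum _ fun s _ => hint t s]
  refine Finset.sum_congr rfl fun t _ => ?_
  rw [integral_finsetSum _ fun s _ => hint t s]
  refine Finset.sum_congr rfl fun s _ => ?_
  rw [h.integral_mul_eq_autocov, ← h.autocov_neg, neg_sub]

end CubicDecay

theorem abs_sqrt_integral_sub_le {α : Type*} [MeasurableSpace α] {m : Measure α} {f g : α → ℝ}
    (hf : MemLp f 2 m) (hg : MemLp g 2 m) :
    |√(∫ x, f x ^ 2 ∂m) - √(∫ x, g x ^ 2 ∂m)| ≤ (eLpNorm (fun x => f x - g x) 2 m).toReal := by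
  have hs : ∀ {f : α → ℝ}, MemLp f 2 m → √(∫ x, f x ^ 2 ∂m) = (eLpNorm f 2 m).toReal :=
    fun {f} hf => by
      have h1 := congrArg ENNReal.toReal (eLpNorm_two_sq_eq hf)
      rw [ENNReal.toReal_pow, ENNReal.toReal_ofReal (integral_nonneg fun x => sq_nonneg _)] at h1
      rw [← h1, Real.sqrt_sq ENNReal.toReal_nonneg]
  have tri : ∀ {f g : α → ℝ}, MemLp f 2 m → MemLp g 2 m → (eLpNorm f 2 m).toReal ≤
      (eLpNorm (fun x => f x - g x) 2 m).toReal + (eLpNorm g 2 m).toReal := fun {f g} hf hg => by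
    have h1 := eLpNorm_add_le (hf.sub hg).1 hg.1 (p := 2) (by norm_num)
    rw [sub_add_cancel] at h1
    have h2 := ENNReal.toReal_mono (ENNReal.add_ne_top.2 ⟨(hf.sub hg).2.ne, hg.2.ne⟩) h1
    rwa [ENNReal.toReal_add (hf.sub hg).2.ne hg.2.ne] at h2
  rw [hs hf, hs hg, abs_le]
  constructor
  · have := tri hg hf
    have hsymm : eLpNorm (fun x => g x - f x) 2 m = eLpNorm (fun x => f x - g x) 2 m :=
      eLpNorm_sub_comm g f 2 m
    rw [hsymm] at this
    linarith
  · have := tri hf hg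
    linarith

end Autocovariance

/-! ### Long-run variance of the block sums. -/

section LongRunVariance

variable {E : ℕ → Type*} [∀ n, MeasurableSpace (E n)] {μ : ∀ n, Measure (E n)}
  [∀ n, IsProbabilityMeasure (μ n)] {f : ∀ n, (ℕ → E n) → ℝ} {C : ℝ}

/-- The variance of a block sum, per unit length, has the limit of the kernel-weighted
variance. -/
theorem tendsto_integral_sq_blockSum (h : ∀ n, CubicDecay (μ n) (f n) C) {K : ℝ → ℝ}
    (hK : IsKernel K) {B : ℕ → ℝ} {T ℓ : ℕ → ℕ} (hB : Tendsto B atTop atTop)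
    (hT : Tendsto T atTop atTop) (hℓ : Tendsto ℓ atTop atTop) {σ2 : ℝ}
    (hσ : Tendsto (fun n => (∑ t ∈ Finset.range (T n), ∑ s ∈ Finset.range (T n),
      autocov (μ n) (f n) ((t : ℤ) - s) * K (((t : ℝ) - s) / B n)) / T n) atTop (𝓝 σ2)) :
    Tendsto (fun n => (∫ x, blockSum (μ n) (f n) (ℓ n) 0 x ^ 2 ∂(iidLaw ℤ (μ n))) / ℓ n)
      atTop (𝓝 σ2) := by
  have hC := (h 0).nonneg
  have h1 := hK.tendsto_kernel_sum_sub (fun n => (h n).autocov_neg)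
    (fun n => (h n).abs_autocov_le) hB hT hℓ
  -- The normalized variance of the unprojected partial sums of length `ℓ` inherits the limit `σ2`
  -- of the kernel-weighted variance.
  have h2 := hσ.sub h1
  simp only [sub_sub_cancel, sub_zero, ← fun n => (h n).integral_sq_sum_eq (ℓ n)] at h2
  have h3 := (Real.continuous_sqrt.tendsto _).comp h2
  have hnn : 0 ≤ σ2 := ge_of_tendsto' h2 fun n =>
    div_nonneg (integral_nonneg fun x => sq_nonneg _) (Nat.cast_nonneg _)
  -- the block sums approximate the partial sums
  have hcs : Tendsto (fun n => 36 * C * ((ℓ n : ℝ)⁻¹ *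
      ∑ i ∈ Finset.range (ℓ n), 6 * C / ((i : ℝ) + 1))) atTop (𝓝 0) := by
    have h0 : Tendsto (fun i : ℕ => 6 * C / ((i : ℝ) + 1)) atTop (𝓝 0) :=
      (tendsto_natCast_atTop_atTop.atTop_add tendsto_const_nhds).const_div_atTop _
    have := ((h0.cesaro).comp hℓ).const_mul (36 * C)
    rwa [mul_zero] at this
  have h4 : Tendsto (fun n =>
      √((∫ x, blockSum (μ n) (f n) (ℓ n) 0 x ^ 2 ∂(iidLaw ℤ (μ n))) / ℓ n) -
      √((∫ x, (∑ i ∈ Finset.range (ℓ n), causal (f n) (i : ℕ) x) ^ 2 ∂(iidLaw ℤ (μ n))) / ℓ n))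
      atTop (𝓝 0) := by
    have hsq := (Real.continuous_sqrt.tendsto _).comp hcs
    rw [Real.sqrt_zero] at hsq
    refine squeeze_zero_norm' ?_ hsq
    filter_upwards [hℓ.eventually_gt_atTop 0] with n hn
    have hn' : (0 : ℝ) < ℓ n := by exact_mod_cast hn
    have hS : MemLp (fun x => ∑ i ∈ Finset.range (ℓ n), causal (f n) (i : ℕ) x) 2
        (iidLaw ℤ (μ n)) := memLp_finsetSum _ fun i _ => (h n).memLp_two i
    have hY := memLp_two_of_four ((h n).memLp_blockSum (ℓ := ℓ n) 0)
    have h5 := abs_sqrt_integral_sub_le hS hY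
    have h6 := (h n).eLpNorm_sum_resid_sq_le hn
    rw [← ENNReal.ofReal_sum_of_nonneg (fun i _ => by positivity), ← ENNReal.ofReal_mul
      (by positivity), show (9 : ℝ≥0∞) = ENNReal.ofReal 9 by simp, ← ENNReal.ofReal_mul
      (by positivity)] at h6
    have h7 := ENNReal.toReal_mono ENNReal.ofReal_ne_top h6
    rw [ENNReal.toReal_pow, ENNReal.toReal_ofReal (mul_nonneg (by norm_num) (mul_nonneg
      (by positivity) (Finset.sum_nonneg fun i _ => by positivity)))] at h7
    rw [Real.norm_eq_abs, Real.sqrt_div' _ hn'.le, Real.sqrt_div' _ hn'.le, ← sub_div, abs_div,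
      abs_of_pos (Real.sqrt_pos.2 hn'), abs_sub_comm]
    refine Real.le_sqrt_of_sq_le ?_
    rw [div_pow, Real.sq_sqrt hn'.le, div_le_iff₀ hn']
    refine (pow_le_pow_left₀ (abs_nonneg _) h5 2).trans (h7.trans (le_of_eq ?_))
    field_simp
    ring
  have h5 := (h4.add h3).pow 2
  simp only [Function.comp_apply, sub_add_cancel, zero_add, Real.sq_sqrt hnn] at h5
  refine h5.congr fun n => ?_
  exact Real.sq_sqrt (div_nonneg (integral_nonneg fun x => sq_nonneg _) (Nat.cast_nonneg _))

end LongRunVariance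

/-! ### From the kernel form to the block form. -/

section KernelForm

/-- The quadratic form of a causal process with kernel weights. -/
def kernelForm {E : Type*} (f : (ℕ → E) → ℝ) (K : ℝ → ℝ) (B : ℝ) (T : ℕ) (x : ℤ → E) : ℝ :=
  ∑ t ∈ Finset.range T, ∑ s ∈ Finset.range T,
    K (((t : ℝ) - s) / B) * (causal f t x * causal f s x)

namespace CubicDecay

variable {E : Type*} [MeasurableSpace E] {μ : Measure E} [IsProbabilityMeasure μ]
  {f : (ℕ → E) → ℝ} {C : ℝ} (h : CubicDecay μ f C)
include h

theorem measurable_kernelForm (K : ℝ → ℝ) (B : ℝ) (T : ℕ) :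
    Measurable (kernelForm f K B T) := by
  have := measurable_causal h.measurable
  unfold kernelForm
  fun_prop

theorem measurable_blockForm (K : ℝ → ℝ) (B : ℝ) (T ℓ q p : ℕ) :
    Measurable (blockForm μ f K B T ℓ q p) := by
  have := fun t => h.measurable_trunc (ℓ := ℓ) t
  unfold blockForm
  fun_prop

/-- The error made by passing to the projected variables and the block coefficients. -/
theorem eLpNorm_kernelForm_sub_blockForm_sq_le {K : ℝ → ℝ} (hK : IsKernel K) {M : ℝ}
    (hM : ∀ u, |K u| ≤ M) {B : ℝ} (hB : 0 < B) {T ℓ q p : ℕ} (hℓ : 0 < ℓ) (hq : 0 < q)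
    (hT : p * (q * ℓ) ≤ T) :
    eLpNorm (fun x => (kernelForm f K B T x - ∫ y, kernelForm f K B T y ∂(iidLaw ℤ μ)) -
      blockForm μ f K B T ℓ q p x) 2 (iidLaw ℤ μ) ^ 2 ≤
    ENNReal.ofReal (2 * (36 * (4 * C) ^ 3 * ((2 * ⌊B⌋₊ + 1) * M ^ 2 *
        ∑ t ∈ Finset.range T, 6 * C / (((t % ℓ : ℕ) : ℝ) + 1))) +
      2 * (36 * (2 * C) ^ 4 * ∑ t ∈ Finset.range T, ∑ s ∈ Finset.range T,
        (K (((t : ℝ) - s) / B) - blockCoef K B ℓ q p (t / ℓ) (s / ℓ)) ^ 2)) := by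
  have hC := h.nonneg
  have hM0 : 0 ≤ M := (abs_nonneg _).trans (hM 0)
  have hmt := fun t : ℤ => h.measurable_trunc (ℓ := ℓ) t
  set tf : (ℤ → E) → ℝ := fun x => ∑ t ∈ Finset.range T, ∑ s ∈ Finset.range T,
    K (((t : ℝ) - s) / B) * (trunc μ f ℓ t x * trunc μ f ℓ s x) with htf
  have htfm : Measurable tf := by fun_prop
  have hti : ∀ t s : ℕ, Integrable (fun x => trunc μ f ℓ t x * trunc μ f ℓ s x) (iidLaw ℤ μ) :=
    fun t s => (memLp_two_of_four (h.memLp_trunc t)).integrable_mul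
      (memLp_two_of_four (h.memLp_trunc s))
  have htfi : Integrable tf (iidLaw ℤ μ) :=
    integrable_finsetSum _ fun t _ => integrable_finsetSum _ fun s _ => (hti t s).const_mul _
  have hbfi : Integrable (blockForm μ f K B T ℓ q p) (iidLaw ℤ μ) :=
    integrable_finsetSum _ fun t _ => integrable_finsetSum _ fun s _ => (hti t s).const_mul _
  -- A row of kernel coefficients has at most `2 ⌊B⌋₊ + 1` nonzero entries, each at most `M` in
  -- absolute value.
  have key1 := h.quad_sub_quad_trunc_le hℓ T (fun t s => K (((t : ℝ) - s) / B))
    (fun t s => by rw [← hK.symm, ← neg_div, neg_sub])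
    (A := ENNReal.ofReal ((2 * ⌊B⌋₊ + 1) * M ^ 2)) (fun t => by
      have hnn : ∀ s : ℕ, ‖K (((t : ℝ) - s) / B)‖ₑ ^ 2 =
          ENNReal.ofReal (K (((t : ℝ) - s) / B) ^ 2) := fun s => by
        rw [← ofReal_norm, ← ENNReal.ofReal_pow (norm_nonneg _), Real.norm_eq_abs, sq_abs]
      simp_rw [hnn]
      rw [← ENNReal.ofReal_sum_of_nonneg fun s _ => sq_nonneg _]
      refine ENNReal.ofReal_le_ofReal (sum_range_near_le T t ⌊B⌋₊ (sq_nonneg M) (fun s => ?_)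
        fun s hs => ?_)
      · rw [← sq_abs]
        exact pow_le_pow_left₀ (abs_nonneg _) (hM _) 2
      · have hfl := Nat.lt_floor_add_one B
        rw [hK.eq_zero_of_lt hB, zero_pow two_ne_zero]
        by_cases h1 : s ≤ t + ⌊B⌋₊
        · have h2 : s + ⌊B⌋₊ + 1 ≤ t := by omega
          have h3 : (s : ℝ) + ⌊B⌋₊ + 1 ≤ t := by exact_mod_cast h2
          exact lt_of_lt_of_le (by linarith) (le_abs_self _)
        · have h2 : t + ⌊B⌋₊ + 1 ≤ s := by omega
          have h3 : (t : ℝ) + ⌊B⌋₊ + 1 ≤ s := by exact_mod_cast h2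
          exact lt_of_lt_of_le (by linarith) (neg_le_abs _))
  have key2 := h.quad_trunc_le (ℓ := ℓ) T
    fun t s => K (((t : ℝ) - s) / B) - blockCoef K B ℓ q p (t / ℓ) (s / ℓ)
  have hsub : ∀ x, ∑ t ∈ Finset.range T, ∑ s ∈ Finset.range T,
      (K (((t : ℝ) - s) / B) - blockCoef K B ℓ q p (t / ℓ) (s / ℓ)) *
        (trunc μ f ℓ t x * trunc μ f ℓ s x) = tf x - blockForm μ f K B T ℓ q p x := fun x => by
    simp only [htf, blockForm, ← Finset.sum_sub_distrib, sub_mul]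
  simp_rw [hsub] at key2
  rw [integral_sub htfi hbfi, h.integral_blockForm hK hℓ hq hT, sub_zero] at key2
  -- The intermediate form has projected variables and kernel coefficients: first the variables
  -- change, then the coefficients.
  have hsplit : (fun x => (kernelForm f K B T x - ∫ y, kernelForm f K B T y ∂(iidLaw ℤ μ)) -
      blockForm μ f K B T ℓ q p x) =
      (fun x => (kernelForm f K B T x - ∫ y, kernelForm f K B T y ∂(iidLaw ℤ μ)) -
        (tf x - ∫ y, tf y ∂(iidLaw ℤ μ))) +
      fun x => tf x - blockForm μ f K B T ℓ q p x - ∫ y, tf y ∂(iidLaw ℤ μ) := by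
    ext x
    simp only [Pi.add_apply]
    ring
  rw [hsplit]
  refine (pow_le_pow_left' (eLpNorm_add_le ?_ ?_ (by norm_num)) 2).trans ?_
  · exact (((h.measurable_kernelForm K B T).sub_const _).sub
      (htfm.sub_const _)).aestronglyMeasurable
  · exact ((htfm.sub (h.measurable_blockForm K B T ℓ q p)).sub_const _).aestronglyMeasurable
  refine (add_sq_le_two _ _).trans ?_
  rw [ENNReal.ofReal_add (by positivity) (by positivity), ENNReal.ofReal_mul (p := 2)
    (by norm_num), ENNReal.ofReal_mul (p := 2) (by norm_num), ENNReal.ofReal_ofNat]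
  refine add_le_add (mul_le_mul' le_rfl (key1.trans (le_of_eq ?_)))
    (mul_le_mul' le_rfl (key2.trans (le_of_eq ?_)))
  · rw [← ENNReal.ofReal_sum_of_nonneg fun t _ => by positivity,
      ← ENNReal.ofReal_mul (by positivity), ← ENNReal.ofReal_pow (by positivity),
      show (36 : ℝ≥0∞) = ENNReal.ofReal 36 by simp, ← ENNReal.ofReal_mul (by positivity),
      ← ENNReal.ofReal_mul (by positivity)]
  · have hnn : ∀ t s : ℕ, ‖K (((t : ℝ) - s) / B) - blockCoef K B ℓ q p (t / ℓ) (s / ℓ)‖ₑ ^ 2 =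
        ENNReal.ofReal
          ((K (((t : ℝ) - s) / B) - blockCoef K B ℓ q p (t / ℓ) (s / ℓ)) ^ 2) := fun t s => by
      rw [← ofReal_norm, ← ENNReal.ofReal_pow (norm_nonneg _), Real.norm_eq_abs, sq_abs]
    have hrow : ∀ t ∈ Finset.range T, ∑ s ∈ Finset.range T,
        ‖K (((t : ℝ) - s) / B) - blockCoef K B ℓ q p (t / ℓ) (s / ℓ)‖ₑ ^ 2 =
        ENNReal.ofReal (∑ s ∈ Finset.range T,
          (K (((t : ℝ) - s) / B) - blockCoef K B ℓ q p (t / ℓ) (s / ℓ)) ^ 2) := fun t _ => by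
      rw [ENNReal.ofReal_sum_of_nonneg fun s _ => sq_nonneg _]
      exact Finset.sum_congr rfl fun s _ => hnn t s
    rw [Finset.sum_congr rfl hrow, ← ENNReal.ofReal_sum_of_nonneg fun t _ =>
      Finset.sum_nonneg fun s _ => sq_nonneg _, ← ENNReal.ofReal_pow (by positivity),
      show (36 : ℝ≥0∞) = ENNReal.ofReal 36 by simp, ← ENNReal.ofReal_mul (by positivity),
      ← ENNReal.ofReal_mul (by positivity)]

end CubicDecay

end KernelForm

/-! ### Negligible errors and the limit of the block form. -/

section Limits

variable {E : ℕ → Type*} [∀ n, MeasurableSpace (E n)] {μ : ∀ n, Measure (E n)}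
  [∀ n, IsProbabilityMeasure (μ n)] {f : ∀ n, (ℕ → E n) → ℝ} {C : ℝ} {K : ℝ → ℝ}
  {B : ℕ → ℝ} {T ℓ q p : ℕ → ℕ}

/-- Both errors are `o(T B)` in variance: the projection costs `O(B)` per row times influences
summing to `o(T)`, and the change of coefficients costs their squared distance, which is `o(T B)`.
-/
theorem tendsto_eLpNorm_kernelForm_sub_blockForm (h : ∀ n, CubicDecay (μ n) (f n) C)
    (hK : IsKernel K) (hS : BlockScales B T ℓ q p) :
    Tendsto (fun n => eLpNorm (fun x => (√(T n * B n))⁻¹ *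
      ((kernelForm (f n) K (B n) (T n) x -
        ∫ y, kernelForm (f n) K (B n) (T n) y ∂(iidLaw ℤ (μ n))) -
      blockForm (μ n) (f n) K (B n) (T n) (ℓ n) (q n) (p n) x)) 2 (iidLaw ℤ (μ n)))
      atTop (𝓝 0) := by
  have hC := (h 0).nonneg
  obtain ⟨M, hM0, hM⟩ := hK.exists_bound
  have hfl : Tendsto (fun n => (2 * (⌊B n⌋₊ : ℝ) + 1) / B n) atTop (𝓝 (2 * 1 + 0)) := by
    have h1 := (tendsto_nat_floor_div_atTop (R := ℝ)).comp hS.tendsto_B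
    have := (h1.const_mul 2).add (hS.tendsto_B.const_div_atTop 1)
    refine this.congr fun n => ?_
    simp only [Function.comp_apply]
    ring
  have hmod := hS.tendsto_sum_mod (f := fun i => 6 * C / ((i : ℝ) + 1))
    (fun i => by positivity)
    ((tendsto_natCast_atTop_atTop.atTop_add tendsto_const_nhds).const_div_atTop _)
  have hlim := (((hfl.mul_const (M ^ 2)).mul hmod).const_mul (2 * (36 * (4 * C) ^ 3))).add
    ((hS.tendsto_sum_sq_coef_sub hK).const_mul (2 * (36 * (2 * C) ^ 4)))
  simp only [mul_zero, add_zero] at hlim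
  have hlim2 := ENNReal.tendsto_ofReal ((Real.continuous_sqrt.tendsto _).comp hlim)
  rw [Real.sqrt_zero, ENNReal.ofReal_zero] at hlim2
  refine tendsto_of_tendsto_of_tendsto_of_le_of_le' tendsto_const_nhds hlim2
    (Eventually.of_forall fun _ => zero_le) ?_
  filter_upwards [hS.tendsto_B.eventually_gt_atTop 0, hS.tendsto_T.eventually_gt_atTop 0,
    hS.q_pos, hS.tendsto_ℓ.eventually_gt_atTop 0] with n hB hT hq hℓ
  have hT' : (0 : ℝ) < T n := by exact_mod_cast hT
  have hTB : 0 < T n * B n := mul_pos hT' hB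
  have key := (h n).eLpNorm_kernelForm_sub_blockForm_sq_le hK hM hB hℓ hq (hS.mul_le n)
  rw [← ENNReal.pow_right_strictMono (n := 2) (by norm_num) |>.le_iff_le]
  have hconst := eLpNorm_const_smul (√(T n * B n))⁻¹ (fun x => (kernelForm (f n) K (B n) (T n) x -
    ∫ y, kernelForm (f n) K (B n) (T n) y ∂(iidLaw ℤ (μ n))) -
    blockForm (μ n) (f n) K (B n) (T n) (ℓ n) (q n) (p n) x) 2 (iidLaw ℤ (μ n))
  refine le_trans (le_of_eq ((congrArg (· ^ 2) hconst).trans (mul_pow _ _ _)))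
    ((mul_le_mul' le_rfl key).trans (le_of_eq ?_))
  simp only [Function.comp_apply]
  rw [← ofReal_norm, ← ENNReal.ofReal_pow (norm_nonneg _), ← ENNReal.ofReal_mul (by positivity),
    ← ENNReal.ofReal_pow (Real.sqrt_nonneg _), norm_inv, inv_pow,
    Real.norm_of_nonneg (Real.sqrt_nonneg _), Real.sq_sqrt hTB.le,
    Real.sq_sqrt (by positivity)]
  congr 1
  field_simp

/-- Lyapunov for `p` i.i.d. group forms. With `S` the sum of squared block coefficients and `v` the
variance of a block sum, the total variance is `2 (S / (T B)) (v / ℓ)²`, and the sum of fourth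
moments is `O(1 / p)`. -/
theorem tendsto_charFun_blockForm (h : ∀ n, CubicDecay (μ n) (f n) C)
    (hK : IsKernel K) (hS : BlockScales B T ℓ q p) {σ2 : ℝ}
    (hσ : Tendsto (fun n => (∑ t ∈ Finset.range (T n), ∑ s ∈ Finset.range (T n),
      autocov (μ n) (f n) ((t : ℤ) - s) * K (((t : ℝ) - s) / B n)) / T n) atTop (𝓝 σ2)) (t : ℝ) :
    Tendsto (fun n => charFun ((iidLaw ℤ (μ n)).map fun x => (√(T n * B n))⁻¹ *
      blockForm (μ n) (f n) K (B n) (T n) (ℓ n) (q n) (p n) x) t) atTop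
      (𝓝 (Complex.exp (-(2 * (∫ u in (-1 : ℝ)..1, K u ^ 2) * σ2 ^ 2 * t ^ 2 / 2 : ℝ)))) := by
  have hC := (h 0).nonneg
  have := fun n => (h n).isProbabilityMeasure_blockLaw (ℓ := ℓ n)
  let ρ₀ : ℕ → Measure ℝ := fun n => groupLaw (blockLaw (μ n) (f n) (ℓ n)) K (B n) (ℓ n) (q n)
  let c : ℕ → ℝ := fun n => (√(T n * B n))⁻¹
  let ρ : ℕ → Measure ℝ := fun n => (ρ₀ n).map fun x => c n * x
  have hρ : ∀ n, IsProbabilityMeasure (ρ n) := fun n =>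
    Measure.isProbabilityMeasure_map (by fun_prop)
  have hmom := fun n => groupLaw_moments (K := K) (B := B n) (ℓ := ℓ n) (q := q n)
    ((h n).memLp_blockLaw (ℓ := ℓ n)) (h n).integral_blockLaw
  have hint : ∀ n k, ∫ x, x ^ k ∂(ρ n) = c n ^ k * ∫ x, x ^ k ∂(ρ₀ n) := fun n k => by
    rw [integral_map (by fun_prop) (by fun_prop), ← integral_const_mul]
    simp_rw [mul_pow]
  have hSlim := hS.tendsto_sum_sq_blockCoef hK
  set S : ℕ → ℝ := fun n => ∑ t ∈ Finset.range (T n), ∑ s ∈ Finset.range (T n),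
    blockCoef K (B n) (ℓ n) (q n) (p n) (t / ℓ n) (s / ℓ n) ^ 2 with hSdef
  have hvar := tendsto_integral_sq_blockSum h hK hS.tendsto_B hS.tendsto_T hS.tendsto_ℓ hσ
  have hev : ∀ᶠ n in atTop, 0 < B n ∧ 0 < T n ∧ 0 < q n ∧ 0 < ℓ n ∧ 0 < p n := by
    filter_upwards [hS.tendsto_B.eventually_gt_atTop 0, hS.tendsto_T.eventually_gt_atTop 0,
      hS.q_pos, hS.tendsto_ℓ.eventually_gt_atTop 0, hS.tendsto_p.eventually_gt_atTop 0]
      with n h1 h2 h3 h4 h5 using ⟨h1, h2, h3, h4, h5⟩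
  have hmain := tendsto_charFun_pow (ρ := ρ) (p := p)
    (V := 2 * (∫ u in (-1 : ℝ)..1, K u ^ 2) * σ2 ^ 2)
    (fun n => by
      rw [memLp_map_measure_iff (by fun_prop) (by fun_prop)]
      exact (hmom n).1.const_mul (c n))
    (fun n => by
      have := hint n 1
      simp only [pow_one] at this
      rw [this, (hmom n).2.1, mul_zero])
    (by
      have h1 := ((hSlim.const_mul 2).mul (hvar.pow 2))
      refine h1.congr' ?_
      filter_upwards [hev] with n ⟨hB, hT, hq, hℓ, hp⟩
      have hT' : (0 : ℝ) < T n := by exact_mod_cast hT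
      have hℓ' : (0 : ℝ) < ℓ n := by exact_mod_cast hℓ
      have hTB : 0 < T n * B n := mul_pos hT' hB
      have hid := hK.sum_sq_blockCoef_eq (B := B n) hℓ hq (hS.mul_le n)
      rw [hint, (hmom n).2.2.1, (h n).integral_sq_blockLaw]
      simp only [c]
      rw [inv_pow, Real.sq_sqrt hTB.le]
      set v := ∫ x, blockSum (μ n) (f n) (ℓ n) 0 x ^ 2 ∂(iidLaw ℤ (μ n))
      calc 2 * (S n / (T n * B n)) * (v / ℓ n) ^ 2
          = (T n * B n)⁻¹ * (v ^ 2 * (2 * S n / (ℓ n : ℝ) ^ 2)) := by field_simp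
        _ = _ := by rw [hid]; field_simp)
    (by
      have hpinv : Tendsto (fun n => (1 : ℝ) / p n) atTop (𝓝 0) :=
        (tendsto_natCast_atTop_atTop.comp hS.tendsto_p).const_div_atTop 1
      -- `16` comes from the fourth moment of a group form, `36 C²` from that of a block sum, and
      -- `2` from expressing the group coefficients by `S`.
      have h1 := ((hSlim.pow 2).const_mul ((16 * (36 * C ^ 2) ^ 2 * 2) ^ 2)).mul hpinv
      rw [mul_zero] at h1
      refine squeeze_zero' (Eventually.of_forall fun n => mul_nonneg (Nat.cast_nonneg _)
        (integral_nonneg fun x => Even.pow_nonneg (by decide) x)) ?_ h1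
      filter_upwards [hev] with n ⟨hB, hT, hq, hℓ, hp⟩
      have hT' : (0 : ℝ) < T n := by exact_mod_cast hT
      have hℓ' : (0 : ℝ) < ℓ n := by exact_mod_cast hℓ
      have hp' : (0 : ℝ) < p n := by exact_mod_cast hp
      have hTB : 0 < T n * B n := mul_pos hT' hB
      have hid := hK.sum_sq_blockCoef_eq (B := B n) hℓ hq (hS.mul_le n)
      rw [hint]
      set W := ∑ i ∈ Finset.range (q n), ∑ j ∈ Finset.range i,
        (2 * groupCoef K (B n) (ℓ n) i j) ^ 2
      have hW : 0 ≤ W := Finset.sum_nonneg fun _ _ => Finset.sum_nonneg fun _ _ => sq_nonneg _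
      have hW' : W = 2 * S n / (p n * (ℓ n : ℝ) ^ 2) := by
        rw [eq_div_iff (by positivity), hid]; ring
      have hc4 : c n ^ 4 = ((T n * B n) ^ 2)⁻¹ := by
        simp only [c]
        rw [inv_pow, show 4 = 2 * 2 by norm_num, pow_mul, Real.sq_sqrt hTB.le]
      calc p n * (c n ^ 4 * ∫ x, x ^ 4 ∂(ρ₀ n))
          ≤ p n * (c n ^ 4 * (16 * (36 * C ^ 2 * ℓ n) ^ 2 * W) ^ 2) := by
            gcongr
            refine ((hmom n).2.2.2).trans ?_
            have h0 : 0 ≤ ∫ x, x ^ 4 ∂(blockLaw (μ n) (f n) (ℓ n)) :=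
              integral_nonneg fun x => Even.pow_nonneg (by decide) x
            gcongr
            exact (h n).integral_pow_four_blockLaw_le
        _ = _ := by
            rw [hc4, hW']
            field_simp
            simp only [hSdef])
    t
  refine hmain.congr' ?_
  filter_upwards [hev] with n ⟨hB, hT, hq, hℓ, hp⟩
  rw [charFun_map_mul_comp ((h n).measurable_blockForm K _ _ _ _ _).aemeasurable,
    (h n).charFun_map_blockForm hK hℓ hq (hS.mul_le n)]
  congr 1
  exact charFun_map_mul (c n) t

end Limits

/-! ### Reduction of the panel to a scalar causal process. -/

section Panel

variable {Ω : Type*} [MeasurableSpace Ω] {P : Measure Ω} [IsProbabilityMeasure P]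

/-- The shifted innovation path. -/
def path {Ω E : Type*} (e : ℤ → Ω → E) (s : ℤ) (ω : Ω) : ℤ → E := fun i => e (i + s) ω

/-- The scalar process `⟨w, ε_t⟩` as a functional of the past. -/
def project {E : Type*} {N : ℕ} (g : (ℕ → E) → EuclideanSpace ℝ (Fin N))
    (w : EuclideanSpace ℝ (Fin N)) (z : ℕ → E) : ℝ := inner ℝ w (g z)

section Project

variable {E : Type*} [MeasurableSpace E] {e : ℤ → Ω → E}

theorem measurePreserving_path (hm : ∀ t, Measurable (e t)) (hi : iIndepFun e P)
    (hd : ∀ t, IdentDistrib (e t) (e 0) P P) (s : ℤ) :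
    MeasurePreserving (path e s) P (iidLaw ℤ (P.map (e 0))) := by
  have h1 := (iIndepFun_iff_map_fun_eq_infinitePi_map (fun i => hm (i + s))).1
    (hi.precomp (add_left_injective s))
  refine ⟨measurable_pi_lambda _ fun i => hm _, ?_⟩
  have h2 : ∀ i, P.map (e (i + s)) = P.map (e 0) := fun i => (hd _).map_eq
  simp only [h2] at h1
  exact h1

variable {N : ℕ} {g : (ℕ → E) → EuclideanSpace ℝ (Fin N)}

theorem causal_project_path {Ω E : Type*} {e : ℤ → Ω → E}
    {g : (ℕ → E) → EuclideanSpace ℝ (Fin N)} (w : EuclideanSpace ℝ (Fin N)) (s t : ℤ) (ω : Ω) :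
    causal (project g w) t (path e s ω) = inner ℝ w (err e g (t + s) ω) := by
  unfold causal project err past path
  congr 3
  ext k
  congr 1
  ring

/-- Resampling the innovation at time `0` is the coupling defining the dependence measure, seen on
the product space: coordinate `m` of the past at time `m` is the innovation at time `0`. -/
theorem infl_project_eq (hm : ∀ t, Measurable (e t)) (hi : iIndepFun e P)
    (hd : ∀ t, IdentDistrib (e t) (e 0) P P) (hg : Measurable g)
    (w : EuclideanSpace ℝ (Fin N)) (m : ℕ) :
    infl (P.map (e 0)) 4 {0} (causal (project g w) m) =
      eLpNorm (fun p : Ω × Ω => inner ℝ w (err e g m p.1) - inner ℝ w (errCoupled e g m p))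
        4 (P.prod P) := by
  have : IsProbabilityMeasure (P.map (e 0)) :=
    Measure.isProbabilityMeasure_map (hm 0).aemeasurable
  have hpath := measurePreserving_path hm hi hd 0
  have hf : Measurable (project g w) := by unfold project; fun_prop
  have hmeas : Measurable fun q : (ℤ → E) × (ℤ → E) =>
      causal (project g w) m q.1 - causal (project g w) m (resample {0} q) :=
    ((measurable_causal hf m).comp measurable_fst).sub
      ((measurable_causal hf m).comp (measurable_resample _))
  rw [infl, ← eLpNorm_comp_measurePreserving hmeas.aestronglyMeasurable (hpath.prod hpath)]
  congr 1
  ext p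
  simp only [Function.comp_apply, Prod.map]
  rw [causal_project_path, add_zero]
  congr 1
  unfold causal project errCoupled
  congr 2
  ext k
  by_cases hk : k = m
  · subst hk
    simp [resample, path]
  · have : (m : ℤ) - k ≠ 0 := by omega
    simp [resample, path, past, hk, this]

/-- Homogeneity extends the bound from unit vectors to `‖w‖ ≤ 1`, and `(m + 1)^{-α} ≤ (m + 1)⁻³`.
The maximum with zero supplies the nonnegativity required of the constant. -/
theorem cubicDecay_project (hm : ∀ t, Measurable (e t)) (hi : iIndepFun e P)
    (hd : ∀ t, IdentDistrib (e t) (e 0) P P) (hg : Measurable g)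
    (h2 : ∀ t i, MemLp (fun ω => err e g t ω i) 2 P)
    (h0 : ∀ t i, ∫ ω, err e g t ω i ∂P = 0) {α C : ℝ} (hα : 3 < α)
    (hdep : ∀ m : ℕ, dependence P e g m ≤ ENNReal.ofReal (C * ((m : ℝ) + 1) ^ (-α)))
    {w : EuclideanSpace ℝ (Fin N)} (hw : ‖w‖ ≤ 1) :
    CubicDecay (P.map (e 0)) (project g w) (max C 0) := by
  have hf : Measurable (project g w) := by unfold project; fun_prop
  have hpath := measurePreserving_path hm hi hd 0
  have hinner : ∀ ω, causal (project g w) 0 (path e 0 ω) = ∑ i, w i * err e g 0 ω i := fun ω => by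
    rw [causal_project_path, add_zero, PiLp.inner_apply]
    exact Finset.sum_congr rfl fun i _ => by simp [mul_comm]
  refine ⟨le_max_right _ _, hf, ?_, ?_, fun m => ?_⟩
  · rw [← hpath.map_eq, memLp_map_measure_iff
      (measurable_causal hf 0).aestronglyMeasurable hpath.measurable.aemeasurable]
    refine (memLp_finsetSum Finset.univ fun i _ => (h2 0 i).const_mul (w i)).ae_eq
      (Eventually.of_forall fun ω => ?_)
    exact (hinner ω).symm
  · rw [← integral_comp_measurePreserving hpath (measurable_causal hf 0).aestronglyMeasurable]
    simp_rw [hinner]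
    rw [integral_finsetSum _ fun i _ => ((h2 0 i).integrable (by norm_num)).const_mul (w i)]
    exact Finset.sum_eq_zero fun i _ => by rw [integral_const_mul, h0, mul_zero]
  · rw [infl_project_eq hm hi hd hg]
    have hbase : (1 : ℝ) ≤ (m : ℝ) + 1 := by
      have : (0 : ℝ) ≤ m := Nat.cast_nonneg m
      linarith
    have hbound : ENNReal.ofReal (C * ((m : ℝ) + 1) ^ (-α)) ≤
        ENNReal.ofReal (max C 0 / ((m : ℝ) + 1) ^ 3) := by
      refine ENNReal.ofReal_le_ofReal ?_
      rw [div_eq_mul_inv]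
      refine mul_le_mul (le_max_left _ _) ?_ (by positivity) (le_max_right _ _)
      calc ((m : ℝ) + 1) ^ (-α) ≤ ((m : ℝ) + 1) ^ (-(3 : ℕ) : ℝ) :=
            Real.rpow_le_rpow_of_exponent_le hbase (by push_cast; linarith)
        _ = _ := by rw [Real.rpow_neg (by positivity), Real.rpow_natCast]
    refine le_trans ?_ hbound
    by_cases hw0 : w = 0
    · subst hw0
      simp
    have hnw : ‖w‖ ≠ 0 := norm_ne_zero_iff.2 hw0
    set v : EuclideanSpace ℝ (Fin N) := ‖w‖⁻¹ • w with hv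
    have hv1 : ‖v‖ = 1 := by rw [hv, norm_smul, norm_inv, norm_norm, inv_mul_cancel₀ hnw]
    have hwv : w = ‖w‖ • v := by rw [hv, smul_smul, mul_inv_cancel₀ hnw, one_smul]
    have hfun : (fun p : Ω × Ω => inner ℝ w (err e g m p.1) - inner ℝ w (errCoupled e g m p)) =
        ‖w‖ • fun p : Ω × Ω => inner ℝ v (err e g m p.1) - inner ℝ v (errCoupled e g m p) := by
      ext p
      rw [Pi.smul_apply, smul_eq_mul, mul_sub, ← real_inner_smul_left, ← real_inner_smul_left,
        ← hwv]
    rw [hfun, eLpNorm_const_smul]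
    refine le_trans (mul_le_of_le_one_left' ?_) (le_trans ?_ (hdep m))
    · rw [← ofReal_norm, norm_norm]
      exact ENNReal.ofReal_le_one.2 hw
    · exact le_iSup₂_of_le (f := fun (v : EuclideanSpace ℝ (Fin N)) (_ : ‖v‖ = 1) =>
        eLpNorm (fun p : Ω × Ω => inner ℝ v (err e g m p.1) - inner ℝ v (errCoupled e g m p))
        4 (P.prod P)) v hv1 le_rfl

end Project

section Weights

variable {N r : ℕ}

/-- The cross-sectional weights `N^{-1/2} (1 - a_i)`. -/
def weight (Λ : Matrix (Fin N) (Fin r) ℝ) : EuclideanSpace ℝ (Fin N) :=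
  WithLp.toLp 2 fun i => 1 / √(N : ℝ) * (1 - aCoef Λ i)

/-- The vector `a` is the orthogonal projection of the vector of ones on the column space of `Λ`.
Hence `∑ a_i = ∑ a_i²`, and the left side equals `N - ∑ a_i²`. -/
theorem sum_one_sub_aCoef_sq_le {Λ : Matrix (Fin N) (Fin r) ℝ}
    (hΛ : IsUnit (loadingGram Λ).det) : ∑ i, (1 - aCoef Λ i) ^ 2 ≤ (N : ℝ) := by
  rcases Nat.eq_zero_or_pos N with h0 | hN
  · subst h0; simp
  have hN' : (N : ℝ) ≠ 0 := by positivity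
  set b := (loadingGram Λ)⁻¹.mulVec (meanLoading Λ) with hb
  have ha : ∀ i, aCoef Λ i = Λ.mulVec b i := fun i => rfl
  have hGb : (loadingGram Λ).mulVec b = meanLoading Λ := by
    rw [hb, Matrix.mulVec_mulVec, Matrix.mul_nonsing_inv _ hΛ, Matrix.one_mulVec]
  have hsum : ∑ i, aCoef Λ i = N * (meanLoading Λ ⬝ᵥ b) := by
    rw [meanLoading, smul_dotProduct, smul_eq_mul, one_div, mul_inv_cancel_left₀ hN',
      sum_dotProduct Finset.univ (fun i => Λ i) b]
    rfl
  have hsq : ∑ i, aCoef Λ i ^ 2 = N * (meanLoading Λ ⬝ᵥ b) := by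
    have h1 : ∑ i, aCoef Λ i ^ 2 = Λ.mulVec b ⬝ᵥ Λ.mulVec b :=
      Finset.sum_congr rfl fun i _ => by rw [sq, ha]
    rw [h1, Matrix.dotProduct_mulVec, ← Matrix.mulVec_transpose, Matrix.mulVec_mulVec, ← hGb,
      loadingGram, Matrix.smul_mulVec, smul_dotProduct, smul_eq_mul, one_div,
      mul_inv_cancel_left₀ hN']
  have h2 : ∑ i, (1 - aCoef Λ i) ^ 2 = N - 2 * ∑ i, aCoef Λ i + ∑ i, aCoef Λ i ^ 2 := by
    have h3 : (N : ℝ) = ∑ _i : Fin N, (1 : ℝ) := by simp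
    rw [h3]
    rw [Finset.mul_sum, ← Finset.sum_sub_distrib, ← Finset.sum_add_distrib]
    exact Finset.sum_congr rfl fun i _ => by ring
  have h3 : 0 ≤ ∑ i, aCoef Λ i ^ 2 := Finset.sum_nonneg fun _ _ => sq_nonneg _
  rw [h2, hsum, hsq]
  rw [hsq] at h3
  linarith

theorem norm_weight_le_one {Λ : Matrix (Fin N) (Fin r) ℝ}
    (hΛ : IsUnit (loadingGram Λ).det) : ‖weight Λ‖ ≤ 1 := by
  rw [EuclideanSpace.norm_eq, Real.sqrt_le_one]
  have h1 : ∀ i, ‖weight Λ i‖ ^ 2 = 1 / N * (1 - aCoef Λ i) ^ 2 := fun i => by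
    rw [Real.norm_eq_abs, sq_abs]
    simp only [weight]
    rw [mul_pow, div_pow, one_pow, Real.sq_sqrt (Nat.cast_nonneg _)]
  simp_rw [h1]
  rw [← Finset.mul_sum, one_div, ← div_eq_inv_mul]
  exact div_le_one_of_le₀ (sum_one_sub_aCoef_sq_le hΛ) (Nat.cast_nonneg _)

theorem errBar_eq_inner {Ω E : Type*} (e : ℤ → Ω → E) (g : (ℕ → E) → EuclideanSpace ℝ (Fin N))
    (Λ : Matrix (Fin N) (Fin r) ℝ) (t : ℤ) (ω : Ω) :
    errBar e g Λ t ω = inner ℝ (weight Λ) (err e g t ω) := by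
  rw [PiLp.inner_apply, errBar, Finset.mul_sum]
  refine Finset.sum_congr rfl fun i _ => ?_
  simp [weight]
  ring

theorem sum_Icc_eq_sum_range {M : Type*} [AddCommMonoid M] (T : ℕ) (F : ℕ → M) :
    ∑ t ∈ Finset.Icc 1 T, F t = ∑ t ∈ Finset.range T, F (t + 1) := by
  rw [← Finset.Ico_add_one_right_eq_Icc, Finset.sum_Ico_eq_sum_range, Nat.add_sub_cancel]
  exact Finset.sum_congr rfl fun t _ => by rw [add_comm]

theorem sum_comm_pairs {M ι κ : Type*} [AddCommMonoid M] (s : Finset ι) (u : Finset κ)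
    (F : ι → ι → κ → κ → M) :
    ∑ i ∈ s, ∑ j ∈ s, ∑ a ∈ u, ∑ b ∈ u, F i j a b =
      ∑ a ∈ u, ∑ b ∈ u, ∑ i ∈ s, ∑ j ∈ s, F i j a b := by
  rw [Finset.sum_congr rfl fun i _ => Finset.sum_comm, Finset.sum_comm]
  refine Finset.sum_congr rfl fun a _ => ?_
  rw [Finset.sum_congr rfl fun i _ => Finset.sum_comm, Finset.sum_comm]

theorem quadForm_eq_kernelForm {Ω E : Type*} (e : ℤ → Ω → E)
    (g : (ℕ → E) → EuclideanSpace ℝ (Fin N)) (Λ : Matrix (Fin N) (Fin r) ℝ) (K : ℝ → ℝ) (T : ℕ)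
    (h : ℝ) (ω : Ω) :
    quadForm e g Λ K T h ω =
      1 / T * kernelForm (project g (weight Λ)) K (T * h) T (path e 1 ω) := by
  have h1 : ∀ t s : ℕ, errBar e g Λ t ω * errBar e g Λ s ω *
      K (((t : ℝ) - s) / (T * h)) = 1 / N * ∑ i, ∑ j, (1 - aCoef Λ i) * (1 - aCoef Λ j) *
        err e g t ω i * err e g s ω j * K (((t : ℝ) - s) / (T * h)) := fun t s => by
    have hN : 1 / √(N : ℝ) * (1 / √(N : ℝ)) = 1 / N := by
      rw [div_mul_div_comm, one_mul, Real.mul_self_sqrt (Nat.cast_nonneg _)]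
    rw [errBar, errBar, mul_mul_mul_comm, hN, Finset.sum_mul_sum, mul_assoc, Finset.sum_mul]
    congr 1
    refine Finset.sum_congr rfl fun i _ => ?_
    rw [Finset.sum_mul]
    exact Finset.sum_congr rfl fun j _ => by ring
  have h2 : kernelForm (project g (weight Λ)) K (T * h) T (path e 1 ω) =
      ∑ t ∈ Finset.Icc 1 T, ∑ s ∈ Finset.Icc 1 T, errBar e g Λ t ω * errBar e g Λ s ω *
        K (((t : ℝ) - s) / (T * h)) := by
    rw [sum_Icc_eq_sum_range, kernelForm]
    refine Finset.sum_congr rfl fun t _ => ?_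
    rw [sum_Icc_eq_sum_range]
    refine Finset.sum_congr rfl fun s _ => ?_
    rw [causal_project_path, causal_project_path, errBar_eq_inner, errBar_eq_inner, mul_comm]
    push_cast
    rw [add_sub_add_right_eq_sub]
  rw [h2, quadForm]
  simp_rw [h1]
  rw [sum_comm_pairs]
  simp_rw [← Finset.mul_sum]
  rw [← mul_assoc, one_div_mul_one_div]

theorem kernelVariance_eq {Ω E : Type*} [MeasurableSpace Ω] [MeasurableSpace E] {P : Measure Ω}
    [IsProbabilityMeasure P] {e : ℤ → Ω → E} {g : (ℕ → E) → EuclideanSpace ℝ (Fin N)}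
    (hm : ∀ t, Measurable (e t)) (hi : iIndepFun e P) (hd : ∀ t, IdentDistrib (e t) (e 0) P P)
    {C : ℝ} {Λ : Matrix (Fin N) (Fin r) ℝ}
    (hC : CubicDecay (P.map (e 0)) (project g (weight Λ)) C) (K : ℝ → ℝ) (T : ℕ) (h : ℝ) :
    kernelVariance P e g Λ K T h =
      (∑ t ∈ Finset.range T, ∑ s ∈ Finset.range T,
        autocov (P.map (e 0)) (project g (weight Λ)) ((t : ℤ) - s) *
          K (((t : ℝ) - s) / (T * h))) / T := by
  have : IsProbabilityMeasure (P.map (e 0)) :=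
    Measure.isProbabilityMeasure_map (hm 0).aemeasurable
  have hcov : ∀ t s : ℕ, ∫ ω, errBar e g Λ (t + 1 : ℕ) ω * errBar e g Λ (s + 1 : ℕ) ω ∂P =
      autocov (P.map (e 0)) (project g (weight Λ)) ((t : ℤ) - s) := fun t s => by
    rw [← hC.autocov_neg, neg_sub, ← hC.integral_mul_eq_autocov,
      ← integral_comp_measurePreserving (measurePreserving_path hm hi hd 1)
        (g := fun x => causal (project g (weight Λ)) t x * causal (project g (weight Λ)) s x)
        ((measurable_causal hC.measurable t).mul
          (measurable_causal hC.measurable s)).aestronglyMeasurable]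
    congr 1
    ext ω
    rw [causal_project_path, causal_project_path, errBar_eq_inner, errBar_eq_inner]
    push_cast
    rfl
  rw [kernelVariance, one_div, ← div_eq_inv_mul, sum_Icc_eq_sum_range]
  congr 1
  refine Finset.sum_congr rfl fun t _ => ?_
  rw [sum_Icc_eq_sum_range]
  refine Finset.sum_congr rfl fun s _ => ?_
  rw [hcov]
  push_cast
  rw [add_sub_add_right_eq_sub]

end Weights

end Panel

end PanelCLT

end

theorem lemmaA6 {Ω : Type*} [MeasurableSpace Ω] (P : Measure Ω) [IsProbabilityMeasure P]
    {E : ℕ → Type*} [∀ N, MeasurableSpace (E N)]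
    (e : ∀ N, ℤ → Ω → E N) (g : ∀ N, (ℕ → E N) → EuclideanSpace ℝ (Fin N))
    {r : ℕ} (Λ : ∀ N, Matrix (Fin N) (Fin r) ℝ)
    (K : ℝ → ℝ) (N T : ℕ → ℕ) (h : ℕ → ℝ) (σ2 : ℝ)
    (hK : PanelCLT.IsKernel K)
    (hh : PanelCLT.IsBandwidth N T h)
    (hε : PanelCLT.IsErrorPanel P e g)
    (hΛ : ∀ᶠ M in atTop, IsUnit (PanelCLT.loadingGram (Λ M)).det)
    (hσ : Tendsto (fun n => PanelCLT.kernelVariance P (e (N n)) (g (N n)) (Λ (N n)) K (T n) (h n))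
      atTop (𝓝 σ2)) :
    TendstoInDistribution
      (fun n ω => √(1 / h n) *
        (PanelCLT.quadForm (e (N n)) (g (N n)) (Λ (N n)) K (T n) (h n) ω -
          ∫ ω', PanelCLT.quadForm (e (N n)) (g (N n)) (Λ (N n)) K (T n) (h n) ω' ∂P))
      atTop (id : ℝ → ℝ) (fun _ => P)
      (gaussianReal 0 (Real.toNNReal (2 * (∫ u in (-1 : ℝ)..1, K u ^ 2) * σ2 ^ 2))) := by
  classical
  obtain ⟨α, C, hα, hdep⟩ := hε.dependence_decay
  -- The value `0` where the Gram matrix is singular makes the norm bound hold for every `n`; this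
  -- affects only finitely many `n`.
  let w : ∀ n, EuclideanSpace ℝ (Fin (N n)) := fun n =>
    if IsUnit (PanelCLT.loadingGram (Λ (N n))).det then PanelCLT.weight (Λ (N n)) else 0
  have hw : ∀ n, ‖w n‖ ≤ 1 := fun n => by
    simp only [w]
    split_ifs with hu
    · exact PanelCLT.norm_weight_le_one hu
    · simp
  have hgood : ∀ᶠ n in atTop, w n = PanelCLT.weight (Λ (N n)) := by
    filter_upwards [hh.tendsto_N.eventually hΛ] with n hn using if_pos hn
  have hμ : ∀ n, IsProbabilityMeasure (P.map (e (N n) 0)) := fun n =>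
    Measure.isProbabilityMeasure_map (hε.measurable_e (N n) 0).aemeasurable
  have hC : ∀ n, PanelCLT.CubicDecay (P.map (e (N n) 0)) (PanelCLT.project (g (N n)) (w n))
      (max C 0) := fun n =>
    PanelCLT.cubicDecay_project (hε.measurable_e _) (hε.indep _) (hε.identDistrib _)
      (hε.measurable_g _) (hε.memLp_two _) (hε.mean_zero _) hα (hdep (N n)) (hw n)
  -- The shift by `1` matches times `1, …, T` of the statistic with `0, …, T - 1` of the kernel
  -- form.
  have hpath : ∀ n, MeasurePreserving (PanelCLT.path (e (N n)) 1) P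
      (PanelCLT.iidLaw ℤ (P.map (e (N n) 0))) := fun n =>
    PanelCLT.measurePreserving_path (hε.measurable_e _) (hε.indep _) (hε.identDistrib _) 1
  have hTpos := hh.tendsto_T.eventually_gt_atTop 0
  have hhpos : ∀ᶠ n in atTop, 0 < h n := by
    filter_upwards [hh.tendsto_Th.eventually_gt_atTop 0] with n hn
    exact pos_of_mul_pos_right hn (Nat.cast_nonneg _)
  obtain ⟨ℓ, q, p, hS⟩ := PanelCLT.exists_blockScales hh.tendsto_Th hh.tendsto_T (by
    refine hh.tendsto_h.congr' ?_
    filter_upwards [hTpos] with n hn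
    have : (T n : ℝ) ≠ 0 := by positivity
    rw [mul_div_cancel_left₀ _ this])
  have hσ' : Tendsto (fun n => (∑ t ∈ Finset.range (T n), ∑ s ∈ Finset.range (T n),
      PanelCLT.autocov (P.map (e (N n) 0)) (PanelCLT.project (g (N n)) (w n)) ((t : ℤ) - s) *
        K (((t : ℝ) - s) / (T n * h n))) / T n) atTop (𝓝 σ2) := by
    refine hσ.congr' ?_
    filter_upwards [hgood] with n hn
    rw [hn]
    exact PanelCLT.kernelVariance_eq (hε.measurable_e _) (hε.indep _) (hε.identDistrib _)
      (hn ▸ hC n) K (T n) (h n)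
  let X : ℕ → Ω → ℝ := fun n ω => (√(T n * (T n * h n)))⁻¹ *
    PanelCLT.blockForm (P.map (e (N n) 0)) (PanelCLT.project (g (N n)) (w n)) K (T n * h n)
      (T n) (ℓ n) (q n) (p n) (PanelCLT.path (e (N n)) 1 ω)
  have hXm : ∀ n, Measurable (X n) := fun n =>
    (((hC n).measurable_blockForm K _ _ _ _ _).comp (hpath n).measurable).const_mul _
  have hquad : ∀ n, Measurable
      (PanelCLT.quadForm (e (N n)) (g (N n)) (Λ (N n)) K (T n) (h n)) := fun n => by
    have h1 : ∀ t : ℤ, Measurable (PanelCLT.err (e (N n)) (g (N n)) t) := fun t =>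
      (hε.measurable_g _).comp (measurable_pi_lambda _ fun k => hε.measurable_e _ _)
    unfold PanelCLT.quadForm
    fun_prop
  have hXlim : TendstoInDistribution X atTop (id : ℝ → ℝ) (fun _ => P)
      (gaussianReal 0 (Real.toNNReal (2 * (∫ u in (-1 : ℝ)..1, K u ^ 2) * σ2 ^ 2))) := by
    refine ⟨fun n => (hXm n).aemeasurable, aemeasurable_id, ?_⟩
    refine ProbabilityMeasure.tendsto_of_tendsto_charFun fun t => ?_
    simp only [ProbabilityMeasure.coe_mk, Measure.map_id, charFun_gaussianReal]
    have hV : 0 ≤ 2 * (∫ u in (-1 : ℝ)..1, K u ^ 2) * σ2 ^ 2 := by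
      have : 0 ≤ ∫ u in (-1 : ℝ)..1, K u ^ 2 :=
        intervalIntegral.integral_nonneg (by norm_num) fun u _ => sq_nonneg _
      positivity
    have h1 := PanelCLT.tendsto_charFun_blockForm hC hK hS hσ' t
    convert! h1 using 2 with n
    · rw [← (hpath n).map_eq, Measure.map_map
        (((hC n).measurable_blockForm K _ _ _ _ _).const_mul _) (hpath n).measurable]
      rfl
    · rw [Real.coe_toNNReal _ hV]
      push_cast
      ring_nf
  -- Slutsky: the statistic differs from the normalized block form `X` by a term tending to zero in
  -- `L²`.
  refine tendstoInDistribution_of_tendstoInMeasure_sub _ _ hXlim ?_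
    fun n => (((hquad n).sub_const _).const_mul _).aemeasurable
  refine tendstoInMeasure_of_tendsto_eLpNorm (p := 2) (by norm_num) (fun n =>
    ((((hquad n).sub_const _).const_mul _).sub (hXm n)).aestronglyMeasurable)
    aestronglyMeasurable_const ?_
  refine (PanelCLT.tendsto_eLpNorm_kernelForm_sub_blockForm hC hK hS).congr' ?_
  filter_upwards [hgood, hTpos, hhpos] with n hn hT hpos
  have hT' : (0 : ℝ) < T n := by exact_mod_cast hT
  refine (eLpNorm_comp_measurePreserving (((((hC n).measurable_kernelForm K _ _).sub_const _).sub
    ((hC n).measurable_blockForm K _ _ _ _ _)).const_mul _).aestronglyMeasurable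
      (hpath n)).symm.trans ?_
  congr 1
  ext ω
  -- With `B = T h`, the normalization `h^{-1/2} / T` is exactly `(T B)^{-1/2}`.
  have hnorm : √(1 / h n) * (1 / T n) = (√(T n * (T n * h n)))⁻¹ := by
    rw [← mul_assoc, Real.sqrt_mul (by positivity), Real.sqrt_mul_self hT'.le, one_div,
      Real.sqrt_inv, mul_inv, one_div, mul_comm]
  have hint : ∫ ω', PanelCLT.quadForm (e (N n)) (g (N n)) (Λ (N n)) K (T n) (h n) ω' ∂P =
      1 / T n * ∫ y, PanelCLT.kernelForm (PanelCLT.project (g (N n)) (w n)) K (T n * h n) (T n) y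
        ∂(PanelCLT.iidLaw ℤ (P.map (e (N n) 0))) := by
    rw [← PanelCLT.integral_comp_measurePreserving (hpath n)
      ((hC n).measurable_kernelForm K _ _).aestronglyMeasurable, ← integral_const_mul, hn]
    simp_rw [PanelCLT.quadForm_eq_kernelForm]
  simp only [Function.comp_apply, Pi.sub_apply, Pi.zero_apply, sub_zero, X]
  rw [hint, PanelCLT.quadForm_eq_kernelForm, ← hnorm, hn]
  ring
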